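/- Let $\tfrac12<\alpha<1$ and put $\beta=\frac{4\alpha-2}{\alpha+1}$ and $\gamma=\frac{\alpha+1}{3}$. Let $\Omega\subset\mathbb R^2$ be a bounded open set. Notation. $\mathcal M_{div}(\Omega)$ is the set of finite $\mathbb R^2$-valued measures $u$ on $\overline\Omega$ whose weak divergence is a finite signed measure on $\overline\Omega$, where $\int\varphi\,d(\nabla\cdot u)=-\int\nabla\varphi\cdot du$ for all $\varphi\in C^1(\overline\Omega)$ (restrictions of $C^1$ functions on $\mathbb R^2$). Convergence in $\mathcal M_{div}(\Omega)$ means that $u_\varepsilon\rightharpoonup u$ and $\nabla\cdot u_\varepsilon\rightharpoonup\nabla\cdot u$ weakly as measures on $\overline\Omega$. A function $v\in L^1(\Omega,\mathbb R^2)$ is identified with the measure $v\,dx$ on $\Omega$. If $u=\theta\,\xi\,\mathcal H^1_{|M}$, with $M$ countably $\mathcal H^1$-rectifiable, $\theta\ge0$ and $\xi$ a unit vector field tangential to $M$ at $\mathcal H^1$-a.e. point, then $M^\alpha(u)=\int_M\theta^\alpha\,d\mathcal H^1$; otherwise $M^\alpha(u)=+\infty$. For $\varepsilon>0$, $$M^\alpha_\varepsilon(v)=\varepsilon^{\alpha-1}\int_\Omega|v|^\beta\,dx+\varepsilon^{\alpha+1}\int_\Omega|\nabla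 v|^2\,dx\quad\text{if }v\in H^1(\Omega,\mathbb R^2),\qquad M^\alpha_\varepsilon(v)=+\infty\text{ otherwise.}$$ The constant $c_0$ is the minimal value (infimum) $$c_0=\inf\Big\{\int_{\mathbb R}w^\beta+\int_{\mathbb R}|w'|^2\;:\;w\in H^1_{loc}(\mathbb R),\ w\ge0,\ \int_{\mathbb R}w=1\Big\}<+\infty .$$ Let $G$ be a finite weighted directed graph in $\Omega$: a finite set of vertices in $\Omega$ and a finite set $E$ of oriented edges $\mathbf e$, each of which is a segment $[a_{\mathbf e},b_{\mathbf e}]\subset\Omega$ joining two distinct vertices, with direction $\tau_{\mathbf e}=\frac{b_{\mathbf e}-a_{\mathbf e}}{|b_{\mathbf e}-a_{\mathbf e}|}$ and weight $\theta(\mathbf e)>0$. Let $$u=u_G=\sum_{\mathbf e\in E}\theta(\mathbf e)\,\tau_{\mathbf e}\,\mathcal H^1_{|[a_{\mathbf e},b_{\mathbf e}]} .$$ Lemma. One has $u\in\mathcal M_{div}(\Omega)$ and $M^\alpha(u)<+\infty$, and there exist a family $(u_\varepsilon)_{\varepsilon>0}\subset\mathcal M_{div}(\Omega)$ of integrable vector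 fields on $\Omega$ that converges to $u$ in $\mathcal M_{div}(\Omega)$ as $\varepsilon\to0$, and a constant $C$ not depending on $\varepsilon$, such that for all sufficiently small $\varepsilon>0$ one has $u_\varepsilon\in H^1_0(\Omega)$ (the closure of $C^\infty_c(\Omega,\mathbb R^2)$ in $H^1(\Omega,\mathbb R^2)$), $M^\alpha_\varepsilon(u_\varepsilon)<+\infty$, and 1. $\int_\Omega|u_\varepsilon|\,dx\le|u|(\Omega)+C\varepsilon^\gamma$, 2. $\int_\Omega|\nabla\cdot u_\varepsilon|\,dx\le|\nabla\cdot u|(\Omega)$, 3. $\varepsilon^\gamma\,\|\nabla\cdot u_\varepsilon\|_{L^2(\Omega)}\le C$, 4. $|M^\alpha_\varepsilon(u_\varepsilon)-c_0M^\alpha(u)|\le C\varepsilon^\gamma$. -/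

import Mathlib

open MeasureTheory Filter Topology
open scoped ENNReal NNReal ContDiff

noncomputable section

namespace BranchedTransport

/-- The Euclidean plane. -/
abbrev Plane : Type := EuclideanSpace ℝ (Fin 2)

/-! ### The exponents in dimension two -/

/-- `β = (4α - 2) / (α + 1)`. -/
def betaExp (α : ℝ) : ℝ := (4 * α - 2) / (α + 1)

/-- `γ₁ = 1 - α`. -/
def gammaOne (α : ℝ) : ℝ := 1 - α

/-- `γ₂ = α + 1`. -/
def gammaTwo (α : ℝ) : ℝ := α + 1

/-- `γ = γ₂ / 3 = (α + 1) / 3`. -/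
def gammaExp (α : ℝ) : ℝ := (α + 1) / 3

/-! ### Vector measures on the closure of `Ω` and their divergence

A finite `ℝ²`-valued measure on `closure Ω` is a vector measure on the plane whose variation does
not charge the complement of `closure Ω`. Since `closure Ω` is compact when `Ω` is bounded, its
continuous functions are the restrictions of the continuous functions on the plane; `C¹` functions
on `closure Ω` are the restrictions of `C¹` functions on the plane. -/

/-- The signed measure `ν` is carried by `closure Ω` and is the weak divergence of `u`:
`∫ φ dν = - ∫ ∇φ · du` for all `φ` of class `C¹` (with no condition on the boundary of `Ω`). -/
def HasWeakDiv (Ω : Set Plane) (u : VectorMeasure Plane Plane) (ν : SignedMeasure Plane) : Prop :=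
  ν.variation (closure Ω)ᶜ = 0 ∧
    ∀ φ : Plane → ℝ, ContDiff ℝ 1 φ →
      ν.integral φ (ContinuousLinearMap.lsmul ℝ ℝ) =
        -u.integral (fderiv ℝ φ) (ContinuousLinearMap.id ℝ (Plane →L[ℝ] ℝ))

/-- `u ∈ M_div(Ω)`: a finite vector measure on `closure Ω` whose weak divergence is a finite
measure. -/
def MemMdiv (Ω : Set Plane) (u : VectorMeasure Plane Plane) : Prop :=
  u.variation (closure Ω)ᶜ = 0 ∧ ∃ ν : SignedMeasure Plane, HasWeakDiv Ω u ν

open Classical in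
/-- The divergence `∇ · u` of `u ∈ M_div(Ω)` (and `0` if there is none). -/
def weakDiv (Ω : Set Plane) (u : VectorMeasure Plane Plane) : SignedMeasure Plane :=
  if h : ∃ ν : SignedMeasure Plane, HasWeakDiv Ω u ν then h.choose else 0

/-- Convergence in `M_div(Ω)`: weak convergence, as measures on `closure Ω`, of the vector measures
and of their divergences. -/
def TendstoMdiv {ι : Type*} (Ω : Set Plane) (l : Filter ι) (v : ι → VectorMeasure Plane Plane)
    (u : VectorMeasure Plane Plane) : Prop :=
  (∀ ψ : Plane → Plane, Continuous ψ →
    Tendsto (fun i => (v i).integral ψ (innerSL ℝ)) l (𝓝 (u.integral ψ (innerSL ℝ)))) ∧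
  ∀ φ : Plane → ℝ, Continuous φ →
    Tendsto (fun i => (weakDiv Ω (v i)).integral φ (ContinuousLinearMap.lsmul ℝ ℝ)) l
      (𝓝 ((weakDiv Ω u).integral φ (ContinuousLinearMap.lsmul ℝ ℝ)))

/-- The vector measure `v dx` on `Ω` of an integrable vector field `v`. -/
def fieldMeasure (Ω : Set Plane) (v : Plane → Plane) : VectorMeasure Plane Plane :=
  (volume.restrict Ω).withDensityᵥ v

/-! ### Transport paths -/

/-- A finite weighted directed graph in `Ω`. An oriented edge is the pair `(a, b)` of its distinct
end points; it is the segment `[a, b]`, directed by `(b - a) / |b - a|`. -/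
structure WeightedDigraph (Ω : Set Plane) where
  /-- the vertices -/
  V : Finset Plane
  /-- the oriented edges -/
  E : Finset (Plane × Plane)
  /-- the weights (only their values on `E` matter) -/
  θ : Plane × Plane → ℝ
  V_subset : ∀ x ∈ V, x ∈ Ω
  source_mem : ∀ e ∈ E, e.1 ∈ V
  target_mem : ∀ e ∈ E, e.2 ∈ V
  ne : ∀ e ∈ E, e.1 ≠ e.2
  segment_subset : ∀ e ∈ E, segment ℝ e.1 e.2 ⊆ Ω
  θ_pos : ∀ e ∈ E, 0 < θ e

/-- The unit vector directing an oriented edge. -/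
def direction (e : Plane × Plane) : Plane := ‖e.2 - e.1‖⁻¹ • (e.2 - e.1)

/-- The vector measure `u_G = ∑ₑ θ(e) τₑ H¹|ₑ` associated to the graph `G`. -/
def WeightedDigraph.measure {Ω : Set Plane} (G : WeightedDigraph Ω) : VectorMeasure Plane Plane :=
  ∑ e ∈ G.E, (μH[1].restrict (segment ℝ e.1 e.2)).withDensityᵥ (fun _ => G.θ e • direction e)

/-! ### The branched transportation energy -/

/-- `M` is countably `H¹`-rectifiable: up to an `H¹`-null set it is covered by countably many
Lipschitz curves. -/
def IsRectifiable (M : Set Plane) : Prop :=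
  ∃ f : ℕ → ℝ → Plane, (∀ n, ∃ K : ℝ≥0, LipschitzWith K (f n)) ∧
    μH[1] (M \ ⋃ n, Set.range (f n)) = 0

/-- `ξ` is tangential to the rectifiable set `M` at `H¹`-almost every point: along every Lipschitz
curve `c`, for almost every time `t` at which `c` is in `M`, the velocity of `c` (which exists for
almost every `t`) is parallel to `ξ (c t)`. -/
def IsTangential (M : Set Plane) (ξ : Plane → Plane) : Prop :=
  ∀ c : ℝ → Plane, (∃ K : ℝ≥0, LipschitzWith K c) →
    ∀ᵐ t : ℝ, c t ∈ M → deriv c t ∈ Submodule.span ℝ {ξ (c t)}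

/-- `u = U(M, θ, ξ) = θ ξ H¹|_M` is the rectifiable vector measure on `M` with multiplicity `θ` and
orientation `ξ`. -/
structure IsRectifiableRep (u : VectorMeasure Plane Plane) (M : Set Plane) (θ : Plane → ℝ)
    (ξ : Plane → Plane) : Prop where
  measurableSet : MeasurableSet M
  rectifiable : IsRectifiable M
  measurable_θ : Measurable θ
  measurable_ξ : Measurable ξ
  θ_nonneg : ∀ x ∈ M, 0 ≤ θ x
  norm_ξ : ∀ x ∈ M, ‖ξ x‖ = 1
  tangential : IsTangential M ξ
  integrable : IntegrableOn θ M μH[1]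
  eq : u = (μH[1].restrict M).withDensityᵥ (fun x => θ x • ξ x)

/-- `M^α(u) = ∫_M θ^α dH¹` if `u = U(M, θ, ξ)`, and `+∞` if `u` has no such representation. (The
integral is the same for all representations of `u`, so the infimum only selects it.) -/
def energy (α : ℝ) (u : VectorMeasure Plane Plane) : ℝ≥0∞ :=
  ⨅ (M : Set Plane) (θ : Plane → ℝ) (ξ : Plane → Plane) (_ : IsRectifiableRep u M θ ξ),
    ∫⁻ x in M, ENNReal.ofReal (θ x ^ α) ∂μH[1]

/-! ### Sobolev fields and the approximate energies -/

/-- The field `v` is in `H¹(Ω)`, with weak gradient `D`, where `D x i j` is the weak derivative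
`∂ⱼ vᵢ (x)`. -/
structure MemH1 (Ω : Set Plane) (v : Plane → Plane) (D : Plane → Matrix (Fin 2) (Fin 2) ℝ) :
    Prop where
  memLp : MemLp v 2 (volume.restrict Ω)
  memLp_grad : ∀ i j, MemLp (fun x => D x i j) 2 (volume.restrict Ω)
  weak_grad : ∀ i j, ∀ φ : Plane → ℝ, ContDiff ℝ ∞ φ → HasCompactSupport φ → tsupport φ ⊆ Ω →
    ∫ x in Ω, v x i * fderiv ℝ φ x (EuclideanSpace.single j 1) = -∫ x in Ω, D x i j * φ x

/-- The field `v`, with weak gradient `D`, is in `H¹₀(Ω)`, the closure in `H¹(Ω)` of the smooth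
fields with compact support in `Ω`. -/
def MemH10 (Ω : Set Plane) (v : Plane → Plane) (D : Plane → Matrix (Fin 2) (Fin 2) ℝ) : Prop :=
  MemH1 Ω v D ∧ ∃ ψ : ℕ → Plane → Plane,
    (∀ n, ContDiff ℝ ∞ (ψ n) ∧ HasCompactSupport (ψ n) ∧ tsupport (ψ n) ⊆ Ω) ∧
    Tendsto (fun n => eLpNorm (fun x => ψ n x - v x) 2 (volume.restrict Ω)) atTop (𝓝 0) ∧
    ∀ i j, Tendsto (fun n => eLpNorm
      (fun x => fderiv ℝ (ψ n) x (EuclideanSpace.single j 1) i - D x i j) 2 (volume.restrict Ω))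
      atTop (𝓝 0)

/-- `M^α_ε(v) = ε^(-γ₁) ∫_Ω |v|^β + ε^γ₂ ∫_Ω |∇v|²` if `v ∈ H¹(Ω)`, and `+∞` otherwise. (The weak
gradient is unique almost everywhere, so the infimum only selects it.) -/
def approxEnergy (α ε : ℝ) (Ω : Set Plane) (v : Plane → Plane) : ℝ≥0∞ :=
  ⨅ (D : Plane → Matrix (Fin 2) (Fin 2) ℝ) (_ : MemH1 Ω v D),
    ENNReal.ofReal (ε ^ (-gammaOne α)) * (∫⁻ x in Ω, ENNReal.ofReal (‖v x‖ ^ betaExp α)) +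
      ENNReal.ofReal (ε ^ gammaTwo α) *
        ∫⁻ x in Ω, ENNReal.ofReal (∑ i, ∑ j, D x i j ^ 2)

/-! ### The constant `c₀` -/

/-- `w ∈ H¹_loc(ℝ)` is nonnegative with integral one, and `g` is its weak derivative. -/
structure IsProfile (w g : ℝ → ℝ) : Prop where
  nonneg : ∀ x, 0 ≤ w x
  memLp_loc : ∀ K : Set ℝ, IsCompact K → MemLp w 2 (volume.restrict K)
  memLp_loc_deriv : ∀ K : Set ℝ, IsCompact K → MemLp g 2 (volume.restrict K)
  weak_deriv : ∀ φ : ℝ → ℝ, ContDiff ℝ ∞ φ → HasCompactSupport φ →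
    ∫ x, w x * deriv φ x = -∫ x, g x * φ x
  lintegral_eq_one : ∫⁻ x, ENNReal.ofReal (w x) = 1

/-- `c₀`, the minimal value of `∫ w^β + ∫ |w'|²` over the profiles `w`. -/
def cZero (α : ℝ) : ℝ≥0∞ :=
  ⨅ (w : ℝ → ℝ) (g : ℝ → ℝ) (_ : IsProfile w g),
    (∫⁻ x, ENNReal.ofReal (w x ^ betaExp α)) + ∫⁻ x, ENNReal.ofReal (g x ^ 2)

end BranchedTransport

end

open MeasureTheory Filter Topology
open scoped ENNReal NNReal ContDiff

noncomputable section

namespace BranchedTransport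

/-! Everything happens at the scale `δ = ε^γ`. For this choice `ε^(α-1) = δ^(β-1)` and `ε^(α+1) =
δ³`, so a field `δ⁻¹ W(y/δ) τ`, with `y` the coordinate transversal to a segment of direction `τ`,
costs exactly `∫ W^β + ∫ W'²` per unit length, whatever `δ` is. If each edge of weight `θ` carries a
profile of mass `θ` and cost `c₀ θ^α`, the energy along the edges is already the limit energy, and
only neighbourhoods of vertices and crossings produce errors.

Profiles. The infimum `c₀` is attained by a compactly supported `C¹` function. The first integral
`(P')² = P^β - P` of the Euler equation is solved by a power of a sine after a change of time
(`exists_isUnitProfile`). Conversely, a calibration shows that a profile of mass one and maximum `M`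
costs at least `M^(β-1) + 4 M^(1+β/2) cal β 1` (`profile_lower_bound`), and this is smallest at the
height of the rescaled `P` (`optimal_height`). A two-parameter scaling then gives mass `θ` at cost
`c₀ θ^α` (`cZero_and_edgeProfiles`).

Gluing. `exists_isJet` provides a `C¹` field whose divergence is exactly `θ σ`, with `σ` a kernel in
the unit ball, and which away from the origin is a jet of profile `W` along a half-line. Subtracting
the rescaled jets issued from the two ends of an edge leaves the strip along the edge
(`IsJet.edgeField_eq`). The divergence of the sum over the edges is the convolution of `∇·u` with
the rescaled kernel: its `L¹` norm is at most `∑ |flux|`, without error, and its `L²` norm is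
`O(1/δ)`. Outside an exceptional set of area `O(δ²)` (balls around the vertices, overlaps of two
strips) at most one strip is active, so the norm and the energy density of the field are sums of
strip functions with known integrals. On the exceptional set both are `O(1/δ)`. Hence all errors are
`O(δ) = O(ε^γ)`.

Reduction. Edges of the given graph may overlap, and then their weights are not the multiplicities
of `u`. `WeightedDigraph.exists_isSimple` rewrites `u` as the measure of a graph whose edges meet
pairwise in at most one point. For such graphs the mass and the energy are read off the edges
(`IsSimple.mass_le_variation`, `IsSimple.energy_eq`). -/

theorem norm_mul_integrable_of_withDensity {X E F : Type*} [MeasurableSpace X]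
    [NormedAddCommGroup E] [NormedAddCommGroup F] {μ : Measure X} {f : X → F} (hf : Integrable f μ)
    {g : X → E} (hg : Integrable g (μ.withDensity fun x => ‖f x‖ₑ)) :
    Integrable (fun x => ‖f x‖ * ‖g x‖) μ := by
  have h := (integrable_withDensity_iff_integrable_smul₀' hf.aestronglyMeasurable.enorm
    (by filter_upwards with x using by simp)).1 hg.norm
  simpa using! h

/-! ### Integration against a vector measure with density -/

section WithDensity

variable {X E F H : Type*} [MeasurableSpace X] [NormedAddCommGroup E] [NormedSpace ℝ E]
  [NormedAddCommGroup F] [NormedSpace ℝ F] 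
  [CompleteSpace F] [NormedAddCommGroup H] [NormedSpace ℝ H] [CompleteSpace H]

/-- Both sides are additive in `g` and continuous for the `L¹` norm of the variation, which has
density `‖f‖` with respect to `μ`. They agree on constants times indicators, so
`Integrable.induction` applies. -/
theorem integral_withDensityᵥ {μ : Measure X} {f : X → F} (hf : Integrable f μ)
    (B : E →L[ℝ] F →L[ℝ] H) {g : X → E} (hg : (μ.withDensityᵥ f).Integrable g) :
    (μ.withDensityᵥ f).integral g B = ∫ x, B (g x) (f x) ∂μ := by
  have hv : (μ.withDensityᵥ f).variation = μ.withDensity fun x => ‖f x‖ₑ :=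
    Measure.variation_withDensityᵥ hf
  have : IsFiniteMeasure (μ.withDensityᵥ f).variation := by
    rw [hv]; exact ⟨by simpa using! hf.2⟩
  have key : ∀ g : X → E, StronglyMeasurable g → (μ.withDensityᵥ f).Integrable g →
      Integrable (fun x => B (g x) (f x)) μ := by
    intro g hgm hg
    unfold VectorMeasure.Integrable at hg
    rw [hv] at hg
    refine ((norm_mul_integrable_of_withDensity hf hg).const_mul ‖B‖).mono'
      (B.aestronglyMeasurable_comp₂ hgm.aestronglyMeasurable hf.aestronglyMeasurable) ?_
    filter_upwards with x
    calc ‖B (g x) (f x)‖ ≤ ‖B‖ * ‖g x‖ * ‖f x‖ := B.le_opNorm₂ _ _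
      _ = _ := by ring
  -- A null set of the variation is `μ`-null only where `f ≠ 0`; where `f = 0` the integrand `B (g
  -- x) (f x)` vanishes whatever `g` is.
  have hae : ∀ g g' : X → E, g =ᵐ[(μ.withDensityᵥ f).variation] g' →
      (fun x => B (g x) (f x)) =ᵐ[μ] fun x => B (g' x) (f x) := by
    intro g g' h
    rw [hv, EventuallyEq, ae_withDensity_iff' hf.aestronglyMeasurable.enorm] at h
    filter_upwards [h] with x hx
    by_cases h0 : f x = 0
    · simp [h0]
    · rw [hx (by simpa using h0)]
  have key' : ∀ g : X → E, (μ.withDensityᵥ f).Integrable g →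
      Integrable (fun x => B (g x) (f x)) μ := by
    intro g hg
    refine (key (hg.1.mk g) hg.1.stronglyMeasurable_mk (hg.congr hg.1.ae_eq_mk)).congr ?_
    exact (hae _ _ hg.1.ae_eq_mk).symm
  have key2 : ∀ h : X → E, ∫ a, ‖h a‖ ∂(μ.withDensityᵥ f).variation =
      ∫ a, ‖f a‖ * ‖h a‖ ∂μ := fun h => by
    rw [hv, integral_withDensity_eq_integral_toReal_smul₀ hf.aestronglyMeasurable.enorm
      (by filter_upwards with x using by simp)]
    simp
  have key3 : ∀ h : X → E, Integrable h (μ.withDensityᵥ f).variation →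
      Integrable (fun a => ‖f a‖ * ‖h a‖) μ := fun h hh => by
    rw [hv] at hh
    exact norm_mul_integrable_of_withDensity hf hh
  refine Integrable.induction
    (P := fun g : X → E => (μ.withDensityᵥ f).integral g B = ∫ x, B (g x) (f x) ∂μ)
    ?_ ?_ ?_ ?_ hg
  · intro c s hs _
    rw [VectorMeasure.integral_indicator_const c hs]
    rw [withDensityᵥ_apply hf hs, ← ContinuousLinearMap.integral_comp_comm _ hf.restrict,
      ← integral_indicator hs]
    congr with x
    by_cases hx : x ∈ s <;> simp [hx]
  · intro g g' _ hg hg' h1 h2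
    rw [VectorMeasure.integral_add hg hg', h1, h2, ← integral_add (key' g hg) (key' g' hg')]
    simp
  · refine isClosed_eq VectorMeasure.continuous_integral ?_
    refine LipschitzWith.continuous (K := ‖B‖₊) (LipschitzWith.of_dist_le_mul fun u v => ?_)
    have hu := L1.integrable_coeFn u
    have hv' := L1.integrable_coeFn v
    rw [dist_eq_norm, ← integral_sub (key' _ hu) (key' _ hv'), dist_eq_norm, L1.norm_eq_integral_norm]
    have e1 : ∫ a, ‖(u - v) a‖ ∂(μ.withDensityᵥ f).variation = ∫ a, ‖f a‖ * ‖u a - v a‖ ∂μ := by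
      rw [integral_congr_ae (g := fun a => ‖u a - v a‖)]
      · exact key2 fun a => u a - v a
      · filter_upwards [Lp.coeFn_sub u v] with a ha
        rw [ha]; rfl
    rw [e1, coe_nnnorm, ← integral_const_mul]
    have hi : Integrable (fun a => ‖f a‖ * ‖u a - v a‖) μ := by
      exact key3 _ (hu.sub hv')
    refine norm_integral_le_of_norm_le (hi.const_mul _) ?_
    filter_upwards with x
    rw [← _root_.sub_apply, ← map_sub]
    calc _ ≤ ‖B‖ * ‖u x - v x‖ * ‖f x‖ := B.le_opNorm₂ _ _
      _ = _ := by ring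
  · intro g g' h _ h1
    rw [← VectorMeasure.integral_congr_ae h, h1]
    exact integral_congr_ae (hae _ _ h)

end WithDensity

/-- A vector measure of finite variation carried by a compact set integrates continuous
functions. -/
theorem integrable_of_variation_compl {F E : Type*} [NormedAddCommGroup F] [NormedAddCommGroup E]
    {u : VectorMeasure Plane F} (hfin : u.variation Set.univ ≠ ⊤) {K : Set Plane}
    (hK : IsCompact K) (hu : u.variation Kᶜ = 0) {g : Plane → E} (hg : Continuous g) :
    u.Integrable g := by
  have : IsFiniteMeasure u.variation := ⟨hfin.lt_top⟩
  have h1 : IntegrableOn g K u.variation := hg.continuousOn.integrableOn_compact hK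
  unfold VectorMeasure.Integrable
  rw [← integrableOn_univ, ← Set.union_compl_self K]
  exact h1.union (by rw [IntegrableOn, Measure.restrict_eq_zero.2 hu]; exact integrable_zero_measure)

/-! ### Uniqueness of the weak divergence -/

theorem signedMeasure_variation_ne_top {X : Type*} [MeasurableSpace X] (ν : SignedMeasure X) :
    ν.variation Set.univ ≠ ⊤ := by
  rw [← SignedMeasure.totalVariation_eq_variation]
  exact measure_ne_top _ _

theorem signedMeasure_eq_zero_of_forall_isOpen {ν : SignedMeasure Plane}
    (h : ∀ U, IsOpen U → ν U = 0) : ν = 0 := by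
  have hfin := signedMeasure_variation_ne_top ν
  ext s hs
  refine MeasurableSpace.induction_on_inter (C := fun s _ => ν s = (0 : SignedMeasure Plane) s)
    (BorelSpace.measurable_eq (α := Plane)) isPiSystem_isOpen ?_ ?_ ?_ ?_ s hs
  · simp
  · intro t ht; simpa using! h t ht
  · intro t ht h0
    have := VectorMeasure.of_union (v := ν) disjoint_compl_right ht ht.compl
    rw [Set.union_compl_self, h _ isOpen_univ, h0] at this
    simpa using! this.symm
  · intro f hd hm h0
    rw [VectorMeasure.of_disjoint_iUnion hm hd]
    simp [h0]

/-- The indicator of an open set `U` is a bounded pointwise limit of `C¹` functions: if `f ≥ 0` is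
`C¹` with support exactly `U`, then `smoothTransition (n f)` is `0` off `U` and eventually `1` at
each point of `U`. Dominated convergence gives `ν U = 0`, and open sets determine `ν`. -/
theorem signedMeasure_eq_zero_of_integral {ν : SignedMeasure Plane}
    (h : ∀ φ : Plane → ℝ, ContDiff ℝ 1 φ → ν.integral φ (ContinuousLinearMap.lsmul ℝ ℝ) = 0) :
    ν = 0 := by
  have hfin := signedMeasure_variation_ne_top ν
  have : IsFiniteMeasure ν.variation := ⟨hfin.lt_top⟩
  refine signedMeasure_eq_zero_of_forall_isOpen fun U hU => ?_
  obtain ⟨f, hf, hfs, hf01⟩ := hU.exists_contDiff_support_eq (n := 1)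
  set g : ℕ → Plane → ℝ := fun n x => Real.smoothTransition (n * f x) with hg
  have hgc : ∀ n, ContDiff ℝ 1 (g n) := fun n =>
    Real.smoothTransition.contDiff.comp (contDiff_const.mul hfs)
  have hlim : ∀ x, Tendsto (fun n => g n x) atTop (𝓝 (U.indicator (fun _ => (1:ℝ)) x)) := by
    intro x
    by_cases hx : x ∈ U
    · have hpos : 0 < f x := by
        have : x ∈ Function.support f := hf ▸ hx
        exact lt_of_le_of_ne (hf01 ⟨x, rfl⟩).1 (Ne.symm this)
      refine tendsto_const_nhds.congr' ?_
      obtain ⟨N, hN⟩ := exists_nat_gt (1 / f x)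
      filter_upwards [eventually_ge_atTop N] with n hn
      rw [Set.indicator_of_mem hx, hg]
      refine (Real.smoothTransition.one_of_one_le ?_).symm
      have : (1 : ℝ) / f x ≤ n := hN.le.trans (by exact_mod_cast hn)
      rwa [div_le_iff₀ hpos] at this
    · have h0 : f x = 0 := by
        by_contra hne
        exact hx (hf ▸ (show x ∈ Function.support f from hne))
      simp [hg, h0, hx, Real.smoothTransition.zero]
  have := VectorMeasure.tendsto_integral_of_dominated_convergence (μ := ν)
    (B := ContinuousLinearMap.lsmul ℝ ℝ)
    (f := U.indicator fun _ => (1:ℝ)) (fun _ => 1) (fun n => (hgc n).continuous.aestronglyMeasurable)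
    (integrable_const _) (fun n => by
      filter_upwards with x
      rw [Real.norm_of_nonneg (Real.smoothTransition.nonneg _)]
      exact Real.smoothTransition.le_one _)
    (by filter_upwards with x using hlim x)
  rw [VectorMeasure.integral_indicator_const _ hU.measurableSet] at this
  simp only [h _ (hgc _)] at this
  simpa using (tendsto_nhds_unique this tendsto_const_nhds)

theorem HasWeakDiv.unique {Ω : Set Plane} (hΩ : Bornology.IsBounded Ω)
    {u : VectorMeasure Plane Plane} {ν ν' : SignedMeasure Plane} (h : HasWeakDiv Ω u ν)
    (h' : HasWeakDiv Ω u ν') : ν = ν' := by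
  rw [← sub_eq_zero]
  refine signedMeasure_eq_zero_of_integral fun φ hφ => ?_
  rw [VectorMeasure.integral_sub_vectorMeasure, h.2 φ hφ, h'.2 φ hφ, sub_self]
  · exact integrable_of_variation_compl (signedMeasure_variation_ne_top _) hΩ.isCompact_closure
      h.1 hφ.continuous
  · exact integrable_of_variation_compl (signedMeasure_variation_ne_top _) hΩ.isCompact_closure
      h'.1 hφ.continuous

/-- Makes the choice inside `weakDiv` harmless: any divergence computed by hand is the selected one.
-/
theorem HasWeakDiv.weakDiv_eq {Ω : Set Plane} (hΩ : Bornology.IsBounded Ω)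
    {u : VectorMeasure Plane Plane} {ν : SignedMeasure Plane} (h : HasWeakDiv Ω u ν) :
    weakDiv Ω u = ν := by
  have hex : ∃ ν : SignedMeasure Plane, HasWeakDiv Ω u ν := ⟨ν, h⟩
  rw [weakDiv, dif_pos hex]
  exact hex.choose_spec.unique hΩ h

/-! ### Orthonormal frames of the plane -/

/-- The rotation by a right angle. -/
def perp (x : Plane) : Plane := !₂[-x 1, x 0]

@[simp] theorem perp_zero_coord (x : Plane) : perp x 0 = -x 1 := by simp [perp]

@[simp] theorem perp_one_coord (x : Plane) : perp x 1 = x 0 := by simp [perp]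

theorem inner_eq (x y : Plane) : inner ℝ x y = x 0 * y 0 + x 1 * y 1 := by
  simp [PiLp.inner_apply, Fin.sum_univ_two, mul_comm]

theorem norm_sq_eq (x : Plane) : ‖x‖ ^ 2 = x 0 ^ 2 + x 1 ^ 2 := by
  simp [EuclideanSpace.norm_sq_eq, Fin.sum_univ_two]

theorem sq_add_sq_of_unit {τ : Plane} (h : ‖τ‖ = 1) : τ 0 ^ 2 + τ 1 ^ 2 = 1 := by
  rw [← norm_sq_eq, h, one_pow]

theorem norm_perp (x : Plane) : ‖perp x‖ = ‖x‖ := by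
  have : ‖perp x‖ ^ 2 = ‖x‖ ^ 2 := by simp [norm_sq_eq, add_comm]
  exact (sq_eq_sq₀ (norm_nonneg _) (norm_nonneg _)).1 this

theorem inner_perp_self (τ : Plane) : inner ℝ (perp τ) τ = 0 := by
  simp [inner_eq]; ring

theorem frame_decomp {τ : Plane} (h : ‖τ‖ = 1) (x : Plane) :
    x = inner ℝ τ x • τ + inner ℝ (perp τ) x • perp τ := by
  have h1 := sq_add_sq_of_unit h
  ext i
  fin_cases i
  · simp [inner_eq]; linear_combination (-x 0) * h1
  · simp [inner_eq]; linear_combination (-x 1) * h1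

theorem frame_norm_sq {τ : Plane} (h : ‖τ‖ = 1) (x : Plane) :
    ‖x‖ ^ 2 = inner ℝ τ x ^ 2 + inner ℝ (perp τ) x ^ 2 := by
  have h1 := sq_add_sq_of_unit h
  simp only [norm_sq_eq, inner_eq, perp_zero_coord, perp_one_coord]
  linear_combination (-(x 0 ^ 2 + x 1 ^ 2)) * h1

/-! ### Measures on segments -/

theorem isometry_line (a : Plane) {τ : Plane} (h : ‖τ‖ = 1) :
    Isometry fun s : ℝ => a + s • τ := by
  refine Isometry.of_dist_eq fun s t => ?_
  rw [dist_add_left, dist_eq_norm, ← sub_smul, norm_smul, h, mul_one, Real.dist_eq,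
    Real.norm_eq_abs]

theorem segment_eq_image_line (a τ : Plane) {L : ℝ} (hL : 0 ≤ L) :
    segment ℝ a (a + L • τ) = (fun s : ℝ => a + s • τ) '' Set.Icc 0 L := by
  rcases hL.eq_or_lt with rfl | hL
  · simp
  rw [segment_eq_image']
  ext x
  simp only [Set.mem_image, add_sub_cancel_left]
  constructor
  · rintro ⟨t, ht, rfl⟩
    exact ⟨t * L, ⟨by nlinarith [ht.1], by nlinarith [ht.2]⟩, by rw [mul_smul]⟩
  · rintro ⟨s, hs, rfl⟩
    refine ⟨s / L, ⟨div_nonneg hs.1 hL.le, (div_le_one hL).2 hs.2⟩, ?_⟩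
    rw [smul_smul, div_mul_cancel₀ _ hL.ne']

/-- Arc length parametrizes the line isometrically, isometries transport `μH[1]` to its restriction
to the range, and on `ℝ` this measure is Lebesgue measure. -/
theorem hausdorffMeasure_restrict_segment (a : Plane) {τ : Plane} (h : ‖τ‖ = 1) {L : ℝ}
    (hL : 0 ≤ L) :
    (μH[1] : Measure Plane).restrict (segment ℝ a (a + L • τ)) =
      Measure.map (fun s : ℝ => a + s • τ) (volume.restrict (Set.Icc 0 L)) := by
  have hi := isometry_line a h
  have hm : MeasurableEmbedding fun s : ℝ => a + s • τ := hi.isClosedEmbedding.measurableEmbedding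
  have h1 := hi.map_hausdorffMeasure (d := 1) (Or.inl zero_le_one)
  rw [hausdorffMeasure_real] at h1
  have hs := segment_eq_image_line a τ hL
  have hmeas : MeasurableSet (segment ℝ a (a + L • τ)) := by
    rw [hs]; exact hm.measurableSet_image.2 measurableSet_Icc
  have h2 := congrArg (fun μ => Measure.restrict μ (segment ℝ a (a + L • τ))) h1
  simp only at h2
  rw [hm.restrict_map, Measure.restrict_restrict hmeas, Set.inter_eq_left.2
    (by rw [hs]; exact Set.image_subset_range _ _), hs, Set.preimage_image_eq _ hi.injective] at h2
  rw [hs, h2]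

theorem norm_direction {e : Plane × Plane} (he : e.1 ≠ e.2) : ‖direction e‖ = 1 := by
  have : ‖e.2 - e.1‖ ≠ 0 := norm_ne_zero_iff.2 (sub_ne_zero.2 he.symm)
  simp [direction, norm_smul, this]

theorem add_norm_smul_direction {e : Plane × Plane} (he : e.1 ≠ e.2) :
    e.1 + ‖e.2 - e.1‖ • direction e = e.2 := by
  have : ‖e.2 - e.1‖ ≠ 0 := norm_ne_zero_iff.2 (sub_ne_zero.2 he.symm)
  simp [direction, smul_smul, this]

theorem setIntegral_segment {e : Plane × Plane} (he : e.1 ≠ e.2) {F : Type*}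
    [NormedAddCommGroup F] [NormedSpace ℝ F] (f : Plane → F) :
    ∫ x in segment ℝ e.1 e.2, f x ∂μH[1] =
      ∫ s in Set.Icc 0 ‖e.2 - e.1‖, f (e.1 + s • direction e) := by
  have h := hausdorffMeasure_restrict_segment e.1 (norm_direction he) (norm_nonneg (e.2 - e.1))
  rw [add_norm_smul_direction he] at h
  rw [h, ((isometry_line e.1 (norm_direction he)).isClosedEmbedding.measurableEmbedding).integral_map]

theorem isCompact_segment (a b : Plane) : IsCompact (segment ℝ a b) := by
  rw [segment_eq_image']
  exact isCompact_Icc.image (by fun_prop)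

theorem measurableSet_segment (a b : Plane) : MeasurableSet (segment ℝ a b) :=
  (isCompact_segment a b).isClosed.measurableSet

theorem hausdorffMeasure_segment_ne_top (a b : Plane) : μH[1] (segment ℝ a b) ≠ ⊤ := by
  rw [hausdorffMeasure_segment]; exact edist_ne_top _ _

theorem integrable_const_segment (a b v : Plane) :
    Integrable (fun _ => v) ((μH[1] : Measure Plane).restrict (segment ℝ a b)) := by
  have : IsFiniteMeasure ((μH[1] : Measure Plane).restrict (segment ℝ a b)) :=
    ⟨by simpa using (hausdorffMeasure_segment_ne_top a b).lt_top⟩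
  exact integrable_const _

/-! ### The vector measure of a graph and its divergence -/

namespace WeightedDigraph

variable {Ω : Set Plane} (G : WeightedDigraph Ω)

theorem measure_apply {A : Set Plane} (hA : MeasurableSet A) :
    G.measure A = ∑ e ∈ G.E, (μH[1] (A ∩ segment ℝ e.1 e.2)).toReal • G.θ e • direction e := by
  rw [measure, FunLike.coe_sum, Finset.sum_apply]
  refine Finset.sum_congr rfl fun e _ => ?_
  rw [withDensityᵥ_apply (integrable_const_segment _ _ _) hA, Measure.restrict_restrict hA,
    setIntegral_const, Measure.real]

theorem variation_edge (e : Plane × Plane) :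
    ((μH[1].restrict (segment ℝ e.1 e.2)).withDensityᵥ
      (fun _ => G.θ e • direction e)).variation =
    ‖G.θ e • direction e‖ₑ • (μH[1] : Measure Plane).restrict (segment ℝ e.1 e.2) := by
  rw [Measure.variation_withDensityᵥ (integrable_const_segment _ _ _), withDensity_const]

theorem variation_le : G.measure.variation ≤
    ∑ e ∈ G.E, ‖G.θ e • direction e‖ₑ • (μH[1] : Measure Plane).restrict (segment ℝ e.1 e.2) := by
  refine (VectorMeasure.variation_finsetSum_le _ _).trans (le_of_eq ?_)
  exact Finset.sum_congr rfl fun e _ => G.variation_edge e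

theorem variation_compl_closure : G.measure.variation (closure Ω)ᶜ = 0 := by
  refine le_antisymm ((G.variation_le _).trans (le_of_eq ?_)) zero_le
  simp only [Measure.coe_finsetSum, Finset.sum_apply, Measure.smul_apply, smul_eq_mul]
  refine Finset.sum_eq_zero fun e he => ?_
  rw [Measure.restrict_apply isClosed_closure.measurableSet.compl]
  have : (closure Ω)ᶜ ∩ segment ℝ e.1 e.2 = ∅ := by
    rw [← Set.disjoint_iff_inter_eq_empty, Set.disjoint_compl_left_iff_subset]
    exact (G.segment_subset e he).trans subset_closure
  simp [this]

theorem integral_measure {E' H : Type*} [NormedAddCommGroup E'] [NormedSpace ℝ E']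
    [NormedAddCommGroup H] [NormedSpace ℝ H] [CompleteSpace H] {g : Plane → E'}
    (hg : Continuous g) (B : E' →L[ℝ] Plane →L[ℝ] H) :
    G.measure.integral g B = ∑ e ∈ G.E,
      ∫ s in Set.Icc 0 ‖e.2 - e.1‖, B (g (e.1 + s • direction e)) (G.θ e • direction e) := by
  have hint : ∀ e : Plane × Plane, ((μH[1].restrict (segment ℝ e.1 e.2)).withDensityᵥ
      (fun _ => G.θ e • direction e)).Integrable g := fun e => by
    refine integrable_of_variation_compl ?_ (isCompact_segment e.1 e.2) ?_ hg
    · rw [G.variation_edge]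
      simpa using! ENNReal.mul_ne_top enorm_ne_top (hausdorffMeasure_segment_ne_top _ _)
    · rw [G.variation_edge]
      simp [Measure.restrict_apply (measurableSet_segment e.1 e.2).compl]
  rw [measure, VectorMeasure.integral_finsetSum_vectorMeasure fun e _ => hint e]
  refine Finset.sum_congr rfl fun e he => ?_
  rw [integral_withDensityᵥ (integrable_const_segment _ _ _) B (hint e),
    setIntegral_segment (G.ne e he)]

/-- The divergence of the transport path: the outgoing weights minus the incoming ones, at each
vertex. -/
def flux (v : Plane) : ℝ := by
  classical
  exact ∑ e ∈ G.E, G.θ e * ((if e.1 = v then 1 else 0) - (if e.2 = v then 1 else 0))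

/-- Discrete summation by parts. It serves twice: with `F` a test function for the divergence of the
path, and with `F` a rescaled kernel for the divergence of the approximating field. -/
theorem sum_flux_smul {M : Type*} [AddCommGroup M] [Module ℝ M] (F : Plane → M) :
    ∑ v ∈ G.V, G.flux v • F v = ∑ e ∈ G.E, G.θ e • (F e.1 - F e.2) := by
  classical
  simp only [flux, Finset.sum_smul]
  rw [Finset.sum_comm]
  refine Finset.sum_congr rfl fun e he => ?_
  simp only [mul_smul, sub_smul, ← Finset.smul_sum, Finset.sum_sub_distrib, ite_smul, one_smul,
    zero_smul, Finset.sum_ite_eq, G.source_mem e he, G.target_mem e he, if_true]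

/-- The weak divergence of the transport path. -/
def divMeasure : SignedMeasure Plane := ∑ v ∈ G.V, VectorMeasure.dirac v (G.flux v)

theorem integral_dirac_of_continuous {φ : Plane → ℝ} (hφ : Continuous φ) (v : Plane) (c : ℝ) :
    (VectorMeasure.dirac v c).integral φ (ContinuousLinearMap.lsmul ℝ ℝ) = φ v * c := by
  rw [VectorMeasure.integral_dirac' hφ.stronglyMeasurable]
  simp

theorem divMeasure_variation_compl : G.divMeasure.variation (closure Ω)ᶜ = 0 := by
  refine le_antisymm ((VectorMeasure.variation_finsetSum_le _ _ _).trans (le_of_eq ?_)) zero_le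
  simp only [Measure.coe_finsetSum, Finset.sum_apply]
  refine Finset.sum_eq_zero fun v hv => ?_
  have : v ∈ closure Ω := subset_closure (G.V_subset v hv)
  simp [VectorMeasure.variation_dirac, this]

theorem integral_divMeasure {φ : Plane → ℝ} (hφ : Continuous φ) :
    G.divMeasure.integral φ (ContinuousLinearMap.lsmul ℝ ℝ) = ∑ v ∈ G.V, G.flux v * φ v := by
  rw [divMeasure, VectorMeasure.integral_finsetSum_vectorMeasure]
  · exact Finset.sum_congr rfl fun v _ => by rw [integral_dirac_of_continuous hφ, mul_comm]
  · intro v _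
    refine integrable_of_variation_compl (K := {v}) (signedMeasure_variation_ne_top _)
      isCompact_singleton ?_ hφ
    simp [VectorMeasure.variation_dirac]

/-- The fundamental theorem of calculus along each edge leaves the values of `φ` at the two ends;
summation by parts regroups them by vertices. -/
theorem hasWeakDiv : HasWeakDiv Ω G.measure G.divMeasure := by
  refine ⟨G.divMeasure_variation_compl, fun φ hφ => ?_⟩
  rw [G.integral_divMeasure hφ.continuous, G.integral_measure (hφ.continuous_fderiv one_ne_zero)]
  have := G.sum_flux_smul φ
  simp only [smul_eq_mul] at this
  rw [this, ← Finset.sum_neg_distrib]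
  refine Finset.sum_congr rfl fun e he => ?_
  have hL := norm_nonneg (e.2 - e.1)
  rw [integral_Icc_eq_integral_Ioc, ← intervalIntegral.integral_of_le hL,
    intervalIntegral.integral_eq_sub_of_hasDerivAt (f := fun s => G.θ e * φ (e.1 + s • direction e))]
  · rw [add_norm_smul_direction (G.ne e he)]
    simp; ring
  · intro s _
    have h1 : HasDerivAt (fun s : ℝ => e.1 + s • direction e) (direction e) s := by
      simpa using ((hasDerivAt_id s).smul_const (direction e)).const_add e.1
    have h2 := (((hφ.differentiable one_ne_zero) (e.1 + s • direction e)).hasFDerivAt.comp_hasDerivAt s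
      h1).const_mul (G.θ e)
    simpa using h2
  · apply Continuous.intervalIntegrable
    have := hφ.continuous_fderiv one_ne_zero
    simp only [ContinuousLinearMap.id_apply]
    fun_prop

theorem memMdiv : MemMdiv Ω G.measure :=
  ⟨G.variation_compl_closure, _, G.hasWeakDiv⟩

/-- Distinct vertices carry distinct atoms, and the variation of an atom is at least its absolute
mass. Only this inequality is needed for the `L¹` bound on the divergence. -/
theorem sum_abs_flux_le_variation :
    ∑ v ∈ G.V, ‖G.flux v‖ₑ ≤ G.divMeasure.variation Ω := by
  have h1 : ∑ v ∈ G.V, G.divMeasure.variation {v} = G.divMeasure.variation (⋃ v ∈ G.V, {v}) := by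
    rw [measure_biUnion_finset]
    · intro v _ w _ hvw
      exact Set.disjoint_singleton.2 hvw
    · exact fun v _ => measurableSet_singleton v
  have h2 : (⋃ v ∈ G.V, {v}) ⊆ Ω := by
    simp only [Set.iUnion_subset_iff, Set.singleton_subset_iff]
    exact G.V_subset
  refine le_trans ?_ (h1.le.trans (measure_mono h2))
  refine Finset.sum_le_sum fun v hv => ?_
  refine le_trans (le_of_eq ?_) (VectorMeasure.enorm_measure_le_variation _ _)
  congr 1
  classical
  rw [divMeasure, FunLike.coe_sum, Finset.sum_apply, Finset.sum_eq_single v]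
  · rw [VectorMeasure.dirac_apply_of_mem (measurableSet_singleton v) (Set.mem_singleton v)]
  · intro w _ hw
    rw [VectorMeasure.dirac_apply_of_notMem (by simpa using hw)]
  · exact fun h => absurd hv h

end WeightedDigraph

/-- A curve that lies in a line segment at the times of a set is tangent to it at almost all of
them. -/
theorem ae_deriv_mem_span (c : ℝ → Plane) (a : Plane) {τ : Plane} (hτ : ‖τ‖ = 1) :
    ∀ᵐ t : ℝ, inner ℝ (perp τ) (c t - a) = 0 → deriv c t ∈ Submodule.span ℝ {τ} := by
  set S : Set ℝ := {t | inner ℝ (perp τ) (c t - a) = 0} with hS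
  -- Points of `S` isolated from the right in `S` are countably many, hence null. At any other time,
  -- difference quotients can be taken along `S`, where the normal coordinate is identically zero.
  have hc : {t ∈ S | 𝓝[S ∩ Set.Ioi t] t = ⊥}.Countable := countable_setOfPred_isolated_right_within
  have hnull := hc.measure_zero (volume : Measure ℝ)
  filter_upwards [compl_mem_ae_iff.2 hnull] with t ht hts
  have hne : (𝓝[S ∩ Set.Ioi t] t).NeBot := ⟨fun h => ht ⟨hts, h⟩⟩
  by_cases hd : DifferentiableAt ℝ c t
  swap
  · rw [deriv_zero_of_not_differentiableAt hd]; exact zero_mem _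
  have h1 : HasDerivAt (fun s => inner ℝ (perp τ) (c s - a)) (inner ℝ (perp τ) (deriv c t)) t := by
    have := (innerSL ℝ (perp τ)).hasFDerivAt.comp_hasDerivAt t (hd.hasDerivAt.sub_const a)
    simpa using! this
  have h2 := (hasDerivWithinAt_iff_tendsto_slope' (by simp)).1
    (h1.hasDerivWithinAt (s := S ∩ Set.Ioi t))
  have h3 : Tendsto (slope (fun s => inner ℝ (perp τ) (c s - a)) t) (𝓝[S ∩ Set.Ioi t] t) (𝓝 0) := by
    refine tendsto_const_nhds.congr' ?_
    filter_upwards [self_mem_nhdsWithin] with s hs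
    have hs1 : inner ℝ (perp τ) (c s - a) = 0 := hs.1
    have hs2 : inner ℝ (perp τ) (c t - a) = 0 := hts
    simp [slope, hs1, hs2]
  have h4 := tendsto_nhds_unique h2 h3
  rw [frame_decomp hτ (deriv c t), h4, zero_smul, add_zero]
  exact Submodule.smul_mem _ _ (Submodule.mem_span_singleton_self _)

/-! ### Mass and energy of a graph without overlapping edges -/

namespace WeightedDigraph

variable {Ω : Set Plane} (G : WeightedDigraph Ω)

/-- Distinct edges share at most one point. -/
def IsSimple : Prop :=
  ∀ e ∈ G.E, ∀ f ∈ G.E, e ≠ f → (segment ℝ e.1 e.2 ∩ segment ℝ f.1 f.2).Subsingleton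

/-- The part of an edge that is in no other edge. -/
def part (e : Plane × Plane) : Set Plane :=
  segment ℝ e.1 e.2 \ ⋃ f ∈ {f ∈ (G.E : Set (Plane × Plane)) | f ≠ e}, segment ℝ f.1 f.2

theorem finite_others (e : Plane × Plane) : {f ∈ (G.E : Set (Plane × Plane)) | f ≠ e}.Finite :=
  G.E.finite_toSet.subset fun _ h => h.1

theorem measurableSet_part (e : Plane × Plane) : MeasurableSet (G.part e) :=
  (measurableSet_segment _ _).diff
    ((G.finite_others e).measurableSet_biUnion fun f _ => measurableSet_segment f.1 f.2)

theorem part_subset (e : Plane × Plane) : G.part e ⊆ segment ℝ e.1 e.2 := Set.sdiff_subset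

theorem disjoint_part {e f : Plane × Plane} (hf : f ∈ G.E) (h : e ≠ f) :
    Disjoint (G.part e) (segment ℝ f.1 f.2) := by
  rw [Set.disjoint_left]
  intro x hx hxf
  exact hx.2 (Set.mem_biUnion (show f ∈ {f ∈ (G.E : Set (Plane × Plane)) | f ≠ e} from
    ⟨hf, h.symm⟩) hxf)

theorem pairwiseDisjoint_part : (G.E : Set (Plane × Plane)).PairwiseDisjoint G.part :=
  fun _ _ _ hf h => (G.disjoint_part hf h).mono_right (G.part_subset _)

variable {G}

theorem IsSimple.ae_eq_part (hG : G.IsSimple) {e : Plane × Plane} (he : e ∈ G.E) :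
    G.part e =ᵐ[μH[1]] segment ℝ e.1 e.2 := by
  have : NullSingletonClass (μH[1] : Measure Plane) := Measure.nullSingletonClass_hausdorff _ one_pos
  have hfin : (segment ℝ e.1 e.2 ∩
      ⋃ f ∈ {f ∈ (G.E : Set (Plane × Plane)) | f ≠ e}, segment ℝ f.1 f.2).Finite := by
    rw [Set.inter_iUnion₂]
    refine (G.finite_others e).biUnion fun f hf => ?_
    exact (hG e he f hf.1 hf.2.symm).finite
  rw [part, ← Set.sdiff_self_inter]
  exact sdiff_null_ae_eq_self (hfin.measure_zero _)

theorem IsSimple.measure_inter_part (hG : G.IsSimple) {e : Plane × Plane} (he : e ∈ G.E)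
    (A : Set Plane) :
    μH[1] (A ∩ G.part e) = μH[1] (A ∩ segment ℝ e.1 e.2) :=
  measure_congr ((ae_eq_refl A).inter (hG.ae_eq_part he))

theorem IsSimple.measure_part (hG : G.IsSimple) {e : Plane × Plane} (he : e ∈ G.E) :
    μH[1] (G.part e) = ENNReal.ofReal ‖e.2 - e.1‖ := by
  rw [measure_congr (hG.ae_eq_part he), hausdorffMeasure_segment, edist_dist, dist_eq_norm,
    norm_sub_rev]

theorem IsSimple.apply_of_subset_part (hG : G.IsSimple) {e : Plane × Plane} (he : e ∈ G.E)
    {A : Set Plane} (hA : MeasurableSet A) (hAe : A ⊆ G.part e) :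
    G.measure A = (μH[1] A).toReal • G.θ e • direction e := by
  rw [G.measure_apply hA, Finset.sum_eq_single_of_mem e he]
  · rw [← hG.measure_inter_part he, Set.inter_eq_left.2 hAe]
  · intro f hf hfe
    have : A ∩ segment ℝ f.1 f.2 = ∅ :=
      Set.disjoint_iff_inter_eq_empty.1 ((G.disjoint_part hf hfe.symm).mono_left hAe)
    simp [this]

theorem enorm_weight_direction {e : Plane × Plane} (he : e ∈ G.E) :
    ‖G.θ e • direction e‖ₑ = ENNReal.ofReal (G.θ e) := by
  rw [← ofReal_norm, norm_smul, norm_direction (G.ne e he), mul_one,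
    Real.norm_of_nonneg (G.θ_pos e he).le]

/-- On the pairwise disjoint sets `part e` the measure is that of the single edge `e`, and each has
full length in its edge; so no cancellation between edges can occur. -/
theorem IsSimple.mass_le_variation (hG : G.IsSimple) :
    ENNReal.ofReal (∑ e ∈ G.E, G.θ e * ‖e.2 - e.1‖) ≤ G.measure.variation Ω := by
  have h1 : ∑ e ∈ G.E, G.measure.variation (G.part e) =
      G.measure.variation (⋃ e ∈ G.E, G.part e) :=
    (measure_biUnion_finset G.pairwiseDisjoint_part fun e _ => G.measurableSet_part e).symm
  have h2 : (⋃ e ∈ G.E, G.part e) ⊆ Ω :=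
    Set.iUnion₂_subset fun e he => (G.part_subset e).trans (G.segment_subset e he)
  refine le_trans ?_ (h1.le.trans (measure_mono h2))
  rw [ENNReal.ofReal_sum_of_nonneg fun e he => mul_nonneg (G.θ_pos e he).le (norm_nonneg _)]
  refine Finset.sum_le_sum fun e he => ?_
  refine le_trans (le_of_eq ?_) (VectorMeasure.enorm_measure_le_variation _ _)
  rw [hG.apply_of_subset_part he (G.measurableSet_part e) subset_rfl, enorm_smul,
    enorm_weight_direction he, hG.measure_part he, ENNReal.toReal_ofReal (norm_nonneg _),
    Real.enorm_of_nonneg (norm_nonneg _), mul_comm, ENNReal.ofReal_mul (norm_nonneg _)]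

/-- Every representation `(M, θ, ξ)` of the path must cover almost all of each `part e`, and there
`θ ξ` agrees almost everywhere with the weighted direction of `e`. Taking norms fixes `θ`. What `M`
contains besides can only add to the integral. -/
theorem IsSimple.le_energy (hG : G.IsSimple) (α : ℝ) :
    ENNReal.ofReal (∑ e ∈ G.E, G.θ e ^ α * ‖e.2 - e.1‖) ≤ energy α G.measure := by
  refine le_iInf fun M => le_iInf fun θ => le_iInf fun ξ => le_iInf fun h => ?_
  have hθ : ∀ e ∈ G.E, ENNReal.ofReal (G.θ e ^ α * ‖e.2 - e.1‖) ≤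
      ∫⁻ x in M ∩ G.part e, ENNReal.ofReal (θ x ^ α) ∂μH[1] := by
    intro e he
    have hint : Integrable (fun x => θ x • ξ x) (μH[1].restrict M) := by
      refine Integrable.smul_bdd h.integrable 1 h.measurable_ξ.aestronglyMeasurable ?_
      · filter_upwards [ae_restrict_mem h.measurableSet] with x hx using (h.norm_ξ x hx).le
    have happ : ∀ A, MeasurableSet A → A ⊆ G.part e →
        (μH[1] A).toReal • G.θ e • direction e = ∫ x in A ∩ M, θ x • ξ x ∂μH[1] := by
      intro A hA hAe
      rw [← hG.apply_of_subset_part he hA hAe, h.eq, withDensityᵥ_apply hint hA,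
        Measure.restrict_restrict hA]
    have hne : G.θ e • direction e ≠ 0 :=
      smul_ne_zero (G.θ_pos e he).ne' (norm_ne_zero_iff.1 (by rw [norm_direction (G.ne e he)]; simp))
    have hfin : μH[1] (G.part e) ≠ ⊤ := by rw [hG.measure_part he]; exact ENNReal.ofReal_ne_top
    -- Tested on the part of `e` outside `M`, the representation gives zero, while the path gives
    -- the length times a nonzero vector.
    have hnull : μH[1] (G.part e \ M) = 0 := by
      have h0 := happ (G.part e \ M) ((G.measurableSet_part e).diff h.measurableSet) Set.sdiff_subset
      rw [Set.sdiff_inter_self, setIntegral_empty] at h0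
      have := (smul_eq_zero.1 h0).resolve_right hne
      exact ((ENNReal.toReal_eq_zero_iff _).1 this).resolve_right
        (ne_top_of_le_ne_top hfin (measure_mono Set.sdiff_subset))
    have hmeas : μH[1] (M ∩ G.part e) = ENNReal.ofReal ‖e.2 - e.1‖ := by
      rw [← hG.measure_part he, Set.inter_comm]
      have := measure_inter_add_sdiff (μ := (μH[1] : Measure Plane)) (G.part e) h.measurableSet
      rw [hnull, add_zero] at this
      exact this
    have hms := h.measurableSet.inter (G.measurableSet_part e)
    have : IsFiniteMeasure ((μH[1] : Measure Plane).restrict (M ∩ G.part e)) :=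
      ⟨by rw [Measure.restrict_apply_univ, hmeas]; exact ENNReal.ofReal_lt_top⟩
    have hae : (fun x => θ x • ξ x) =ᵐ[μH[1].restrict (M ∩ G.part e)]
        fun _ => G.θ e • direction e := by
      refine Integrable.ae_eq_of_forall_setIntegral_eq _ _
        (hint.mono_measure (Measure.restrict_mono Set.inter_subset_left le_rfl))
        (integrable_const _) fun A hA _ => ?_
      rw [Measure.restrict_restrict hA, setIntegral_const, Measure.real,
        happ _ (hA.inter hms) fun x hx => hx.2.2]
      congr 2
      ext x; simp; tauto
    rw [lintegral_congr_ae (g := fun _ => ENNReal.ofReal (G.θ e ^ α))]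
    · rw [lintegral_const, Measure.restrict_apply_univ, hmeas,
        ENNReal.ofReal_mul (Real.rpow_nonneg (G.θ_pos e he).le _)]
    · filter_upwards [hae, ae_restrict_mem hms] with x hx hxM
      have := congrArg norm hx
      rw [norm_smul, norm_smul, h.norm_ξ x hxM.1, norm_direction (G.ne e he), mul_one, mul_one,
        Real.norm_of_nonneg (h.θ_nonneg x hxM.1), Real.norm_of_nonneg (G.θ_pos e he).le] at this
      rw [this]
  rw [ENNReal.ofReal_sum_of_nonneg fun e he =>
    mul_nonneg (Real.rpow_nonneg (G.θ_pos e he).le _) (norm_nonneg _)]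
  refine (Finset.sum_le_sum hθ).trans ?_
  rw [← lintegral_biUnion_finset (fun e he f hf hef =>
    (G.pairwiseDisjoint_part he hf hef).mono Set.inter_subset_right Set.inter_subset_right)
    fun e _ => h.measurableSet.inter (G.measurableSet_part e)]
  exact lintegral_mono_set (Set.iUnion₂_subset fun e _ => Set.inter_subset_left)

theorem sum_indicator_part {M : Type*} [AddCommMonoid M] (c : Plane × Plane → M)
    {e : Plane × Plane} (he : e ∈ G.E) {x : Plane} (hx : x ∈ G.part e) :
    ∑ f ∈ G.E, (G.part f).indicator (fun _ => c f) x = c e := by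
  rw [Finset.sum_eq_single_of_mem e he, Set.indicator_of_mem hx]
  intro f hf hfe
  exact Set.indicator_of_notMem
    (fun h => Set.disjoint_left.1 (G.pairwiseDisjoint_part hf he hfe) h hx) _

/-- The points common to two edges are discarded from the carrier, so that multiplicity and
orientation are single-valued sums of indicators. Tangency reduces to the fact that a curve meeting
a line is parallel to it at almost all times of contact. -/
theorem IsSimple.isRectifiableRep (hG : G.IsSimple) :
    IsRectifiableRep G.measure (⋃ e ∈ G.E, G.part e)
      (fun x => ∑ e ∈ G.E, (G.part e).indicator (fun _ => G.θ e) x)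
      (fun x => ∑ e ∈ G.E, (G.part e).indicator (fun _ => direction e) x) := by
  have hM : MeasurableSet (⋃ e ∈ G.E, G.part e) :=
    Finset.measurableSet_biUnion _ fun e _ => G.measurableSet_part e
  have hmem : ∀ x ∈ ⋃ e ∈ G.E, G.part e, ∃ e ∈ G.E, x ∈ G.part e := fun x hx => by
    simpa using! hx
  have hfin : ∀ e ∈ G.E, μH[1] (G.part e) ≠ ⊤ := fun e he => by
    rw [hG.measure_part he]; exact ENNReal.ofReal_ne_top
  refine ⟨hM, ?_, ?_, ?_, ?_, ?_, ?_, ?_, ?_⟩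
  · refine ⟨fun n s => (G.E.toList.getD n 0).1 + s • direction (G.E.toList.getD n 0),
      fun n => ⟨‖direction (G.E.toList.getD n 0)‖₊, ?_⟩, ?_⟩
    · refine LipschitzWith.of_dist_le_mul fun s t => ?_
      rw [dist_add_left, dist_eq_norm, ← sub_smul, norm_smul, mul_comm, Real.dist_eq,
        Real.norm_eq_abs, coe_nnnorm]
    · rw [Set.sdiff_eq_empty.2, measure_empty]
      intro x hx
      obtain ⟨e, he, hxe⟩ := hmem x hx
      obtain ⟨n, hn, hne⟩ := List.getElem_of_mem (Finset.mem_toList.2 he)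
      have hs := G.part_subset e hxe
      rw [← add_norm_smul_direction (G.ne e he), segment_eq_image_line _ _ (norm_nonneg _)] at hs
      obtain ⟨s, _, rfl⟩ := hs
      refine Set.mem_iUnion.2 ⟨n, s, ?_⟩
      simp only [List.getD_eq_getElem _ _ hn, hne]
  · exact Finset.measurable_sum _ fun e _ => measurable_const.indicator (G.measurableSet_part e)
  · exact Finset.measurable_sum _ fun e _ => measurable_const.indicator (G.measurableSet_part e)
  · intro x hx
    obtain ⟨e, he, hxe⟩ := hmem x hx
    rw [sum_indicator_part _ he hxe]
    exact (G.θ_pos e he).le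
  · intro x hx
    obtain ⟨e, he, hxe⟩ := hmem x hx
    rw [sum_indicator_part _ he hxe, norm_direction (G.ne e he)]
  · intro c _
    have : ∀ᵐ t : ℝ, ∀ e ∈ G.E, inner ℝ (perp (direction e)) (c t - e.1) = 0 →
        deriv c t ∈ Submodule.span ℝ {direction e} :=
      (Finset.eventually_all G.E).2 fun e he =>
        ae_deriv_mem_span c e.1 (norm_direction (G.ne e he))
    filter_upwards [this] with t ht hct
    obtain ⟨e, he, hxe⟩ := hmem _ hct
    rw [sum_indicator_part _ he hxe]
    refine ht e he ?_
    have hs := G.part_subset e hxe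
    rw [← add_norm_smul_direction (G.ne e he), segment_eq_image_line _ _ (norm_nonneg _)] at hs
    obtain ⟨s, _, hs⟩ := hs
    rw [← hs, add_sub_cancel_left, inner_smul_right, inner_perp_self, mul_zero]
  · refine Integrable.integrableOn ?_
    refine integrable_finsetSum _ fun e he => ?_
    exact (integrable_indicator_iff (G.measurableSet_part e)).2 (integrableOn_const (hfin e he))
  · have hint : Integrable (fun x => ∑ e ∈ G.E, (G.part e).indicator
        (fun _ => G.θ e • direction e) x) (μH[1] : Measure Plane) :=
      integrable_finsetSum _ fun e he =>
        (integrable_indicator_iff (G.measurableSet_part e)).2 (integrableOn_const (hfin e he))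
    have h1 : (μH[1].restrict (⋃ e ∈ G.E, G.part e)).withDensityᵥ (fun x =>
        (∑ e ∈ G.E, (G.part e).indicator (fun _ => G.θ e) x) •
        ∑ e ∈ G.E, (G.part e).indicator (fun _ => direction e) x) =
        (μH[1].restrict (⋃ e ∈ G.E, G.part e)).withDensityᵥ (fun x =>
        ∑ e ∈ G.E, (G.part e).indicator (fun _ => G.θ e • direction e) x) := by
      refine WithDensityᵥEq.congr_ae ?_
      filter_upwards [ae_restrict_mem hM] with x hx
      obtain ⟨e, he, hxe⟩ := hmem x hx
      rw [sum_indicator_part _ he hxe, sum_indicator_part _ he hxe, sum_indicator_part _ he hxe]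
    rw [h1]
    ext1 A hA
    rw [withDensityᵥ_apply hint.restrict hA, G.measure_apply hA, integral_finsetSum]
    · refine Finset.sum_congr rfl fun e he => ?_
      rw [Measure.restrict_restrict hA, integral_indicator (G.measurableSet_part e),
        Measure.restrict_restrict (G.measurableSet_part e), setIntegral_const, Measure.real,
        ← hG.measure_inter_part he]
      congr 3
      ext x
      simp only [Set.mem_inter_iff, Set.mem_iUnion]
      exact ⟨fun h => ⟨h.2, h.1, e, he, h.2⟩, fun h => ⟨h.2.1, h.1⟩⟩
    · intro e he
      exact ((integrable_indicator_iff (G.measurableSet_part e)).2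
        (integrableOn_const (hfin e he))).restrict.restrict

theorem IsSimple.energy_eq (hG : G.IsSimple) (α : ℝ) :
    energy α G.measure = ENNReal.ofReal (∑ e ∈ G.E, G.θ e ^ α * ‖e.2 - e.1‖) := by
  refine le_antisymm ?_ (hG.le_energy α)
  unfold energy
  refine iInf_le_of_le _ (iInf_le_of_le _ (iInf_le_of_le _
    (iInf_le_of_le hG.isRectifiableRep (le_of_eq ?_))))
  rw [lintegral_biUnion_finset G.pairwiseDisjoint_part fun e _ => G.measurableSet_part e,
    ENNReal.ofReal_sum_of_nonneg fun e he =>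
    mul_nonneg (Real.rpow_nonneg (G.θ_pos e he).le _) (norm_nonneg _)]
  refine Finset.sum_congr rfl fun e he => ?_
  rw [setLIntegral_congr_fun (g := fun _ => ENNReal.ofReal (G.θ e ^ α)) (G.measurableSet_part e)]
  · rw [setLIntegral_const, hG.measure_part he,
      ENNReal.ofReal_mul (Real.rpow_nonneg (G.θ_pos e he).le _)]
  · intro x hx
    simp only [sum_indicator_part _ he hx]

end WeightedDigraph

/-! ### Subdivision of a transport path into edges that do not overlap -/

theorem segment_line (a τ : Plane) {s t : ℝ} (h : s ≤ t) :
    segment ℝ (a + s • τ) (a + t • τ) = (fun r : ℝ => a + r • τ) '' Set.Icc s t := by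
  have h1 := segment_eq_image_line (a + s • τ) τ (sub_nonneg.2 h)
  rw [show a + s • τ + (t - s) • τ = a + t • τ by module] at h1
  rw [h1]
  ext x
  simp only [Set.mem_image]
  constructor
  · rintro ⟨r, hr, rfl⟩
    exact ⟨s + r, ⟨by linarith [hr.1], by linarith [hr.2]⟩, by module⟩
  · rintro ⟨r, hr, rfl⟩
    exact ⟨r - s, ⟨by linarith [hr.1], by linarith [hr.2]⟩, by module⟩

/-- The unit vector measure of an oriented segment. -/
def unitMeasure (p : Plane × Plane) : VectorMeasure Plane Plane :=
  (μH[1].restrict (segment ℝ p.1 p.2)).withDensityᵥ fun _ => direction p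

theorem unitMeasure_apply (p : Plane × Plane) {A : Set Plane} (hA : MeasurableSet A) :
    unitMeasure p A = (μH[1] (A ∩ segment ℝ p.1 p.2)).toReal • direction p := by
  rw [unitMeasure, withDensityᵥ_apply (integrable_const_segment _ _ _) hA,
    Measure.restrict_restrict hA, setIntegral_const, Measure.real]

theorem direction_swap (p : Plane × Plane) : direction p.swap = -direction p := by
  simp only [direction, Prod.fst_swap, Prod.snd_swap]
  rw [norm_sub_rev, ← smul_neg, neg_sub]

theorem unitMeasure_swap (p : Plane × Plane) : unitMeasure p.swap = -unitMeasure p := by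
  ext1 A hA
  rw [_root_.neg_apply, unitMeasure_apply _ hA, unitMeasure_apply _ hA, direction_swap, smul_neg,
    Prod.fst_swap, Prod.snd_swap, segment_symm]

theorem WeightedDigraph.measure_eq_sum {Ω : Set Plane} (G : WeightedDigraph Ω) :
    G.measure = ∑ e ∈ G.E, G.θ e • unitMeasure e :=
  Finset.sum_congr rfl fun e _ => withDensityᵥ_smul' (fun _ => direction e) (G.θ e)

theorem mem_segment_iff_line {p : Plane × Plane} (hp : p.1 ≠ p.2) {x : Plane} :
    x ∈ segment ℝ p.1 p.2 ↔ ∃ s ∈ Set.Icc 0 ‖p.2 - p.1‖, p.1 + s • direction p = x := by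
  have h := segment_eq_image_line p.1 (direction p) (norm_nonneg (p.2 - p.1))
  rw [add_norm_smul_direction hp] at h
  rw [h]; rfl

theorem direction_line {a τ : Plane} (hτ : ‖τ‖ = 1) {s t : ℝ} (h : s < t) :
    direction (a + s • τ, a + t • τ) = τ := by
  have : a + t • τ - (a + s • τ) = (t - s) • τ := by module
  have hst : 0 < t - s := sub_pos.2 h
  rw [direction]
  simp only [this]
  rw [norm_smul, hτ, mul_one, Real.norm_of_nonneg hst.le, smul_smul, inv_mul_cancel₀ hst.ne',
    one_smul]

theorem unitMeasure_add {a v b : Plane} (hab : a ≠ b) (hva : v ≠ a) (hvb : v ≠ b)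
    (hv : v ∈ segment ℝ a b) :
    unitMeasure (a, b) = unitMeasure (a, v) + unitMeasure (v, b) := by
  have : NullSingletonClass (μH[1] : Measure Plane) :=
    Measure.nullSingletonClass_hausdorff _ one_pos
  obtain ⟨s, hs, rfl⟩ := (mem_segment_iff_line (p := (a, b)) hab).1 hv
  simp only at hs hva hvb ⊢
  set τ := direction (a, b) with hτ
  set L := ‖b - a‖
  have hτ1 : ‖τ‖ = 1 := norm_direction (e := (a, b)) hab
  have hb : b = a + L • τ := (add_norm_smul_direction (e := (a, b)) hab).symm
  have hs0 : 0 < s := lt_of_le_of_ne hs.1 fun h => hva (by simp [← h])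
  have hsL : s < L := lt_of_le_of_ne hs.2 fun h => hvb (by rw [h, hb])
  have ha : a = a + (0:ℝ) • τ := by simp
  have d1 : direction (a, a + s • τ) = τ := by
    have := direction_line (a := a) hτ1 hs0
    rwa [← ha] at this
  have d2 : direction (a + s • τ, b) = τ := by
    have := direction_line (a := a) hτ1 hsL
    rwa [← hb] at this
  have s0 : segment ℝ a b = (fun r : ℝ => a + r • τ) '' Set.Icc 0 L := by
    have := segment_line a τ (hs0.trans hsL).le
    rwa [← ha, ← hb] at this
  have s1 : segment ℝ a (a + s • τ) = (fun r : ℝ => a + r • τ) '' Set.Icc 0 s := by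
    have := segment_line a τ hs0.le
    rwa [← ha] at this
  have s2 : segment ℝ (a + s • τ) b = (fun r : ℝ => a + r • τ) '' Set.Icc s L := by
    have := segment_line a τ hsL.le
    rwa [← hb] at this
  have hinj := (isometry_line a hτ1).injective
  have hU : segment ℝ a b = segment ℝ a (a + s • τ) ∪ segment ℝ (a + s • τ) b := by
    rw [s0, s1, s2, ← Set.image_union, Set.Icc_union_Icc_eq_Icc hs0.le hsL.le]
  have hI : segment ℝ a (a + s • τ) ∩ segment ℝ (a + s • τ) b = {a + s • τ} := by
    rw [s1, s2, ← Set.image_inter hinj, Set.Icc_inter_Icc_eq_singleton hs0.le hsL.le,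
      Set.image_singleton]
  ext1 A hA
  rw [_root_.add_apply, unitMeasure_apply _ hA, unitMeasure_apply _ hA, unitMeasure_apply _ hA,
    d1, d2, ← hτ, ← add_smul]
  simp only
  congr 1
  have hfin : ∀ x y : Plane, μH[1] (A ∩ segment ℝ x y) ≠ ⊤ := fun x y =>
    ne_top_of_le_ne_top (hausdorffMeasure_segment_ne_top x y) (measure_mono Set.inter_subset_right)
  rw [← ENNReal.toReal_add (hfin _ _) (hfin _ _), hU, Set.inter_union_distrib_left]
  congr 1
  refine measure_union₀ (hA.inter (measurableSet_segment _ _)).nullMeasurableSet ?_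
  refine measure_mono_null (t := {a + s • τ}) ?_ (measure_singleton _)
  rw [← hI]
  exact fun x hx => ⟨hx.1.2, hx.2.2⟩

/-- The pairs of points of `V` whose segment is in `Ω` and contains no other point of `V`. -/
def elementary (Ω : Set Plane) (V : Finset Plane) : Set (Plane × Plane) :=
  {p | p.1 ∈ V ∧ p.2 ∈ V ∧ p.1 ≠ p.2 ∧ segment ℝ p.1 p.2 ⊆ Ω ∧
    ∀ v ∈ V, v ∈ segment ℝ p.1 p.2 → v = p.1 ∨ v = p.2}

theorem swap_mem_elementary {Ω : Set Plane} {V : Finset Plane} {p : Plane × Plane}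
    (hp : p ∈ elementary Ω V) : p.swap ∈ elementary Ω V := by
  obtain ⟨h1, h2, h3, h4, h5⟩ := hp
  refine ⟨h2, h1, h3.symm, ?_, fun v hv hvp => ?_⟩
  · rwa [Prod.fst_swap, Prod.snd_swap, segment_symm]
  · rw [Prod.fst_swap, Prod.snd_swap, segment_symm] at hvp
    exact (h5 v hv hvp).symm

theorem not_mem_segment_of_mem {a v b : Plane} (hvb : v ≠ b) (hv : v ∈ segment ℝ a b) :
    b ∉ segment ℝ a v := by
  intro hb
  have h1 := dist_add_dist_of_mem_segment hv
  have h2 := dist_add_dist_of_mem_segment hb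
  have h3 : 0 < dist v b := dist_pos.2 hvb
  rw [dist_comm b v] at h2
  linarith

/-- Induction on the number of points of `V` on the segment: cutting at an interior one gives two
segments, each of which misses an end point of the original and so contains strictly fewer points of
`V`. -/
theorem unitMeasure_mem_span {Ω : Set Plane} {V : Finset Plane} (n : ℕ) :
    ∀ a ∈ V, ∀ b ∈ V, a ≠ b → segment ℝ a b ⊆ Ω →
      ((V : Set Plane) ∩ segment ℝ a b).ncard ≤ n →
      unitMeasure (a, b) ∈ Submodule.span ℝ (unitMeasure '' elementary Ω V) := by
  have hfin : ∀ a b : Plane, ((V : Set Plane) ∩ segment ℝ a b).Finite := fun a b =>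
    V.finite_toSet.subset Set.inter_subset_left
  induction n with
  | zero =>
    intro a ha b _ _ _ hn
    have := (Set.ncard_eq_zero (hfin a b)).1 (Nat.le_zero.1 hn)
    exact absurd (this ▸ (⟨ha, left_mem_segment ℝ a b⟩ : a ∈ (V : Set Plane) ∩ segment ℝ a b))
      (Set.notMem_empty a)
  | succ n ih =>
    intro a ha b hb hab hΩ hn
    by_cases hex : ∃ v ∈ V, v ∈ segment ℝ a b ∧ v ≠ a ∧ v ≠ b
    · obtain ⟨v, hvV, hv, hva, hvb⟩ := hex
      have c := convex_segment (𝕜 := ℝ) a b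
      have sub1 : segment ℝ a v ⊆ segment ℝ a b := c.segment_subset (left_mem_segment ℝ a b) hv
      have sub2 : segment ℝ v b ⊆ segment ℝ a b := c.segment_subset hv (right_mem_segment ℝ a b)
      rw [unitMeasure_add hab hva hvb hv]
      refine add_mem (ih a ha v hvV hva.symm (sub1.trans hΩ) ?_)
        (ih v hvV b hb hvb (sub2.trans hΩ) ?_)
      · refine Nat.le_of_lt_succ (lt_of_lt_of_le (Set.ncard_lt_ncard ?_ (hfin a b)) hn)
        refine (Set.ssubset_iff_of_subset (Set.inter_subset_inter_right _ sub1)).2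
          ⟨b, ⟨hb, right_mem_segment ℝ a b⟩, fun h => not_mem_segment_of_mem hvb hv h.2⟩
      · refine Nat.le_of_lt_succ (lt_of_lt_of_le (Set.ncard_lt_ncard ?_ (hfin a b)) hn)
        refine (Set.ssubset_iff_of_subset (Set.inter_subset_inter_right _ sub2)).2
          ⟨a, ⟨ha, left_mem_segment ℝ a b⟩, fun h => ?_⟩
        rw [segment_symm] at hv h
        exact not_mem_segment_of_mem hva hv (segment_symm ℝ b v ▸ h.2)
    · refine Submodule.subset_span ⟨(a, b), ⟨ha, hb, hab, hΩ, fun v hvV hv => ?_⟩, rfl⟩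
      by_contra hne
      rw [not_or] at hne
      exact hex ⟨v, hvV, hv, hne⟩

/-- Two common points force the segments onto one line, where they are intervals with a
nondegenerate intersection. If they differed, an end point of one would be interior to the other,
which elementary segments exclude. -/
theorem elementary_inter {Ω : Set Plane} {V : Finset Plane} {p p' : Plane × Plane}
    (hp : p ∈ elementary Ω V) (hp' : p' ∈ elementary Ω V)
    (h : ¬ (segment ℝ p.1 p.2 ∩ segment ℝ p'.1 p'.2).Subsingleton) : p' = p ∨ p' = p.swap := by
  rw [Set.not_subsingleton_iff] at h
  obtain ⟨x, ⟨hx, hx'⟩, y, ⟨hy, hy'⟩, hxy⟩ := h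
  set τ := direction p
  set L := ‖p.2 - p.1‖
  have hτ : ‖τ‖ = 1 := norm_direction hp.2.2.1
  have hp2 : p.1 + L • τ = p.2 := add_norm_smul_direction hp.2.2.1
  have hL : 0 < L := norm_pos_iff.2 (sub_ne_zero.2 hp.2.2.1.symm)
  obtain ⟨s₁, hs₁, rfl⟩ := (mem_segment_iff_line hp.2.2.1).1 hx
  obtain ⟨s₂, hs₂, rfl⟩ := (mem_segment_iff_line hp.2.2.1).1 hy
  have hs : s₁ ≠ s₂ := fun h => hxy (by rw [h])
  have hinj := (isometry_line p.1 hτ).injective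
  have hline : ∃ u w : ℝ, p.1 + u • τ = p'.1 ∧ p.1 + w • τ = p'.2 := by
    rw [segment_eq_image'] at hx' hy'
    obtain ⟨t₁, _, h1⟩ := hx'
    obtain ⟨t₂, _, h2⟩ := hy'
    simp only at h1 h2
    have ht : t₁ ≠ t₂ := fun h => hxy (by rw [← h1, ← h2, h])
    have ht' : t₁ - t₂ ≠ 0 := sub_ne_zero.2 ht
    have h3 : (t₁ - t₂) • (p'.2 - p'.1) = (s₁ - s₂) • τ := by
      have : (t₁ - t₂) • (p'.2 - p'.1) =
        (p'.1 + t₁ • (p'.2 - p'.1)) - (p'.1 + t₂ • (p'.2 - p'.1)) := by module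
      rw [this, h1, h2]; module
    have h4 : p'.2 - p'.1 = ((s₁ - s₂) / (t₁ - t₂)) • τ := by
      rw [div_eq_inv_mul, mul_smul, ← h3, smul_smul, inv_mul_cancel₀ ht', one_smul]
    set r := (s₁ - s₂) / (t₁ - t₂)
    have h5 : p.1 + (s₁ - t₁ * r) • τ = p'.1 := by
      rw [h4] at h1
      have : p'.1 = (p'.1 + t₁ • r • τ) - (t₁ * r) • τ := by module
      rw [this, h1]; module
    refine ⟨s₁ - t₁ * r, s₁ - t₁ * r + r, h5, ?_⟩
    have : p'.2 = p'.1 + (p'.2 - p'.1) := by abel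
    rw [this, h4, ← h5]; module
  obtain ⟨u, w, hu, hw⟩ := hline
  -- In the arc length coordinate of `p` the other segment is `[u, w]`, and both intervals contain
  -- `s₁ ≠ s₂`. Each of `u`, `w`, `0`, `L` that falls in the other interval must be one of its ends.
  have key : ∀ u w : ℝ, u ≤ w → segment ℝ p'.1 p'.2 = segment ℝ (p.1 + u • τ) (p.1 + w • τ) →
      p.1 + u • τ ∈ V → p.1 + w • τ ∈ V →
      (∀ v ∈ V, v ∈ segment ℝ p'.1 p'.2 → v = p.1 + u • τ ∨ v = p.1 + w • τ) →
      u = 0 ∧ w = L := by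
    intro u w huw hseg huV hwV hV
    rw [hseg, segment_line _ _ huw] at hx' hy' hV
    obtain ⟨r₁, hr₁, hr₁'⟩ := hx'
    obtain ⟨r₂, hr₂, hr₂'⟩ := hy'
    obtain rfl := hinj hr₁'
    obtain rfl := hinj hr₂'
    have m0 : p.1 = p.1 + (0 : ℝ) • τ := by simp
    have a1 : 0 ≤ u → u = 0 ∨ u = L := fun hu0 => by
      have := hp.2.2.2.2 _ huV ((mem_segment_iff_line hp.2.2.1).2
        ⟨u, ⟨hu0, hr₁.1.trans hs₁.2⟩, rfl⟩)
      rcases this with h | h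
      · left; nth_rw 2 [m0] at h; exact hinj h
      · right; rw [← hp2] at h; exact hinj h
    have a2 : w ≤ L → w = 0 ∨ w = L := fun hw0 => by
      have := hp.2.2.2.2 _ hwV ((mem_segment_iff_line hp.2.2.1).2
        ⟨w, ⟨hs₁.1.trans hr₁.2, hw0⟩, rfl⟩)
      rcases this with h | h
      · left; nth_rw 2 [m0] at h; exact hinj h
      · right; rw [← hp2] at h; exact hinj h
    have a3 : u ≤ 0 → 0 = u ∨ 0 = w := fun hu0 => by
      rcases hV p.1 hp.1 ⟨0, ⟨hu0, hs₁.1.trans hr₁.2⟩, m0.symm⟩ with h | h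
      · left; nth_rw 1 [m0] at h; exact hinj h
      · right; nth_rw 1 [m0] at h; exact hinj h
    have a4 : L ≤ w → L = u ∨ L = w := fun hw0 => by
      rcases hV p.2 hp.2.1 ⟨L, ⟨hr₁.1.trans hs₁.2, hw0⟩, hp2⟩ with h | h
      · left; rw [← hp2] at h; exact hinj h
      · right; rw [← hp2] at h; exact hinj h
    have := hs₁.1; have := hs₁.2; have := hs₂.1; have := hs₂.2
    have := hr₁.1; have := hr₁.2; have := hr₂.1; have := hr₂.2
    rcases lt_or_gt_of_ne hs with hlt | hlt
    · constructor
      · rcases le_total 0 u with h0 | h0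
        · rcases a1 h0 with h | h
          · exact h
          · linarith
        · rcases a3 h0 with h | h <;> linarith
      · rcases le_total w L with h0 | h0
        · rcases a2 h0 with h | h
          · linarith
          · exact h
        · rcases a4 h0 with h | h <;> linarith
    · constructor
      · rcases le_total 0 u with h0 | h0
        · rcases a1 h0 with h | h
          · exact h
          · linarith
        · rcases a3 h0 with h | h <;> linarith
      · rcases le_total w L with h0 | h0
        · rcases a2 h0 with h | h
          · linarith
          · exact h
        · rcases a4 h0 with h | h <;> linarith
  rcases le_total u w with huw | huw
  · obtain ⟨rfl, rfl⟩ := key u w huw (by rw [hu, hw]) (hu ▸ hp'.1) (hw ▸ hp'.2.1)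
      (by rw [hu, hw]; exact hp'.2.2.2.2)
    left
    exact Prod.ext (by rw [← hu]; simp) (by rw [← hw, hp2])
  · obtain ⟨rfl, rfl⟩ := key w u huw (by rw [hu, hw, segment_symm]) (hw ▸ hp'.2.1) (hu ▸ hp'.1)
      (by rw [hu, hw]; exact fun v hv hvs => (hp'.2.2.2.2 v hv hvs).symm)
    right
    exact Prod.ext (by rw [← hu, hp2]; rfl) (by rw [← hw]; simp)

/-- The measure is a linear combination of unit measures of elementary segments. Keeping one
orientation of each, discarding zero coefficients and reversing the segments with negative ones
yields a graph with positive weights and the same measure. Opposite flows on overlapping edges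
cancel in the coefficients. -/
theorem WeightedDigraph.exists_isSimple {Ω : Set Plane} (G : WeightedDigraph Ω) :
    ∃ G' : WeightedDigraph Ω, G'.measure = G.measure ∧ G'.IsSimple := by
  classical
  -- An arbitrary well-order of the plane selects one of the two orientations of each elementary
  -- segment.
  set r : Plane → Plane → Prop := WellOrderingRel
  set P : Finset (Plane × Plane) :=
    (G.V ×ˢ G.V).filter fun p => p ∈ elementary Ω G.V ∧ r p.1 p.2 with hP
  have hPmem : ∀ p ∈ P, p ∈ elementary Ω G.V ∧ r p.1 p.2 := fun p hp => (Finset.mem_filter.1 hp).2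
  have hspan : G.measure ∈ Submodule.span ℝ (unitMeasure '' (P : Set (Plane × Plane))) := by
    have h1 : Submodule.span ℝ (unitMeasure '' elementary Ω G.V) ≤
        Submodule.span ℝ (unitMeasure '' (P : Set (Plane × Plane))) := by
      rw [Submodule.span_le]
      rintro _ ⟨p, hp, rfl⟩
      have hmem : ∀ p ∈ elementary Ω G.V, r p.1 p.2 →
          unitMeasure p ∈ Submodule.span ℝ (unitMeasure '' (P : Set (Plane × Plane))) :=
        fun p hp hr => Submodule.subset_span ⟨p, Finset.mem_coe.2 (Finset.mem_filter.2
          ⟨Finset.mem_product.2 ⟨hp.1, hp.2.1⟩, hp, hr⟩), rfl⟩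
      rcases trichotomous_of r p.1 p.2 with hr | hr | hr
      · exact hmem p hp hr
      · exact absurd hr hp.2.2.1
      · have := hmem p.swap (swap_mem_elementary hp) hr
        rw [unitMeasure_swap] at this
        simpa using Submodule.neg_mem _ this
    rw [G.measure_eq_sum]
    refine Submodule.sum_mem _ fun e he => Submodule.smul_mem _ _ (h1 ?_)
    exact unitMeasure_mem_span _ e.1 (G.source_mem e he) e.2 (G.target_mem e he) (G.ne e he)
      (G.segment_subset e he) le_rfl
  obtain ⟨c, hc⟩ : ∃ c : Plane × Plane → ℝ, ∑ p ∈ P, c p • unitMeasure p = G.measure := by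
    obtain ⟨c, hc⟩ := (Submodule.mem_span_image_finset_iff_exists_fun ℝ).1 hspan
    refine ⟨fun p => if h : p ∈ P then c ⟨p, h⟩ else 0, ?_⟩
    rw [← hc, ← Finset.sum_coe_sort P]
    exact Finset.sum_congr rfl fun p _ => by simp
  set g : Plane × Plane → Plane × Plane := fun p => if 0 < c p then p else p.swap with hg
  -- The orientation of an edge in the image of `g` tells whether it was reversed, so the sign of
  -- the coefficient can be recovered from the edge alone.
  set θ : Plane × Plane → ℝ := fun q => if r q.1 q.2 then c q else -c q.swap with hθ
  set P' := P.filter fun p => c p ≠ 0 with hP'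
  have hP'mem : ∀ p ∈ P', p ∈ P ∧ c p ≠ 0 := fun p hp => Finset.mem_filter.1 hp
  have hasymm : ∀ p ∈ P, ¬ r p.2 p.1 := fun p hp h => asymm_of r (hPmem p hp).2 h
  have hgE : ∀ p ∈ P, g p ∈ elementary Ω G.V := fun p hp => by
    by_cases h : 0 < c p
    · simpa [hg, h] using (hPmem p hp).1
    · simpa [hg, h] using swap_mem_elementary (hPmem p hp).1
  have hgseg : ∀ p, segment ℝ (g p).1 (g p).2 = segment ℝ p.1 p.2 := fun p => by
    by_cases h : 0 < c p
    · simp [hg, h]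
    · simp [hg, h, segment_symm]
  have hgθ : ∀ p ∈ P', 0 < θ (g p) := fun p hp => by
    obtain ⟨hpP, hne⟩ := hP'mem p hp
    by_cases h : 0 < c p
    · simp [hg, hθ, h, (hPmem p hpP).2]
    · have : c p < 0 := lt_of_le_of_ne (not_lt.1 h) hne
      simpa [hg, hθ, h, hasymm p hpP] using this
  have hgm : ∀ p ∈ P', θ (g p) • unitMeasure (g p) = c p • unitMeasure p := fun p hp => by
    obtain ⟨hpP, hne⟩ := hP'mem p hp
    by_cases h : 0 < c p
    · simp [hg, hθ, h, (hPmem p hpP).2]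
    · simp [hg, hθ, h, hasymm p hpP, unitMeasure_swap]
  have hginj : Set.InjOn g P' := by
    intro p hp q hq hpq
    have hpP := (hP'mem p hp).1
    have hqP := (hP'mem q hq).1
    by_cases h : 0 < c p <;> by_cases h' : 0 < c q <;> simp only [hg, h, h', if_true, if_false] at hpq
    · exact hpq
    · exact absurd (hPmem p hpP).2 (by rw [hpq]; exact hasymm q hqP)
    · exact absurd (hPmem q hqP).2 (by rw [← hpq]; exact hasymm p hpP)
    · exact Prod.swap_injective hpq
  refine ⟨⟨G.V, P'.image g, θ, G.V_subset, ?_, ?_, ?_, ?_, ?_⟩, ?_, ?_⟩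
  · simp only [Finset.forall_mem_image]
    exact fun p hp => (hgE p (hP'mem p hp).1).1
  · simp only [Finset.forall_mem_image]
    exact fun p hp => (hgE p (hP'mem p hp).1).2.1
  · simp only [Finset.forall_mem_image]
    exact fun p hp => (hgE p (hP'mem p hp).1).2.2.1
  · simp only [Finset.forall_mem_image]
    exact fun p hp => (hgE p (hP'mem p hp).1).2.2.2.1
  · simp only [Finset.forall_mem_image]
    exact hgθ
  · rw [WeightedDigraph.measure_eq_sum, ← hc]
    simp only
    rw [Finset.sum_image hginj, Finset.sum_congr rfl hgm]
    refine Finset.sum_subset (Finset.filter_subset _ _) fun p hp hp' => ?_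
    have : c p = 0 := by
      by_contra h
      exact hp' (Finset.mem_filter.2 ⟨hp, h⟩)
    rw [this]
    ext1 A hA
    exact zero_smul ℝ (unitMeasure p A)
  · simp only [IsSimple, Finset.forall_mem_image]
    intro p hp q hq hpq
    by_contra hcon
    rw [hgseg, hgseg] at hcon
    have hpP := (hP'mem p hp).1
    have hqP := (hP'mem q hq).1
    rcases elementary_inter (hPmem p hpP).1 (hPmem q hqP).1 hcon with h | h
    · exact hpq (by rw [h])
    · refine hasymm p hpP ?_
      have := (hPmem q hqP).2
      rwa [h] at this

/-! ### The optimal profile -/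

/-- A solution of `(P')² = P^β - P` on the line, with compact support and height one. -/
structure IsUnitProfile (β : ℝ) (P P' : ℝ → ℝ) (T : ℝ) : Prop where
  pos : 0 < T
  continuous_deriv : Continuous P'
  hasDerivAt : ∀ t, HasDerivAt P (P' t) t
  nonneg : ∀ t, 0 ≤ P t
  eq_zero : ∀ t, t ∉ Set.Ioo 0 T → P t = 0
  deriv_eq_zero : ∀ t, t ∉ Set.Ioo 0 T → P' t = 0
  deriv_sq : ∀ t, P' t ^ 2 = P t ^ β - P t
  peak : ∃ t₁ ∈ Set.Icc 0 T, P t₁ = 1 ∧ (∀ t ≤ t₁, 0 ≤ P' t) ∧ ∀ t, t₁ ≤ t → P' t ≤ 0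
  balance : (2 + β) * ∫ t in 0..T, P' t ^ 2 = (1 - β) * ∫ t in 0..T, P t

theorem strictMono_integral_abs_sin_rpow {c r : ℝ} (hc : 0 < c) (hr : 0 ≤ r) :
    StrictMono fun x : ℝ => ∫ s in 0..x, c * |Real.sin s| ^ r := by
  have hcont : Continuous fun s : ℝ => c * |Real.sin s| ^ r :=
    continuous_const.mul (Real.continuous_sin.abs.rpow_const fun _ => Or.inr hr)
  intro a b hab
  have hpos : 0 < ∫ s in a..b, c * |Real.sin s| ^ r := by
    refine intervalIntegral.integral_pos hab hcont.continuousOn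
      (fun s _ => by positivity) ?_
    have : ∃ s ∈ Set.Icc a b, Real.sin s ≠ 0 := by
      by_cases ha : Real.sin a = 0
      · set h := min (b - a) 1
        have h0 : 0 < h := lt_min (sub_pos.2 hab) one_pos
        have h1 : h ≤ 1 := min_le_right _ _
        have h2 : h ≤ b - a := min_le_left _ _
        refine ⟨a + h, ⟨by linarith, by linarith⟩, ?_⟩
        rw [Real.sin_add, ha, zero_mul, zero_add]
        refine mul_ne_zero (fun hcos => ?_) (Real.sin_pos_of_pos_of_le_one h0 h1).ne'
        have := Real.sin_sq_add_cos_sq a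
        rw [ha, hcos] at this
        norm_num at this
      · exact ⟨a, ⟨le_rfl, hab.le⟩, ha⟩
    obtain ⟨s, hs, hne⟩ := this
    exact ⟨s, hs, mul_pos hc (Real.rpow_pos_of_pos (abs_pos.2 hne) _)⟩
  have := intervalIntegral.integral_add_adjacent_intervals (hcont.intervalIntegrable 0 a)
    (hcont.intervalIntegrable a b) (μ := volume)
  simp only
  linarith

theorem surjective_integral_abs_sin_rpow {c r : ℝ} (hc : 0 < c) (hr : 0 ≤ r) :
    Function.Surjective fun x : ℝ => ∫ s in 0..x, c * |Real.sin s| ^ r := by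
  have hcont : Continuous fun s : ℝ => c * |Real.sin s| ^ r :=
    continuous_const.mul (Real.continuous_sin.abs.rpow_const fun _ => Or.inr hr)
  have hper : Function.Periodic (fun s : ℝ => c * |Real.sin s| ^ r) Real.pi := fun s => by
    simp only [Real.sin_add_pi, abs_neg]
  have hpos : 0 < ∫ s in 0..Real.pi, c * |Real.sin s| ^ r := by
    have := strictMono_integral_abs_sin_rpow hc hr Real.pi_pos
    simpa using this
  exact (intervalIntegral.continuous_primitive (fun a b => hcont.intervalIntegrable a b) 0).surjective
    (hper.tendsto_atTop_intervalIntegral_of_pos hpos Real.pi_pos)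
    (hper.tendsto_atBot_intervalIntegral_of_pos hpos Real.pi_pos)

/-- Put `P = sin^q φ` with `q = 2/(1-β)`. Since `q β = q - 2`, one has `P^β - P = sin^(q-2) φ · cos²
φ`, so the equation becomes `φ' = 1/(q sin^(q/2) φ)`. The time is therefore an explicit primitive in
`φ`, and `φ` runs through `[0, π]` in a finite time `T`. -/
theorem exists_isUnitProfile {β : ℝ} (h0 : 0 < β) (h1 : β < 1) :
    ∃ P P' T, IsUnitProfile β P P' T := by
  have hb : 0 < 1 - β := sub_pos.2 h1
  set q : ℝ := 2 / (1 - β) with hq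
  have hqb : q * (1 - β) = 2 := div_mul_cancel₀ _ hb.ne'
  have hq2 : 2 < q := by rw [hq, lt_div_iff₀ hb]; linarith
  have hq0 : 0 < q := by linarith
  have hq20 : 0 ≤ q / 2 := by linarith
  -- The time as a function of the angle. The absolute value extends it to an increasing bijection
  -- of the whole line, whose inverse is `ph`.
  set tm : ℝ → ℝ := fun x : ℝ => ∫ s in 0..x, q * |Real.sin s| ^ (q / 2) with htm
  have hmono : StrictMono tm := strictMono_integral_abs_sin_rpow hq0 hq20
  have hsurj : Function.Surjective tm := surjective_integral_abs_sin_rpow hq0 hq20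
  have hcont : Continuous fun s : ℝ => q * |Real.sin s| ^ (q / 2) :=
    continuous_const.mul (Real.continuous_sin.abs.rpow_const fun _ => Or.inr hq20)
  have htmd : ∀ x, HasDerivAt tm (q * |Real.sin x| ^ (q / 2)) x := fun x =>
    intervalIntegral.integral_hasDerivAt_right (hcont.intervalIntegrable _ _)
      hcont.stronglyMeasurable.stronglyMeasurableAtFilter hcont.continuousAt
  set eq := StrictMono.orderIsoOfSurjective tm hmono hsurj with heq
  set ph : ℝ → ℝ := fun t => eq.symm t with hph
  have hphc : Continuous ph := eq.symm.continuous
  have htp : ∀ t, tm (ph t) = t := fun t => eq.apply_symm_apply t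
  have hpt : ∀ x, ph (tm x) = x := fun x => eq.symm_apply_apply x
  have hphm : StrictMono ph := eq.symm.strictMono
  set T := tm Real.pi with hT
  have htm0 : tm 0 = 0 := by simp [htm]
  have hT0 : 0 < T := by rw [← htm0]; exact hmono Real.pi_pos
  have hph0 : ph 0 = 0 := by rw [← htm0, hpt, htm0]
  have hphT : ph T = Real.pi := hpt _
  -- Freezing the angle at `0` and `π` extends the profile by zero outside `[0, T]`.
  set cl : ℝ → ℝ := fun t => max 0 (min Real.pi (ph t)) with hcl
  have hclc : Continuous cl := continuous_const.max (continuous_const.min hphc)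
  have hcl0 : ∀ t, 0 ≤ cl t := fun t => le_max_left _ _
  have hclpi : ∀ t, cl t ≤ Real.pi := fun t => max_le Real.pi_pos.le (min_le_left _ _)
  have hs0 : ∀ t, 0 ≤ Real.sin (cl t) := fun t => Real.sin_nonneg_of_nonneg_of_le_pi (hcl0 t) (hclpi t)
  have hsin0 : ∀ t, t ∉ Set.Ioo 0 T → Real.sin (cl t) = 0 := fun t ht => by
    rw [Set.mem_Ioo, not_and_or, not_lt, not_lt] at ht
    rcases ht with ht | ht
    · have : ph t ≤ 0 := by rw [← hph0]; exact hphm.monotone ht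
      have : cl t = 0 := max_eq_left ((min_le_right _ _).trans this)
      rw [this, Real.sin_zero]
    · have : Real.pi ≤ ph t := by rw [← hphT]; exact hphm.monotone ht
      have : cl t = Real.pi := by rw [hcl]; simp only [min_eq_left this, max_eq_right Real.pi_pos.le]
      rw [this, Real.sin_pi]
  have hin : ∀ t ∈ Set.Ioo 0 T, ph t ∈ Set.Ioo 0 Real.pi := fun t ht =>
    ⟨by rw [← hph0]; exact hphm ht.1, by rw [← hphT]; exact hphm ht.2⟩
  have hclin : ∀ t ∈ Set.Ioo 0 T, cl t = ph t := fun t ht => by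
    rw [hcl]
    simp only [min_eq_right (hin t ht).2.le, max_eq_right (hin t ht).1.le]
  have hclev : ∀ t ∈ Set.Ioo 0 T, cl =ᶠ[𝓝 t] ph := fun t ht => by
    filter_upwards [isOpen_Ioo.mem_nhds ht] with s hs using hclin s hs
  have hspos : ∀ t ∈ Set.Ioo 0 T, 0 < Real.sin (ph t) := fun t ht =>
    Real.sin_pos_of_pos_of_lt_pi (hin t ht).1 (hin t ht).2
  have hphd : ∀ t ∈ Set.Ioo 0 T, HasDerivAt ph (q * Real.sin (ph t) ^ (q / 2))⁻¹ t := fun t ht => by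
    have hd := htmd (ph t)
    rw [abs_of_pos (hspos t ht)] at hd
    exact HasDerivAt.of_local_left_inverse hphc.continuousAt hd
      (mul_pos hq0 (Real.rpow_pos_of_pos (hspos t ht) _)).ne' (Eventually.of_forall htp)
  set P : ℝ → ℝ := fun t => Real.sin (cl t) ^ q with hP
  set P' : ℝ → ℝ := fun t => Real.sin (cl t) ^ (q / 2 - 1) * Real.cos (cl t) with hP'
  have hPc : Continuous P := (Real.continuous_sin.comp hclc).rpow_const fun _ => Or.inr hq0.le
  have hP'c : Continuous P' :=
    ((Real.continuous_sin.comp hclc).rpow_const fun _ => Or.inr (by linarith)).mul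
      (Real.continuous_cos.comp hclc)
  have hPz : ∀ t, t ∉ Set.Ioo 0 T → P t = 0 := fun t ht => by
    simp only [hP, hsin0 t ht, Real.zero_rpow hq0.ne']
  have hP'z : ∀ t, t ∉ Set.Ioo 0 T → P' t = 0 := fun t ht => by
    simp only [hP', hsin0 t ht, Real.zero_rpow (show q / 2 - 1 ≠ 0 by linarith), zero_mul]
  have hdin : ∀ t ∈ Set.Ioo 0 T, HasDerivAt P (P' t) t := fun t ht => by
    have hs := hspos t ht
    have h2 : HasDerivAt (fun x => Real.sin (ph x) ^ q) _ t :=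
      ((Real.hasDerivAt_sin (ph t)).comp t (hphd t ht)).rpow_const (p := q) (Or.inl hs.ne')
    refine (h2.congr_of_eventuallyEq ?_).congr_deriv ?_
    · filter_upwards [hclev t ht] with s h
      simp only [hP, h]
    · simp only [hP', hclin t ht, Function.comp]
      have e1 : Real.sin (ph t) ^ (q - 1) =
          Real.sin (ph t) ^ (q / 2 - 1) * Real.sin (ph t) ^ (q / 2) := by
        rw [← Real.rpow_add hs]; congr 1; ring
      have e2 : Real.sin (ph t) ^ (q / 2) ≠ 0 := (Real.rpow_pos_of_pos hs _).ne'
      rw [e1]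
      field_simp
  have hdoff : ∀ t, t ∉ ({0, T} : Set ℝ) → HasDerivAt P (P' t) t := fun t ht => by
    by_cases hin' : t ∈ Set.Ioo 0 T
    · exact hdin t hin'
    · have hmem : t ∈ (Set.Icc 0 T)ᶜ := fun h => by
        simp only [Set.mem_insert_iff, Set.mem_singleton_iff, not_or] at ht
        exact hin' ⟨lt_of_le_of_ne h.1 (Ne.symm ht.1), lt_of_le_of_ne h.2 ht.2⟩
      rw [hP'z t hin']
      refine (hasDerivAt_const t (0 : ℝ)).congr_of_eventuallyEq ?_
      filter_upwards [isClosed_Icc.isOpen_compl.mem_nhds hmem] with s hs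
      exact hPz s fun h => hs (Set.Ioo_subset_Icc_self h)
  have hcount : ({0, T} : Set ℝ).Countable := (Set.toFinite _).countable
  -- At `0` and `T` the angle itself need not be differentiable. There the derivative of `P` comes
  -- from writing `P` as the integral of the continuous function `P'`, which only requires
  -- differentiability off a countable set.
  have hder : ∀ t, HasDerivAt P (P' t) t := fun t => by
    have h2 : P = fun t => P 0 + ∫ s in 0..t, P' s := by
      ext t
      rw [integral_eq_of_hasDerivAt_off_countable P P' hcount hPc.continuousOn
        (fun x hx => hdoff x hx.2) (hP'c.intervalIntegrable _ _)]
      ring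
    rw [h2]
    exact (intervalIntegral.integral_hasDerivAt_right (hP'c.intervalIntegrable _ _)
      hP'c.stronglyMeasurable.stronglyMeasurableAtFilter hP'c.continuousAt).const_add _
  have hsq : ∀ t, P' t ^ 2 = P t ^ β - P t := fun t => by
    have hexp : ∀ u : ℝ, 0 ≤ u → (u ^ (q / 2 - 1)) ^ 2 = (u ^ q) ^ β := fun u hu => by
      rw [← Real.rpow_natCast, ← Real.rpow_mul hu, ← Real.rpow_mul hu]
      congr 1
      push_cast
      linarith
    have hexp2 : ∀ u : ℝ, 0 ≤ u → (u ^ (q / 2 - 1)) ^ 2 * u ^ 2 = u ^ q := fun u hu => by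
      rw [← mul_pow, ← Real.rpow_add_one' hu (by linarith), ← Real.rpow_natCast, ← Real.rpow_mul hu]
      congr 1
      push_cast
      ring
    simp only [hP, hP']
    rw [mul_pow, ← hexp _ (hs0 t), ← hexp2 _ (hs0 t), Real.cos_sq']
    ring
  refine ⟨P, P', T, hT0, hP'c, hder, fun t => Real.rpow_nonneg (hs0 t) _, hPz, hP'z, hsq, ?_, ?_⟩
  · have hpi2 : cl (tm (Real.pi / 2)) = Real.pi / 2 := by
      simp only [hcl, hpt]
      rw [min_eq_right (by linarith [Real.pi_pos]), max_eq_right (by linarith [Real.pi_pos])]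
    have hclm : Monotone cl := fun s t hst =>
      max_le_max le_rfl (min_le_min le_rfl (hphm.monotone hst))
    refine ⟨tm (Real.pi / 2), ⟨?_, hmono.monotone (by linarith [Real.pi_pos])⟩, ?_, fun t ht => ?_,
      fun t ht => ?_⟩
    · rw [← htm0]; exact hmono.monotone (by linarith [Real.pi_pos])
    · simp only [hP, hpi2, Real.sin_pi_div_two, Real.one_rpow]
    · refine mul_nonneg (Real.rpow_nonneg (hs0 t) _)
        (Real.cos_nonneg_of_neg_pi_div_two_le_of_le ?_ ?_)
      · linarith [hcl0 t, Real.pi_pos]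
      · rw [← hpi2]; exact hclm ht
    · refine mul_nonpos_of_nonneg_of_nonpos (Real.rpow_nonneg (hs0 t) _)
        (Real.cos_nonpos_of_pi_div_two_le_of_le ?_ ?_)
      · rw [← hpi2]; exact hclm ht
      · linarith [hclpi t, Real.pi_pos]
  -- The balance relation is the integral of `(P P')'` over `[0, T]`, with vanishing boundary terms.
  -- Here `P P' = sin^(n-1) · cos`, so its derivative is `((n-1) P'² - P)/q`, and `(1-β)(n-1) =
  -- 2+β`.
  · set n := 3 * q / 2 with hn
    have hint : ∫ t in 0..T, ((n - 1) * P' t ^ 2 - P t) / q = P T * P' T - P 0 * P' 0 := by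
      refine integral_eq_of_hasDerivAt_off_countable_of_le (fun t => P t * P' t) _ hT0.le
        Set.countable_empty (hPc.mul hP'c).continuousOn (fun t ht => ?_) ?_
      · have ht := ht.1
        have hs := hspos t ht
        have h2 : HasDerivAt (fun x => Real.sin (ph x) ^ (n - 1) * Real.cos (ph x)) _ t :=
          (((Real.hasDerivAt_sin (ph t)).comp t (hphd t ht)).rpow_const (p := n - 1)
            (Or.inl hs.ne')).mul ((Real.hasDerivAt_cos (ph t)).comp t (hphd t ht))
        refine (h2.congr_of_eventuallyEq ?_).congr_deriv ?_
        · filter_upwards [hclev t ht, isOpen_Ioo.mem_nhds ht] with s h hs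
          simp only [hP, hP', h]
          rw [← mul_assoc, ← Real.rpow_add (hspos s hs)]
          congr 2
          rw [hn]; ring
        · simp only [hP', hP, hclin t ht, Function.comp]
          set u := Real.sin (ph t)
          set c := Real.cos (ph t)
          have e1 : u ^ (n - 1 - 1) = (u ^ (q / 2 - 1)) ^ 2 * u ^ (q / 2) := by
            rw [← Real.rpow_natCast, ← Real.rpow_mul hs.le, ← Real.rpow_add hs]
            congr 1; push_cast; rw [hn]; ring
          have e2 : u ^ (n - 1) * u = u ^ q * u ^ (q / 2) := by
            rw [← Real.rpow_add_one hs.ne', ← Real.rpow_add hs]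
            congr 1; rw [hn]; ring
          have e3 : u ^ (q / 2) ≠ 0 := (Real.rpow_pos_of_pos hs _).ne'
          rw [e1]
          have e4 : u ^ (n - 1) * (-u * (q * u ^ (q / 2))⁻¹) = - u ^ q / q := by
            have : u ^ (n - 1) * (-u * (q * u ^ (q / 2))⁻¹) =
              -(u ^ (n - 1) * u) * (q * u ^ (q / 2))⁻¹ := by ring
            rw [this, e2]
            field_simp
          rw [e4]
          field_simp
          ring
      · exact Continuous.intervalIntegrable (by fun_prop) _ _
    rw [hPz T (by simp), hPz 0 (by simp), zero_mul, zero_mul, sub_zero,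
      intervalIntegral.integral_div, intervalIntegral.integral_sub,
      intervalIntegral.integral_const_mul] at hint
    · have h3 : (n - 1) * ∫ t in 0..T, P' t ^ 2 = ∫ t in 0..T, P t := by
        have := (div_eq_zero_iff.1 hint).resolve_right hq0.ne'
        linarith
      have h4 : (1 - β) * (n - 1) = 2 + β := by rw [hn]; linear_combination (3 / 2) * hqb
      rw [← h3, ← mul_assoc, h4]
    · exact Continuous.intervalIntegrable (by fun_prop) _ _
    · exact hPc.intervalIntegrable _ _

/-! ### Weakly differentiable functions on the line -/

theorem support_subset_Ioo {φ : ℝ → ℝ} (h : HasCompactSupport φ) :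
    ∃ R > 0, tsupport φ ⊆ Set.Ioo (-R) R := by
  obtain ⟨R, hR, hsub⟩ := h.isCompact.isBounded.subset_ball_lt 0 0
  exact ⟨R, hR, hsub.trans (by rw [Real.ball_eq_Ioo]; simp)⟩

theorem integral_eq_intervalIntegral {f : ℝ → ℝ} {R : ℝ} (hR : 0 < R)
    (hf : ∀ x, x ∉ Set.Ioo (-R) R → f x = 0) : ∫ x, f x = ∫ x in (-R)..R, f x := by
  rw [intervalIntegral.integral_of_le (by linarith), setIntegral_eq_integral_of_forall_compl_eq_zero]
  exact fun x hx => hf x fun h => hx ⟨h.1, h.2.le⟩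

theorem intervalIntegrable_of_locallyIntegrable {g : ℝ → ℝ} (hg : LocallyIntegrable g) (a b : ℝ) :
    IntervalIntegrable g volume a b :=
  intervalIntegrable_iff.2
    ((hg.integrableOn_isCompact isCompact_uIcc).mono_set Set.uIoc_subset_uIcc)

/-- The primitive of a locally integrable function is absolutely continuous with derivative `g`
almost everywhere, so integration by parts holds on an interval containing the support of `φ`. -/
theorem integral_primitive_mul_deriv {g : ℝ → ℝ} (hg : LocallyIntegrable g) {φ : ℝ → ℝ}
    (hφ : ContDiff ℝ 1 φ) (hs : HasCompactSupport φ) :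
    ∫ x, (∫ t in 0..x, g t) * deriv φ x = -∫ x, g x * φ x := by
  obtain ⟨R, hR, hsub⟩ := support_subset_Ioo hs
  have hφ0 : ∀ x, x ∉ Set.Ioo (-R) R → φ x = 0 := fun x hx =>
    image_eq_zero_of_notMem_tsupport fun h => hx (hsub h)
  have hd0 : ∀ x, x ∉ Set.Ioo (-R) R → deriv φ x = 0 := fun x hx =>
    image_eq_zero_of_notMem_tsupport fun h => hx (hsub (closure_minimal
      (support_deriv_subset (f := φ)) isClosed_closure h))
  rw [integral_eq_intervalIntegral hR fun x hx => by rw [hd0 x hx, mul_zero],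
    integral_eq_intervalIntegral hR fun x hx => by rw [hφ0 x hx, mul_zero]]
  have hgi : IntervalIntegrable g volume (-R) R :=
    intervalIntegrable_of_locallyIntegrable hg _ _
  have hF : AbsolutelyContinuousOnInterval (fun x => ∫ t in 0..x, g t) (-R) R :=
    hgi.absolutelyContinuousOnInterval_intervalIntegral
      (by rw [Set.uIcc_of_le (by linarith)]; exact ⟨by linarith, hR.le⟩)
  rw [hF.integral_mul_deriv_eq_deriv_mul hφ.contDiffOn.absolutelyContinuousOnInterval,
    hφ0 R (by simp), hφ0 (-R) (by simp)]
  simp only [mul_zero, sub_zero, zero_sub]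
  congr 1
  refine intervalIntegral.integral_congr_ae ?_
  filter_upwards [_root_.LocallyIntegrable.ae_hasDerivAt_integral hg] with x hx _
  rw [(hx 0).deriv]

/-- The du Bois-Reymond lemma: a test function of integral zero is the derivative of a test
function, so `u` is orthogonal to it. -/
theorem ae_eq_const_of_integral_mul_deriv_eq_zero {u : ℝ → ℝ} (hu : LocallyIntegrable u)
    (h : ∀ φ : ℝ → ℝ, ContDiff ℝ ∞ φ → HasCompactSupport φ → ∫ x, u x * deriv φ x = 0) :
    ∃ c, ∀ᵐ x, u x = c := by
  set b : ContDiffBump (0 : ℝ) := ⟨1, 2, one_pos, one_lt_two⟩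
  set η : ℝ → ℝ := b.normed volume with hη
  have hηd : ContDiff ℝ ∞ η := b.contDiff_normed
  have hηs : HasCompactSupport η := b.hasCompactSupport_normed
  have hηi : ∫ x, η x = 1 := b.integral_normed
  refine ⟨∫ x, η x * u x, ?_⟩
  set c := ∫ x, η x * u x
  have hui : ∀ φ : ℝ → ℝ, ContDiff ℝ ∞ φ → HasCompactSupport φ → Integrable fun x => φ x * u x :=
    fun φ hφ hs => by
      simpa using! hu.integrable_smul_left_of_hasCompactSupport hφ.continuous hs
  have key : ∀ᵐ x, u x - c = 0 := by
    refine ae_eq_zero_of_integral_contDiff_smul_eq_zero (hu.sub (locallyIntegrable_const c)) ?_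
    intro φ hφ hs
    set I := ∫ x, φ x
    -- A general `φ` is brought to integral zero by subtracting the right multiple of the fixed bump
    -- `η`; this is what singles out the constant `c = ∫ η u`.
    set f : ℝ → ℝ := fun x => φ x - I * η x with hf
    have hfd : ContDiff ℝ ∞ f := hφ.sub (contDiff_const.mul hηd)
    have hfs : HasCompactSupport f := hs.sub (hηs.mul_left)
    have hfi : ∫ x, f x = 0 := by
      rw [hf, integral_sub (hφ.continuous.integrable_of_hasCompactSupport hs)
        ((hηd.continuous.integrable_of_hasCompactSupport hηs).const_mul I), integral_const_mul, hηi]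
      simp [I]
    obtain ⟨R, hR, hsub⟩ := support_subset_Ioo hfs
    have hf0 : ∀ x, x ∉ Set.Ioo (-R) R → f x = 0 := fun x hx =>
      image_eq_zero_of_notMem_tsupport fun h => hx (hsub h)
    set ψ : ℝ → ℝ := fun x => ∫ t in (-R)..x, f t with hψ
    have hψd : ∀ x, HasDerivAt ψ (f x) x := fun x =>
      intervalIntegral.integral_hasDerivAt_right (hfd.continuous.intervalIntegrable _ _)
        hfd.continuous.stronglyMeasurable.stronglyMeasurableAtFilter hfd.continuous.continuousAt
    have hψ' : deriv ψ = f := funext fun x => (hψd x).deriv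
    have hψc : ContDiff ℝ ∞ ψ := by
      rw [contDiff_infty_iff_deriv, hψ']
      exact ⟨fun x => (hψd x).differentiableAt, hfd⟩
    have hψ0 : ∀ x, x ∉ Set.Icc (-R) R → ψ x = 0 := fun x hx => by
      rw [Set.mem_Icc, not_and_or, not_le, not_le] at hx
      rcases hx with hx | hx
      · simp only [hψ]
        rw [intervalIntegral.integral_congr (g := fun _ => 0), intervalIntegral.integral_zero]
        intro t ht
        rw [Set.uIcc_of_ge hx.le] at ht
        exact hf0 t fun h => by linarith [h.1, ht.2]
      · have h1 := integral_eq_intervalIntegral hR hf0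
        rw [hfi] at h1
        simp only [hψ]
        rw [← intervalIntegral.integral_add_adjacent_intervals
          (hfd.continuous.intervalIntegrable (-R) R) (hfd.continuous.intervalIntegrable R x), ← h1,
          zero_add, intervalIntegral.integral_congr (g := fun _ => 0), intervalIntegral.integral_zero]
        intro t ht
        rw [Set.uIcc_of_le hx.le] at ht
        exact hf0 t fun h => by linarith [h.2, ht.1]
    have hψs : HasCompactSupport ψ := HasCompactSupport.intro isCompact_Icc hψ0
    have h0 := h ψ hψc hψs
    rw [hψ'] at h0
    have e1 : ∫ x, u x * f x = (∫ x, φ x * u x) - I * c := by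
      rw [← integral_const_mul, ← integral_sub (hui φ hφ hs) ((hui η hηd hηs).const_mul I)]
      exact integral_congr_ae (Eventually.of_forall fun x => by simp only [hf]; ring)
    have e2 : ∫ x, φ x • (u x - c) = (∫ x, φ x * u x) - I * c := by
      have : I * c = ∫ x, φ x * c := (integral_mul_const _ _).symm
      rw [this, ← integral_sub (hui φ hφ hs)
        ((hφ.continuous.integrable_of_hasCompactSupport hs).mul_const c)]
      exact integral_congr_ae (Eventually.of_forall fun x => by simp only [smul_eq_mul]; ring)
    change ∫ x, φ x • (u x - c) = 0
    rw [e2, ← e1, h0]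
  filter_upwards [key] with x hx using sub_eq_zero.1 hx

/-- Gives an `H¹_loc` function its absolutely continuous representative, on which the calibration
argument is carried out. -/
theorem exists_ae_eq_primitive {w g : ℝ → ℝ} (hw : LocallyIntegrable w) (hg : LocallyIntegrable g)
    (h : ∀ φ : ℝ → ℝ, ContDiff ℝ ∞ φ → HasCompactSupport φ →
      ∫ x, w x * deriv φ x = -∫ x, g x * φ x) :
    ∃ c, ∀ᵐ x, w x = c + ∫ t in 0..x, g t := by
  have hF : Continuous fun x => ∫ t in 0..x, g t :=
    intervalIntegral.continuous_primitive (fun _ _ => intervalIntegrable_of_locallyIntegrable hg _ _) 0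
  obtain ⟨c, hc⟩ := ae_eq_const_of_integral_mul_deriv_eq_zero (hw.sub hF.locallyIntegrable) (by
    intro φ hφ hs
    have hd : Continuous (deriv φ) := hφ.continuous_deriv (by simp)
    have h1 : Integrable fun x => w x * deriv φ x := by
      simpa [mul_comm] using! hw.integrable_smul_left_of_hasCompactSupport hd hs.deriv
    have h2 : Integrable fun x => (∫ t in 0..x, g t) * deriv φ x :=
      (hF.mul hd).integrable_of_hasCompactSupport hs.deriv.mul_left
    have := integral_sub h1 h2
    rw [h φ hφ hs, integral_primitive_mul_deriv hg (hφ.of_le (by simp)) hs, sub_self] at this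
    simpa [sub_mul] using this)
  refine ⟨c, ?_⟩
  filter_upwards [hc] with x hx
  simp only [Pi.sub_apply] at hx
  linarith

theorem _root_.AbsolutelyContinuousOnInterval.comp_lipschitzOnWith {f Φ : ℝ → ℝ} {a b : ℝ}
    (hf : AbsolutelyContinuousOnInterval f a b) {K : ℝ≥0} {s : Set ℝ} (hΦ : LipschitzOnWith K Φ s)
    (hs : Set.MapsTo f (Set.uIcc a b) s) :
    AbsolutelyContinuousOnInterval (fun x => Φ (f x)) a b := by
  rw [absolutelyContinuousOnInterval_iff] at hf ⊢
  intro ε hε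
  obtain ⟨δ, hδ, h⟩ := hf (ε / (K + 1)) (by positivity)
  refine ⟨δ, hδ, fun E hE hEδ => ?_⟩
  have h1 := h E hE hEδ
  have hmem : ∀ i ∈ Finset.range E.1, (E.2 i).1 ∈ Set.uIcc a b ∧ (E.2 i).2 ∈ Set.uIcc a b := by
    intro i hi
    exact hE.1 i hi
  calc ∑ i ∈ Finset.range E.1, dist (Φ (f (E.2 i).1)) (Φ (f (E.2 i).2))
      ≤ ∑ i ∈ Finset.range E.1, (K + 1) * dist (f (E.2 i).1) (f (E.2 i).2) := by
        refine Finset.sum_le_sum fun i hi => ?_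
        have := hΦ.dist_le_mul _ (hs (hmem i hi).1) _ (hs (hmem i hi).2)
        nlinarith [dist_nonneg (x := f (E.2 i).1) (y := f (E.2 i).2)]
    _ = (K + 1) * ∑ i ∈ Finset.range E.1, dist (f (E.2 i).1) (f (E.2 i).2) := by
        rw [Finset.mul_sum]
    _ < (K + 1) * (ε / (K + 1)) := by
        gcongr
    _ = ε := by field_simp

/-! ### The calibration of the profile problem -/

/-- The rate of the calibration, `√(s^β - s)`. -/
def calRate (β s : ℝ) : ℝ := √(s ^ β - s)

/-- The calibration `∫₀ˢ √(r^β - r) dr`. -/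
def cal (β s : ℝ) : ℝ := ∫ r in 0..s, calRate β r

theorem continuous_calRate {β : ℝ} (hβ : 0 ≤ β) : Continuous (calRate β) :=
  ((Real.continuous_rpow_const hβ).sub continuous_id).sqrt

theorem calRate_nonneg (β s : ℝ) : 0 ≤ calRate β s := Real.sqrt_nonneg _

theorem hasDerivAt_cal {β : ℝ} (hβ : 0 ≤ β) (s : ℝ) : HasDerivAt (cal β) (calRate β s) s :=
  intervalIntegral.integral_hasDerivAt_right ((continuous_calRate hβ).intervalIntegrable _ _)
    (continuous_calRate hβ).stronglyMeasurable.stronglyMeasurableAtFilter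
    (continuous_calRate hβ).continuousAt

theorem contDiff_cal {β : ℝ} (hβ : 0 ≤ β) : ContDiff ℝ 1 (cal β) := by
  have hd : deriv (cal β) = calRate β := funext fun s => (hasDerivAt_cal hβ s).deriv
  rw [contDiff_one_iff_deriv, hd]
  exact ⟨fun s => (hasDerivAt_cal hβ s).differentiableAt, continuous_calRate hβ⟩

theorem monotone_cal {β : ℝ} (hβ : 0 ≤ β) : Monotone (cal β) :=
  monotone_of_hasDerivAt_nonneg (hasDerivAt_cal hβ) fun s => calRate_nonneg β s

theorem cal_zero (β : ℝ) : cal β 0 = 0 := by simp [cal]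

theorem calRate_sq {β s : ℝ} (hβ : β ≤ 1) (h0 : 0 ≤ s) (h1 : s ≤ 1) :
    calRate β s ^ 2 = s ^ β - s := by
  rw [calRate, Real.sq_sqrt]
  rcases h0.eq_or_lt with rfl | h0
  · simpa using Real.zero_rpow_nonneg β
  · have := Real.rpow_le_rpow_of_exponent_ge h0 h1 hβ
    rw [Real.rpow_one] at this
    linarith

namespace IsUnitProfile

variable {β T : ℝ} {P P' : ℝ → ℝ}

theorem continuous (h : IsUnitProfile β P P' T) : Continuous P :=
  continuous_iff_continuousAt.2 fun t => (h.hasDerivAt t).continuousAt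

theorem hasCompactSupport (h : IsUnitProfile β P P' T) : HasCompactSupport P :=
  HasCompactSupport.intro isCompact_Icc fun t ht =>
    h.eq_zero t fun h' => ht (Set.Ioo_subset_Icc_self h')

theorem integral_eq (h : IsUnitProfile β P P' T) {f : ℝ → ℝ}
    (hf : ∀ t, t ∉ Set.Ioo 0 T → f t = 0) : ∫ t, f t = ∫ t in 0..T, f t := by
  rw [intervalIntegral.integral_of_le h.pos.le, setIntegral_eq_integral_of_forall_compl_eq_zero]
  exact fun x hx => hf x fun h => hx ⟨h.1, h.2.le⟩

/-- Along the profile `P'² = calRate β P · |P'|`, which is plus or minus the derivative of `cal β ∘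
P`. It climbs once from `0` to `1` and comes back once, hence the factor `2`. -/
theorem integral_deriv_sq (h : IsUnitProfile β P P' T) (hβ : 0 ≤ β) :
    ∫ t, P' t ^ 2 = 2 * cal β 1 := by
  rw [h.integral_eq fun t ht => by rw [h.deriv_eq_zero t ht]; ring]
  obtain ⟨t₁, ht₁, hp, hup, hdown⟩ := h.peak
  have hc : Continuous fun t => P' t ^ 2 := h.continuous_deriv.pow 2
  have habs : ∀ t, calRate β (P t) = |P' t| := fun t => by
    rw [calRate, ← h.deriv_sq, Real.sqrt_sq_eq_abs]
  have hd : ∀ t, HasDerivAt (fun t => cal β (P t)) (|P' t| * P' t) t := fun t => by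
    have := (hasDerivAt_cal hβ (P t)).comp t (h.hasDerivAt t)
    rwa [habs] at this
  have hdc : Continuous fun t => |P' t| * P' t := h.continuous_deriv.abs.mul h.continuous_deriv
  have h1 := intervalIntegral.integral_eq_sub_of_hasDerivAt (a := 0) (b := t₁) (fun t _ => hd t)
    (hdc.intervalIntegrable _ _)
  have h2 := intervalIntegral.integral_eq_sub_of_hasDerivAt (a := t₁) (b := T) (fun t _ => hd t)
    (hdc.intervalIntegrable _ _)
  rw [hp, h.eq_zero 0 (by simp), cal_zero] at h1
  rw [hp, h.eq_zero T (by simp), cal_zero] at h2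
  rw [← intervalIntegral.integral_add_adjacent_intervals (hc.intervalIntegrable 0 t₁)
    (hc.intervalIntegrable t₁ T)]
  have e1 : ∫ t in 0..t₁, P' t ^ 2 = ∫ t in 0..t₁, |P' t| * P' t := by
    refine intervalIntegral.integral_congr fun t ht => ?_
    rw [Set.uIcc_of_le ht₁.1] at ht
    rw [abs_of_nonneg (hup t ht.2), sq]
  have e2 : ∫ t in t₁..T, P' t ^ 2 = -∫ t in t₁..T, |P' t| * P' t := by
    rw [← intervalIntegral.integral_neg]
    refine intervalIntegral.integral_congr fun t ht => ?_
    rw [Set.uIcc_of_le ht₁.2] at ht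
    rw [abs_of_nonpos (hdown t ht.1)]; ring
  rw [e1, e2, h1, h2]; ring

theorem integral_pos (h : IsUnitProfile β P P' T) : 0 < ∫ t, P t := by
  rw [integral_pos_iff_support_of_nonneg h.nonneg
    (h.continuous.integrable_of_hasCompactSupport h.hasCompactSupport)]
  obtain ⟨t₁, -, hp, -⟩ := h.peak
  exact h.continuous.isOpen_support.measure_pos _ ⟨t₁, by simp [hp]⟩

theorem balance' (h : IsUnitProfile β P P' T) :
    (2 + β) * ∫ t, P' t ^ 2 = (1 - β) * ∫ t, P t := by
  rw [h.integral_eq fun t ht => by rw [h.deriv_eq_zero t ht]; ring, h.integral_eq h.eq_zero,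
    h.balance]

theorem integrable_deriv_sq (h : IsUnitProfile β P P' T) : Integrable fun t => P' t ^ 2 :=
  (h.continuous_deriv.pow 2).integrable_of_hasCompactSupport
    (HasCompactSupport.intro isCompact_Icc fun t ht => by
      change P' t ^ 2 = 0
      rw [h.deriv_eq_zero t fun h' => ht (Set.Ioo_subset_Icc_self h')]; simp)

theorem integral_rpow (h : IsUnitProfile β P P' T) :
    ∫ t, P t ^ β = (∫ t, P t) + ∫ t, P' t ^ 2 := by
  rw [← integral_add (h.continuous.integrable_of_hasCompactSupport h.hasCompactSupport)
    h.integrable_deriv_sq]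
  exact integral_congr_ae (Eventually.of_forall fun t => by simp only [h.deriv_sq t]; ring)

end IsUnitProfile

/-! ### The lower bound -/

theorem exists_lt_of_integrable {f : ℝ → ℝ} (hf : Integrable f) {η : ℝ} (hη : 0 < η) {s : Set ℝ}
    (hs : volume s = ⊤) : ∃ x ∈ s, f x < η := by
  by_contra! hcon
  have h1 : s ⊆ {x | η ≤ f x} := fun x hx => hcon x hx
  have h2 := hf.measure_ge_lt_top hη
  have := (measure_mono h1).trans_lt h2
  rw [hs] at this
  exact lt_irrefl _ this

/-- In any unit interval to the right of `x` a function of mass one takes a value at most `2`, and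
over that interval it varies by at most `∫ (1 + g²)`. -/
theorem profile_bounded {f g : ℝ → ℝ} {c : ℝ} (hg : LocallyIntegrable g)
    (hf : ∀ x, f x = c + ∫ t in 0..x, g t) (hfi : Integrable f) (hf1 : ∫ x, f x = 1)
    (hf0 : ∀ x, 0 ≤ f x) (hg2 : Integrable fun x => g x ^ 2) (x : ℝ) :
    f x ≤ 3 + ∫ t, g t ^ 2 := by
  have hfc : Continuous f := by
    rw [funext hf]
    exact continuous_const.add
      (intervalIntegral.continuous_primitive (intervalIntegrable_of_locallyIntegrable hg) 0)
  have hex : ∃ y ∈ Set.Icc x (x + 1), f y ≤ 2 := by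
    by_contra! hcon
    have h1 : ∫ t in Set.Icc x (x + 1), (2 : ℝ) ≤ ∫ t in Set.Icc x (x + 1), f t :=
      setIntegral_mono_on (by simp) hfi.integrableOn measurableSet_Icc
        fun t ht => (hcon t ht).le
    have h2 := setIntegral_le_integral (s := Set.Icc x (x + 1)) hfi (Eventually.of_forall hf0)
    rw [setIntegral_const] at h1
    simp at h1
    linarith
  obtain ⟨y, hy, hfy⟩ := hex
  have hgi := intervalIntegrable_of_locallyIntegrable hg
  have h1 : f x = f y - ∫ t in x..y, g t := by
    rw [hf x, hf y, ← intervalIntegral.integral_interval_sub_left (hgi 0 y) (hgi 0 x)]; ring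
  have h2 : -∫ t in x..y, g t ≤ ∫ t in x..y, (1 + g t ^ 2) := by
    rw [← intervalIntegral.integral_neg]
    refine intervalIntegral.integral_mono_on hy.1 (hgi x y).neg
      (intervalIntegrable_const.add hg2.intervalIntegrable) fun t _ => ?_
    nlinarith [sq_nonneg (g t + 1)]
  have h3 : ∫ t in x..y, (1 + g t ^ 2) ≤ 1 + ∫ t, g t ^ 2 := by
    rw [intervalIntegral.integral_add intervalIntegrable_const hg2.intervalIntegrable]
    have : ∫ t in x..y, g t ^ 2 ≤ ∫ t, g t ^ 2 := by
      rw [intervalIntegral.integral_of_le hy.1]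
      exact setIntegral_le_integral hg2 (Eventually.of_forall fun t => sq_nonneg _)
    have h4 : ∫ t in x..y, (1 : ℝ) = y - x := by simp
    rw [h4]
    linarith [hy.2]
  linarith

/-- The composition stays absolutely continuous because `cal β` is `C¹`, hence Lipschitz on the
bounded range of `f / M`; the chain rule then holds almost everywhere. -/
theorem cal_comp_sub {β : ℝ} (hβ : 0 ≤ β) {f g : ℝ → ℝ} {c M : ℝ} (hg : LocallyIntegrable g)
    (hf : ∀ x, f x = c + ∫ t in 0..x, g t) (a b : ℝ) :
    cal β (f b / M) - cal β (f a / M) = ∫ t in a..b, calRate β (f t / M) * (g t / M) := by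
  have hgi := intervalIntegrable_of_locallyIntegrable hg
  have hac : AbsolutelyContinuousOnInterval (fun x => f x / M) a b := by
    have h1 : AbsolutelyContinuousOnInterval (fun x => ∫ t in a..x, g t) a b :=
      (hgi a b).absolutelyContinuousOnInterval_intervalIntegral Set.left_mem_uIcc
    have h2 : AbsolutelyContinuousOnInterval (fun _ : ℝ => f a / M) a b :=
      (contDiff_const.contDiffOn (n := 1)).absolutelyContinuousOnInterval
    have h3 := h2.add (h1.const_mul M⁻¹)
    have e : (fun x => f x / M) = (fun _ : ℝ => f a / M) + fun x => M⁻¹ * ∫ t in a..x, g t := by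
      ext x
      simp only [Pi.add_apply]
      rw [hf x, hf a, ← intervalIntegral.integral_interval_sub_left (hgi 0 x) (hgi 0 a)]
      ring
    rw [e]; exact h3
  obtain ⟨B, hB⟩ := hac.exists_bound
  obtain ⟨K, hK⟩ := (contDiff_cal hβ).contDiffOn.exists_lipschitzOnWith (s := Set.Icc (-B) B)
    (by simp) (convex_Icc _ _) isCompact_Icc
  have hac2 := hac.comp_lipschitzOnWith hK fun x hx => abs_le.1 (hB x hx)
  rw [← hac2.integral_deriv_eq_sub]
  refine intervalIntegral.integral_congr_ae ?_
  filter_upwards [_root_.LocallyIntegrable.ae_hasDerivAt_integral hg] with x hx _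
  have h1 : HasDerivAt (fun x => f x / M) (g x / M) x := by
    have := ((hx 0).const_add c).div_const M
    simpa only [← hf] using this
  exact ((hasDerivAt_cal hβ (f x / M)).comp x h1).deriv

/-- With `M` the supremum of `f` and `v = f/M`, the difference `f^β - M^(β-1) f` equals `M^β (v^β -
v)`, nonnegative since `0 ≤ v ≤ 1`. The inequality `a² + b² ≥ 2ab` bounds its sum with `g²` from
below by a multiple of `|(cal β ∘ v)'|`. The mass constraint handles the subtracted term, and `cal β
∘ v` has total variation at least `2 cal β 1`. -/
theorem profile_lower_bound {β : ℝ} (h0 : 0 < β) (h1 : β < 1) {f g : ℝ → ℝ} {c : ℝ}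
    (hg : LocallyIntegrable g) (hf : ∀ x, f x = c + ∫ t in 0..x, g t) (hfi : Integrable f)
    (hf1 : ∫ x, f x = 1) (hf0 : ∀ x, 0 ≤ f x) (hg2 : Integrable fun x => g x ^ 2)
    (hfb : Integrable fun x => f x ^ β) :
    ∃ M > 0, M ^ (β - 1) + 4 * M ^ (1 + β / 2) * cal β 1 ≤
      (∫ x, f x ^ β) + ∫ x, g x ^ 2 := by
  have hfc : Continuous f := by
    rw [funext hf]
    exact continuous_const.add
      (intervalIntegral.continuous_primitive (intervalIntegrable_of_locallyIntegrable hg) 0)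
  have hbdd : BddAbove (Set.range f) := ⟨_, by
    rintro _ ⟨x, rfl⟩; exact profile_bounded hg hf hfi hf1 hf0 hg2 x⟩
  set M := sSup (Set.range f) with hM
  have hle : ∀ x, f x ≤ M := fun x => le_csSup hbdd ⟨x, rfl⟩
  have hMpos : 0 < M := by
    by_contra hneg
    have : ∀ x, f x = 0 := fun x => le_antisymm ((hle x).trans (not_lt.1 hneg)) (hf0 x)
    simp [this] at hf1
  refine ⟨M, hMpos, ?_⟩
  set k : ℝ → ℝ := fun x => calRate β (f x / M) * (|g x| / M) with hk
  have hgm : AEStronglyMeasurable g := hg.aestronglyMeasurable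
  have hkm : AEStronglyMeasurable k :=
    ((continuous_calRate h0.le).comp (hfc.div_const M)).aestronglyMeasurable.mul
      (by simpa [div_eq_mul_inv] using hgm.norm.mul_const M⁻¹)
  have hk0 : ∀ x, 0 ≤ k x := fun x =>
    mul_nonneg (calRate_nonneg _ _) (div_nonneg (abs_nonneg _) hMpos.le)
  have hpt : ∀ x, M ^ (β - 1) * f x + 2 * M ^ (1 + β / 2) * k x ≤ f x ^ β + g x ^ 2 := by
    intro x
    have hv0 : 0 ≤ f x / M := div_nonneg (hf0 x) hMpos.le
    have hv1 : f x / M ≤ 1 := (div_le_one hMpos).2 (hle x)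
    have e1 : f x ^ β = M ^ β * (f x / M) ^ β := by
      rw [← Real.mul_rpow hMpos.le hv0, mul_div_cancel₀ _ hMpos.ne']
    have e2 : M ^ (β - 1) * f x = M ^ β * (f x / M) := by
      rw [Real.rpow_sub_one hMpos.ne']; ring
    have e3 : (M ^ (β / 2)) ^ 2 = M ^ β := by
      rw [← Real.rpow_natCast, ← Real.rpow_mul hMpos.le]; congr 1; push_cast; ring
    have e4 : 2 * M ^ (1 + β / 2) * k x = 2 * (M ^ (β / 2) * calRate β (f x / M)) * |g x| := by
      rw [hk, Real.rpow_add hMpos, Real.rpow_one]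
      field_simp
    have e5 := calRate_sq h1.le hv0 hv1
    rw [e4, e2, e1, ← sq_abs (g x)]
    have e6 := sq_nonneg (M ^ (β / 2) * calRate β (f x / M) - |g x|)
    have e7 : (M ^ (β / 2) * calRate β (f x / M)) ^ 2 = M ^ β * ((f x / M) ^ β - f x / M) := by
      rw [mul_pow, e3, e5]
    nlinarith
  have hMb : 0 < M ^ (1 + β / 2) := Real.rpow_pos_of_pos hMpos _
  have hki : Integrable k := by
    refine ((hfb.add hg2).const_mul (2 * M ^ (1 + β / 2))⁻¹).mono' hkm
      (Eventually.of_forall fun x => ?_)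
    rw [Real.norm_of_nonneg (hk0 x), Pi.add_apply, ← div_eq_inv_mul, le_div_iff₀ (by positivity)]
    have := hpt x
    have : 0 ≤ M ^ (β - 1) * f x := mul_nonneg (Real.rpow_nonneg hMpos.le _) (hf0 x)
    linarith
  -- The supremum and the decay at infinity may be attained only approximately: `v` exceeds `1 - η`
  -- at some `x` and is below `η` at a point on each side. Then `η → 0`.
  have hkint : 2 * cal β 1 ≤ ∫ x, k x := by
    have hlim : Tendsto (fun η : ℝ => 2 * cal β (1 - η) - 2 * cal β η) (𝓝[>] 0) (𝓝 (2 * cal β 1)) := by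
      have hc := (contDiff_cal h0.le).continuous
      have : Continuous fun η : ℝ => 2 * cal β (1 - η) - 2 * cal β η := by fun_prop
      have := (this.tendsto 0).mono_left (nhdsWithin_le_nhds (s := Set.Ioi 0))
      simpa [cal_zero] using this
    refine le_of_tendsto hlim ?_
    filter_upwards [self_mem_nhdsWithin] with η hη
    have hη : 0 < η := hη
    obtain ⟨_, ⟨x, rfl⟩, hx⟩ : ∃ y ∈ Set.range f, (1 - η) * M < y :=
      exists_lt_of_lt_csSup (Set.range_nonempty f) (by nlinarith)
    obtain ⟨a, ha, hfa⟩ := exists_lt_of_integrable hfi (mul_pos hη hMpos) (s := Set.Iio x)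
      Real.volume_Iio
    obtain ⟨b, hb, hfb'⟩ := exists_lt_of_integrable hfi (mul_pos hη hMpos) (s := Set.Ioi x)
      Real.volume_Ioi
    have hax : a ≤ x := le_of_lt ha
    have hxb : x ≤ b := le_of_lt hb
    have m1 : cal β (1 - η) ≤ cal β (f x / M) := monotone_cal h0.le ((le_div_iff₀ hMpos).2 hx.le)
    have m2 : cal β (f a / M) ≤ cal β η := monotone_cal h0.le ((div_le_iff₀ hMpos).2 hfa.le)
    have m3 : cal β (f b / M) ≤ cal β η := monotone_cal h0.le ((div_le_iff₀ hMpos).2 hfb'.le)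
    have c1 := cal_comp_sub h0.le (M := M) hg hf a x
    have c2 := cal_comp_sub h0.le (M := M) hg hf x b
    have habs : ∀ t, ‖calRate β (f t / M) * (g t / M)‖ = k t := fun t => by
      rw [norm_mul, Real.norm_of_nonneg (calRate_nonneg _ _), norm_div, Real.norm_eq_abs,
        Real.norm_of_nonneg hMpos.le]
    have b1 : cal β (f x / M) - cal β (f a / M) ≤ ∫ t in a..x, k t := by
      rw [c1, intervalIntegral.integral_of_le hax, intervalIntegral.integral_of_le hax]
      refine (Real.le_norm_self _).trans ((norm_integral_le_integral_norm _).trans (le_of_eq ?_))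
      simp only [habs]
    have b2 : cal β (f x / M) - cal β (f b / M) ≤ ∫ t in x..b, k t := by
      rw [← neg_sub, c2, intervalIntegral.integral_of_le hxb, intervalIntegral.integral_of_le hxb]
      refine ((neg_le_abs _).trans (Real.norm_eq_abs _).ge).trans ((norm_integral_le_integral_norm _).trans (le_of_eq ?_))
      simp only [habs]
    have b3 : ∫ t in a..b, k t ≤ ∫ t, k t := by
      rw [intervalIntegral.integral_of_le (hax.trans hxb)]
      exact setIntegral_le_integral hki (Eventually.of_forall hk0)
    rw [← intervalIntegral.integral_add_adjacent_intervals (b := x) hki.intervalIntegrable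
      hki.intervalIntegrable] at b3
    linarith
  have hint := integral_mono ((hfi.const_mul (M ^ (β - 1))).add (hki.const_mul (2 * M ^ (1 + β / 2))))
    (hfb.add hg2) hpt
  simp only [Pi.add_apply] at hint
  rw [integral_add (hfi.const_mul _) (hki.const_mul _), integral_const_mul, integral_const_mul, hf1,
    integral_add hfb hg2] at hint
  nlinarith

/-! ### Optimal height, value of `c₀`, and profiles of arbitrary mass -/

theorem betaExp_pos {α : ℝ} (hα : 1 / 2 < α) : 0 < betaExp α :=
  div_pos (by linarith) (by linarith)

theorem betaExp_lt_one {α : ℝ} (hα : 1 / 2 < α) (hα' : α < 1) : betaExp α < 1 := by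
  rw [betaExp, div_lt_one (by linarith)]; linarith

/-- With `M = m exp t`, the right-hand side is a positive combination of two exponentials in `t`.
Each lies above its tangent at `t = 0`, and the balance relation says precisely that the linear
terms cancel. -/
theorem optimal_height {β A D m M κ : ℝ} (hm : 0 < m) (hM : 0 < M) (hA : 0 < A) (hD : D = 2 * κ)
    (hD0 : 0 ≤ D) (hmA : m ^ (2 - β / 2) * A = 1) (hbal : (2 + β) * D = (1 - β) * A) :
    m ^ (1 + β / 2) * (A + 2 * D) ≤ M ^ (β - 1) + 4 * M ^ (1 + β / 2) * κ := by
  obtain ⟨t, rfl⟩ : ∃ t, M = m * Real.exp t :=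
    ⟨Real.log (M / m), by rw [Real.exp_log (div_pos hM hm), mul_div_cancel₀ _ hm.ne']⟩
  have e1 : m ^ (β - 1) = m ^ (1 + β / 2) * A := by
    have : m ^ (1 + β / 2) = m ^ (β - 1) * m ^ (2 - β / 2) := by
      rw [← Real.rpow_add hm]; congr 1; ring
    rw [this, mul_assoc, hmA, mul_one]
  rw [Real.mul_rpow hm.le (Real.exp_pos t).le, Real.mul_rpow hm.le (Real.exp_pos t).le,
    ← Real.exp_mul, ← Real.exp_mul, e1]
  have hp : 0 < m ^ (1 + β / 2) := Real.rpow_pos_of_pos hm _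
  have h1 := Real.add_one_le_exp (t * (β - 1))
  have h2 := Real.add_one_le_exp (t * (1 + β / 2))
  have h3 : A + 2 * D ≤ A * Real.exp (t * (β - 1)) + 4 * Real.exp (t * (1 + β / 2)) * κ := by
    have h4 := mul_le_mul_of_nonneg_left h1 hA.le
    have h5 := mul_le_mul_of_nonneg_left h2 hD0
    have h6 : 4 * Real.exp (t * (1 + β / 2)) * κ = 2 * (D * Real.exp (t * (1 + β / 2))) := by
      rw [hD]; ring
    rw [h6]
    have h7 : A * (t * (β - 1) + 1) + 2 * (D * (t * (1 + β / 2) + 1)) = A + 2 * D := by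
      linear_combination t * hbal
    linarith
  calc _ ≤ m ^ (1 + β / 2) * (A * Real.exp (t * (β - 1)) + 4 * Real.exp (t * (1 + β / 2)) * κ) :=
        mul_le_mul_of_nonneg_left h3 hp.le
    _ = _ := by ring

/-- Transfers the calibration bound from the continuous representative to an arbitrary admissible
pair; infinite energies are trivial, and finite ones supply the integrability the bound requires. -/
theorem le_energy_of_isProfile {β C : ℝ} (h0 : 0 < β) (h1 : β < 1)
    (hC : ∀ M > 0, C ≤ M ^ (β - 1) + 4 * M ^ (1 + β / 2) * cal β 1) {w g : ℝ → ℝ}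
    (h : IsProfile w g) :
    ENNReal.ofReal C ≤ (∫⁻ x, ENNReal.ofReal (w x ^ β)) + ∫⁻ x, ENNReal.ofReal (g x ^ 2) := by
  by_cases hfin : (∫⁻ x, ENNReal.ofReal (w x ^ β)) + ∫⁻ x, ENNReal.ofReal (g x ^ 2) = ⊤
  · rw [hfin]; exact le_top
  rw [ENNReal.add_eq_top, not_or] at hfin
  have hloc : ∀ {u : ℝ → ℝ}, (∀ K : Set ℝ, IsCompact K → MemLp u 2 (volume.restrict K)) →
      LocallyIntegrable u := fun {u} hu => by
    rw [locallyIntegrable_iff]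
    intro K hK
    have : IsFiniteMeasure ((volume : Measure ℝ).restrict K) :=
      ⟨by simpa using hK.measure_lt_top⟩
    exact (hu K hK).integrable one_le_two
  have hw := hloc h.memLp_loc
  have hg := hloc h.memLp_loc_deriv
  obtain ⟨c, hc⟩ := exists_ae_eq_primitive hw hg h.weak_deriv
  set f : ℝ → ℝ := fun x => c + ∫ t in 0..x, g t with hf
  have hwf : w =ᵐ[volume] f := hc
  have hfc : Continuous f := continuous_const.add
    (intervalIntegral.continuous_primitive (intervalIntegrable_of_locallyIntegrable hg) 0)
  have hf0 : ∀ x, 0 ≤ f x := by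
    have hopen : IsOpen {x | f x < 0} := isOpen_lt hfc continuous_const
    have hnull : volume {x | f x < 0} = 0 := by
      have : ∀ᵐ x, ¬ f x < 0 := by
        filter_upwards [hwf] with x hx
        rw [← hx]; exact not_lt.2 (h.nonneg x)
      simpa [ae_iff] using this
    have := (hopen.measure_eq_zero_iff volume).1 hnull
    intro x
    by_contra hneg
    exact (Set.eq_empty_iff_forall_notMem.1 this x) (not_le.1 hneg)
  have hfb_c : Continuous fun x => f x ^ β := hfc.rpow_const fun _ => Or.inr h0.le
  have l1 : ∫⁻ x, ENNReal.ofReal (f x) = 1 := by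
    rw [← h.lintegral_eq_one]
    exact lintegral_congr_ae (hwf.mono fun x hx => by simp only [hx])
  have l2 : ∫⁻ x, ENNReal.ofReal (w x ^ β) = ∫⁻ x, ENNReal.ofReal (f x ^ β) :=
    lintegral_congr_ae (hwf.mono fun x hx => by simp only [hx])
  have hfi : Integrable f := by
    refine (lintegral_ofReal_ne_top_iff_integrable hfc.aestronglyMeasurable
      (Eventually.of_forall hf0)).1 (by rw [l1]; exact ENNReal.one_ne_top)
  have hfb : Integrable fun x => f x ^ β :=
    (lintegral_ofReal_ne_top_iff_integrable hfb_c.aestronglyMeasurable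
      (Eventually.of_forall fun x => Real.rpow_nonneg (hf0 x) _)).1 (by rw [← l2]; exact hfin.1)
  have hg2 : Integrable fun x => g x ^ 2 :=
    (lintegral_ofReal_ne_top_iff_integrable (hg.aestronglyMeasurable.pow 2)
      (Eventually.of_forall fun x => sq_nonneg _)).1 hfin.2
  have hf1 : ∫ x, f x = 1 := by
    rw [integral_eq_lintegral_of_nonneg_ae (Eventually.of_forall hf0) hfc.aestronglyMeasurable, l1]
    simp
  obtain ⟨M, hM, hb⟩ := profile_lower_bound h0 h1 hg (fun _ => rfl) hfi hf1 hf0 hg2 hfb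
  rw [l2, ← ofReal_integral_eq_lintegral_ofReal hfb
    (Eventually.of_forall fun x => Real.rpow_nonneg (hf0 x) _),
    ← ofReal_integral_eq_lintegral_ofReal hg2 (Eventually.of_forall fun x => sq_nonneg _),
    ← ENNReal.ofReal_add (integral_nonneg fun x => Real.rpow_nonneg (hf0 x) _)
      (integral_nonneg fun x => sq_nonneg _)]
  exact ENNReal.ofReal_le_ofReal ((hC M hM).trans hb)

/-- A profile of class `C¹` with compact support, of mass `θ` and energy `c`. -/
structure IsEdgeProfile (β θ c : ℝ) (W W' : ℝ → ℝ) (R : ℝ) : Prop where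
  pos : 0 < R
  continuous_deriv : Continuous W'
  hasDerivAt : ∀ y, HasDerivAt W (W' y) y
  nonneg : ∀ y, 0 ≤ W y
  eq_zero : ∀ y, R ≤ |y| → W y = 0
  deriv_eq_zero : ∀ y, R ≤ |y| → W' y = 0
  mass : ∫ y, W y = θ
  energy : (∫ y, W y ^ β) + ∫ y, W' y ^ 2 = c

theorem IsUnitProfile.isEdgeProfile {β T : ℝ} {P P' : ℝ → ℝ} (h : IsUnitProfile β P P' T)
    {m l : ℝ} (hm : 0 < m) (hl : 0 < l) :
    IsEdgeProfile β (m * l * ∫ t, P t)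
      (m ^ β * l * ((∫ t, P t) + ∫ t, P' t ^ 2) + m ^ 2 / l * ∫ t, P' t ^ 2)
      (fun y => m * P (y / l)) (fun y => m / l * P' (y / l)) (l * T) := by
  have hnot : ∀ y, l * T ≤ |y| → y / l ∉ Set.Ioo 0 T := fun y hy hmem => by
    have h1 : 0 < y := by
      have := mul_pos hmem.1 hl
      rwa [div_mul_cancel₀ _ hl.ne'] at this
    rw [abs_of_pos h1] at hy
    have := (div_lt_iff₀ hl).1 hmem.2
    linarith
  refine ⟨mul_pos hl h.pos, continuous_const.mul (h.continuous_deriv.comp (continuous_id.div_const l)),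
    fun y => ?_, fun y => mul_nonneg hm.le (h.nonneg _), fun y hy => ?_, fun y hy => ?_, ?_, ?_⟩
  · have := ((h.hasDerivAt (y / l)).comp y ((hasDerivAt_id y).div_const l)).const_mul m
    refine this.congr_deriv ?_
    ring
  · rw [h.eq_zero _ (hnot y hy), mul_zero]
  · rw [h.deriv_eq_zero _ (hnot y hy), mul_zero]
  · rw [integral_const_mul, Measure.integral_comp_div, smul_eq_mul, abs_of_pos hl]; ring
  · have e1 : ∀ y, (m * P (y / l)) ^ β = m ^ β * P (y / l) ^ β := fun y =>
      Real.mul_rpow hm.le (h.nonneg _)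
    have e2 : ∀ y, (m / l * P' (y / l)) ^ 2 = (m / l) ^ 2 * P' (y / l) ^ 2 := fun y => mul_pow _ _ _
    simp only [e1, e2]
    rw [integral_const_mul, integral_const_mul, Measure.integral_comp_div (fun t => P t ^ β),
      Measure.integral_comp_div (fun t => P' t ^ 2), h.integral_rpow, smul_eq_mul, smul_eq_mul,
      abs_of_pos hl]
    field_simp

theorem IsEdgeProfile.continuous {β θ c R : ℝ} {W W' : ℝ → ℝ} (h : IsEdgeProfile β θ c W W' R) :
    Continuous W :=
  continuous_iff_continuousAt.2 fun t => (h.hasDerivAt t).continuousAt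

theorem IsEdgeProfile.contDiff {β θ c R : ℝ} {W W' : ℝ → ℝ} (h : IsEdgeProfile β θ c W W' R) :
    ContDiff ℝ 1 W := by
  have hd : deriv W = W' := funext fun s => (h.hasDerivAt s).deriv
  rw [contDiff_one_iff_deriv, hd]
  exact ⟨fun s => (h.hasDerivAt s).differentiableAt, h.continuous_deriv⟩

theorem hasCompactSupport_of_abs {R : ℝ} {f : ℝ → ℝ} (hf : ∀ y, R ≤ |y| → f y = 0) :
    HasCompactSupport f :=
  HasCompactSupport.intro (isCompact_Icc (a := -R) (b := R)) fun y hy => hf y (by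
    by_contra hlt
    exact hy (abs_le.1 (not_le.1 hlt).le))

theorem IsEdgeProfile.integrable {β θ c R : ℝ} {W W' : ℝ → ℝ}
    (h : IsEdgeProfile β θ c W W' R) : Integrable W :=
  h.continuous.integrable_of_hasCompactSupport (hasCompactSupport_of_abs h.eq_zero)

theorem IsEdgeProfile.integrable_rpow {β θ c R : ℝ} {W W' : ℝ → ℝ} (hβ : 0 < β)
    (h : IsEdgeProfile β θ c W W' R) : Integrable fun y => W y ^ β :=
  (h.continuous.rpow_const fun _ => Or.inr hβ.le).integrable_of_hasCompactSupport
    (hasCompactSupport_of_abs fun y hy => by rw [h.eq_zero y hy, Real.zero_rpow hβ.ne'])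

theorem IsEdgeProfile.integrable_deriv_sq {β θ c R : ℝ} {W W' : ℝ → ℝ}
    (h : IsEdgeProfile β θ c W W' R) : Integrable fun y => W' y ^ 2 :=
  (h.continuous_deriv.pow 2).integrable_of_hasCompactSupport
    (hasCompactSupport_of_abs fun y hy => by
      change W' y ^ 2 = 0
      rw [h.deriv_eq_zero y hy]; simp)

theorem IsEdgeProfile.isProfile {β c R : ℝ} {W W' : ℝ → ℝ} (h : IsEdgeProfile β 1 c W W' R) :
    IsProfile W W' := by
  have hmem : ∀ {u : ℝ → ℝ}, Continuous u → ∀ K : Set ℝ, IsCompact K →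
      MemLp u 2 (volume.restrict K) := fun {u} hu K hK => by
    have : IsFiniteMeasure ((volume : Measure ℝ).restrict K) :=
      ⟨by simpa using hK.measure_lt_top⟩
    obtain ⟨B, hB⟩ := hK.exists_bound_of_continuousOn hu.continuousOn
    exact MemLp.of_bound hu.aestronglyMeasurable B
      ((ae_restrict_iff' hK.measurableSet).2 (Eventually.of_forall hB))
  refine ⟨h.nonneg, hmem h.continuous, hmem h.continuous_deriv, fun φ hφ hs => ?_, ?_⟩
  · have hd : Continuous (deriv φ) := hφ.continuous_deriv (by simp)
    refine integral_mul_deriv_eq_deriv_mul_of_integrable (fun x _ => h.hasDerivAt x)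
      (fun x _ => (hφ.differentiable (by simp) x).hasDerivAt) ?_ ?_ ?_
    · exact (h.continuous.mul hd).integrable_of_hasCompactSupport hs.deriv.mul_left
    · exact (h.continuous_deriv.mul hφ.continuous).integrable_of_hasCompactSupport hs.mul_left
    · exact (h.continuous.mul hφ.continuous).integrable_of_hasCompactSupport hs.mul_left
  · rw [← ofReal_integral_eq_lintegral_ofReal h.integrable (Eventually.of_forall h.nonneg), h.mass,
      ENNReal.ofReal_one]

/-- The rescaling `m P(y/l)` of the unit profile has mass one and a cost equal to the lower bound,
which determines `c₀`. Rescaling height and width once more by powers of `θ` changes both terms of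
the cost by the same factor `θ^α`. -/
theorem cZero_and_edgeProfiles {α : ℝ} (hα : 1 / 2 < α) (hα' : α < 1) :
    cZero α ≠ ⊤ ∧ ∀ θ > 0, ∃ W W' R,
      IsEdgeProfile (betaExp α) θ ((cZero α).toReal * θ ^ α) W W' R := by
  have h0 := betaExp_pos hα
  have h1 := betaExp_lt_one hα hα'
  set β := betaExp α with hβ
  have hβα : β * (α + 1) = 4 * α - 2 := div_mul_cancel₀ _ (by linarith)
  obtain ⟨P, P', T, hP⟩ := exists_isUnitProfile h0 h1
  set A := ∫ t, P t with hA
  set D := ∫ t, P' t ^ 2 with hD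
  have hApos : 0 < A := hP.integral_pos
  have hD0 : 0 ≤ D := integral_nonneg fun t => sq_nonneg _
  -- The critical height of the lower bound. With the width `l = m^(1-β/2)` it also makes `m^β l =
  -- m²/l`, so that the mass is one and the cost is the bound.
  set m : ℝ := A ^ (-(2 - β / 2)⁻¹) with hm
  have hmpos : 0 < m := Real.rpow_pos_of_pos hApos _
  have hmA : m ^ (2 - β / 2) * A = 1 := by
    rw [hm, ← Real.rpow_mul hApos.le, neg_mul, inv_mul_cancel₀ (by linarith), Real.rpow_neg_one,
      inv_mul_cancel₀ hApos.ne']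
  set l : ℝ := m ^ (1 - β / 2) with hl
  have hlpos : 0 < l := Real.rpow_pos_of_pos hmpos _
  have hml : m * l = m ^ (2 - β / 2) := by
    rw [hl, ← Real.rpow_one_add' hmpos.le (by linarith)]; congr 1; ring
  set C := m ^ (1 + β / 2) * (A + 2 * D) with hC
  have hCpos : 0 ≤ C := by positivity
  have hlow : ∀ M > 0, C ≤ M ^ (β - 1) + 4 * M ^ (1 + β / 2) * cal β 1 := fun M hM =>
    optimal_height hmpos hM hApos (hP.integral_deriv_sq h0.le) hD0 hmA hP.balance'
  have e1 : m ^ β * l = m ^ (1 + β / 2) := by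
    rw [hl, ← Real.rpow_add hmpos]; congr 1; ring
  have e2 : m ^ 2 / l = m ^ (1 + β / 2) := by
    rw [hl, ← Real.rpow_natCast, ← Real.rpow_sub hmpos]; congr 1; push_cast; ring
  have hopt := hP.isEdgeProfile hmpos hlpos
  rw [← hA, ← hD, hml, hmA] at hopt
  have hcost : m ^ β * l * (A + D) + m ^ 2 / l * D = C := by rw [e1, e2, hC]; ring
  rw [hcost] at hopt
  have hcz : cZero α = ENNReal.ofReal C := by
    refine le_antisymm ?_ ?_
    · refine iInf_le_of_le _ (iInf_le_of_le _ (iInf_le_of_le hopt.isProfile (le_of_eq ?_)))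
      rw [← ofReal_integral_eq_lintegral_ofReal (hopt.integrable_rpow h0)
        (Eventually.of_forall fun x => Real.rpow_nonneg (hopt.nonneg x) _),
        ← ofReal_integral_eq_lintegral_ofReal hopt.integrable_deriv_sq
          (Eventually.of_forall fun x => sq_nonneg _),
        ← ENNReal.ofReal_add (integral_nonneg fun x => Real.rpow_nonneg (hopt.nonneg x) _)
          (integral_nonneg fun x => sq_nonneg _), hopt.energy]
    · exact le_iInf fun w => le_iInf fun g => le_iInf fun h =>
        le_energy_of_isProfile h0 h1 hlow h
  refine ⟨by rw [hcz]; exact ENNReal.ofReal_ne_top, fun θ hθ => ?_⟩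
  rw [hcz, ENNReal.toReal_ofReal hCpos]
  -- The factor on the width; the height is multiplied by `θ/s`. The gradient term forces `θ²/s³ =
  -- θ^α`, and the value of `β` then makes `(θ/s)^β s = θ^α` as well.
  set s : ℝ := θ ^ ((2 - α) / 3) with hs
  have hspos : 0 < s := Real.rpow_pos_of_pos hθ _
  have hprof := hP.isEdgeProfile (m := θ / s * m) (l := s * l) (by positivity) (by positivity)
  rw [← hA, ← hD] at hprof
  have m1 : θ / s * m * (s * l) * A = θ := by
    have : θ / s * m * (s * l) * A = θ * (m * l * A) := by field_simp
    rw [this, hml, hmA, mul_one]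
  have m2 : (θ / s * m) ^ β * (s * l) * (A + D) + (θ / s * m) ^ 2 / (s * l) * D = C * θ ^ α := by
    have s1 : (θ / s) ^ β * s = θ ^ α := by
      have : θ / s = θ ^ (1 - (2 - α) / 3) := by
        rw [hs, Real.rpow_sub hθ, Real.rpow_one]
      rw [this, hs, ← Real.rpow_mul hθ.le, ← Real.rpow_add hθ]
      congr 1
      linear_combination hβα / 3
    have s2 : (θ / s) ^ 2 / s = θ ^ α := by
      have h3 : s ^ 3 = θ ^ (2 - α) := by
        rw [hs, ← Real.rpow_natCast, ← Real.rpow_mul hθ.le]; congr 1; push_cast; ring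
      have h4 : (θ / s) ^ 2 / s = θ ^ 2 / s ^ 3 := by field_simp
      rw [h4, h3, ← Real.rpow_natCast, ← Real.rpow_sub hθ]; congr 1; push_cast; ring
    rw [Real.mul_rpow (by positivity) hmpos.le]
    have t1 : (θ / s) ^ β * m ^ β * (s * l) * (A + D) =
        ((θ / s) ^ β * s) * (m ^ β * l * (A + D)) := by ring
    have t2 : (θ / s * m) ^ 2 / (s * l) * D = ((θ / s) ^ 2 / s) * (m ^ 2 / l * D) := by
      field_simp
    rw [t1, t2, s1, s2, ← hcost]; ring
  rw [m1, m2] at hprof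
  exact ⟨_, _, _, hprof⟩

/-! ### Divergence of a field in coordinates -/

theorem fderiv_apply_fst {f : ℝ × ℝ → ℝ} {p : ℝ × ℝ} {d : ℝ} (hf : DifferentiableAt ℝ f p)
    (h : HasDerivAt (fun t => f (t, p.2)) d p.1) : fderiv ℝ f p (1, 0) = d := by
  have h1 : HasDerivAt (fun t : ℝ => (t, p.2)) ((1 : ℝ), (0 : ℝ)) p.1 :=
    (hasDerivAt_id p.1).prodMk (hasDerivAt_const _ _)
  exact (HasFDerivAt.comp_hasDerivAt (f := fun t : ℝ => (t, p.2)) p.1 hf.hasFDerivAt h1).unique h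

theorem fderiv_apply_snd {f : ℝ × ℝ → ℝ} {p : ℝ × ℝ} {d : ℝ} (hf : DifferentiableAt ℝ f p)
    (h : HasDerivAt (fun t => f (p.1, t)) d p.2) : fderiv ℝ f p (0, 1) = d := by
  have h1 : HasDerivAt (fun t : ℝ => (p.1, t)) ((0 : ℝ), (1 : ℝ)) p.2 :=
    (hasDerivAt_const _ _).prodMk (hasDerivAt_id p.2)
  exact (HasFDerivAt.comp_hasDerivAt (f := fun t : ℝ => (p.1, t)) p.2 hf.hasFDerivAt h1).unique h

/-- Primitives in the first variable of a compactly supported function. -/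
theorem exists_primitive_fst {g : ℝ × ℝ → ℝ} (hg : ContDiff ℝ 1 g)
    (h0 : ∀ s y, 1 ≤ |s| → g (s, y) = 0) (h0' : ∀ s y, 1 ≤ |y| → g (s, y) = 0) :
    ∃ G : ℝ × ℝ → ℝ, ContDiff ℝ 1 G ∧ (∀ s y, HasDerivAt (fun t => G (t, y)) (g (s, y)) s) ∧
      (∀ s y, s ≤ -1 → G (s, y) = 0) ∧ (∀ s y, 1 ≤ |y| → G (s, y) = 0) ∧
      ∀ s y, 1 ≤ s → G (s, y) = ∫ t, g (t, y) := by
  have hc : ∀ y, Continuous fun t => g (t, y) := fun y => by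
    have := hg.continuous; fun_prop
  have hi : ∀ y, Integrable fun t => g (t, y) := fun y =>
    (hc y).integrable_of_hasCompactSupport (hasCompactSupport_of_abs fun t ht => h0 t y ht)
  have hout : ∀ y t, t ∈ Set.Iic (-1 : ℝ) → g (t, y) = 0 := fun y t ht =>
    h0 t y (le_abs.2 (Or.inr (by simp only [Set.mem_Iic] at ht; linarith)))
  have hIic : ∀ s y, ∫ t in Set.Iic s, g (t, y) = ∫ t in (-1 : ℝ)..s, g (t, y) := fun s y => by
    have := intervalIntegral.integral_Iic_sub_Iic (a := -1) (b := s) (hi y).integrableOn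
      (hi y).integrableOn
    rwa [setIntegral_eq_zero_of_forall_eq_zero (hout y), sub_zero] at this
  refine ⟨fun p => ∫ t in (-1 : ℝ)..p.1, g (t, p.2), ?_, fun s y => ?_, fun s y hs => ?_,
    fun s y hy => ?_, fun s y hs => ?_⟩
  -- Joint smoothness: the primitive is the convolution of `g(·, y)` with the Heaviside function,
  -- and convolution depends smoothly on the parameter `y`.
  · have hloc : LocallyIntegrable (Set.indicator (Set.Ici (0 : ℝ)) fun _ => (1 : ℝ)) volume :=
      (locallyIntegrable_const (1 : ℝ)).indicator measurableSet_Ici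
    have key := contDiffOn_convolution_right_with_param (μ := volume) (n := 1)
      (ContinuousLinearMap.mul ℝ ℝ) (g := fun y t : ℝ => g (t, y)) (s := Set.univ)
      (k := Set.Icc (-1) 1) isOpen_univ isCompact_Icc (fun y t _ ht => h0 t y (by
        by_contra hlt
        exact ht (abs_le.1 (not_le.1 hlt).le))) hloc
      (hg.comp (contDiff_snd.prodMk contDiff_fst)).contDiffOn
    rw [Set.univ_prod_univ, contDiffOn_univ] at key
    have key' : ContDiff ℝ 1 _ := ContDiff.comp key (contDiff_snd.prodMk contDiff_fst)
    refine (congrArg (ContDiff ℝ 1) (funext fun p => ?_)).mp key'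
    rw [Function.comp_apply, convolution_eq_swap, ← hIic, ← integral_indicator measurableSet_Iic]
    congr 1
    ext t
    by_cases h : t ≤ p.1 <;> simp [Set.indicator, h]
  · exact intervalIntegral.integral_hasDerivAt_right ((hc y).intervalIntegrable _ _)
      ((hc y).stronglyMeasurableAtFilter _ _) (hc y).continuousAt
  · simp only [← hIic]
    exact setIntegral_eq_zero_of_forall_eq_zero fun t ht => hout y t (le_trans ht hs)
  · simp [h0' _ y hy]
  · simp only [← hIic]
    rw [setIntegral_eq_integral_of_forall_compl_eq_zero]
    intro t ht
    simp only [Set.mem_Iic, not_le] at ht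
    exact h0 t y (le_abs.2 (Or.inl (by linarith)))

/-- A field with a given compactly supported divergence of mass `θ`, which is a jet of profile `W`
in the direction of the first axis away from the origin. -/
theorem exists_planar_jet {g : ℝ × ℝ → ℝ} (hg : ContDiff ℝ 1 g)
    (h0 : ∀ s y, 1 ≤ |s| → g (s, y) = 0) (h0' : ∀ s y, 1 ≤ |y| → g (s, y) = 0)
    {W : ℝ → ℝ} {R : ℝ} (hR : 1 ≤ R) (hW : ContDiff ℝ 1 W) (hW0 : ∀ y, R ≤ |y| → W y = 0)
    (hmass : ∫ y, W y = ∫ p, g p) :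
    ∃ r₁ r₂ : ℝ × ℝ → ℝ, ContDiff ℝ 1 r₁ ∧ ContDiff ℝ 1 r₂ ∧
      (∀ p, fderiv ℝ r₁ p (1, 0) + fderiv ℝ r₂ p (0, 1) = g p) ∧
      ∀ s y, (1 < |s| ∨ R ≤ |y|) → r₁ (s, y) = Real.smoothTransition s * W y ∧ r₂ (s, y) = 0 := by
  obtain ⟨G, hG, hGd, hG1, hG2, hG3⟩ := exists_primitive_fst hg h0 h0'
  set F : ℝ → ℝ := fun y => G (1, y) with hF
  have hFc : ContDiff ℝ 1 F := hG.comp (contDiff_const.prodMk contDiff_id)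
  set H := Real.smoothTransition
  have hH : ContDiff ℝ 2 H := Real.smoothTransition.contDiff (n := 2)
  have hH' : ContDiff ℝ 1 (deriv H) := by
    have : ContDiff ℝ (1 + 1) H := by simpa [one_add_one_eq_two] using hH
    exact (contDiff_succ_iff_deriv.1 this).2.2
  have hHd : ∀ s, HasDerivAt H (deriv H s) s := fun s =>
    (hH.differentiable (by simp) s).hasDerivAt
  have hH0 : ∀ s, 1 < |s| → deriv H s = 0 := fun s hs => by
    rcases lt_abs.1 hs with h | h
    · refine HasDerivAt.deriv ((hasDerivAt_const s (1 : ℝ)).congr_of_eventuallyEq ?_)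
      filter_upwards [lt_mem_nhds h] with t ht using Real.smoothTransition.one_of_one_le ht.le
    · refine HasDerivAt.deriv ((hasDerivAt_const s (0 : ℝ)).congr_of_eventuallyEq ?_)
      filter_upwards [gt_mem_nhds (show s < 0 by linarith)] with t ht using
        Real.smoothTransition.zero_of_nonpos ht.le
  have hcW : Continuous fun y => W y - F y := hW.continuous.sub hFc.continuous
  have hWF0 : ∀ y, R ≤ |y| → W y - F y = 0 := fun y hy => by
    rw [hW0 y hy, hF]; simp [hG2 1 y (hR.trans hy)]
  -- Corrector that turns the transversal distribution `F` produced by `g` into the prescribed `W`.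
  -- Since `W` and `F` have equal mass, `Ψ` vanishes for `|y| ≥ R`.
  set Ψ : ℝ → ℝ := fun y => ∫ t in (-R)..y, (W t - F t) with hΨ
  have hΨd : ∀ y, HasDerivAt Ψ (W y - F y) y := fun y =>
    intervalIntegral.integral_hasDerivAt_right (hcW.intervalIntegrable _ _)
      (hcW.stronglyMeasurableAtFilter _ _) hcW.continuousAt
  have hΨc : ContDiff ℝ 1 Ψ := by
    rw [contDiff_one_iff_deriv]
    refine ⟨fun y => (hΨd y).differentiableAt, ?_⟩
    rwa [show deriv Ψ = fun y => W y - F y from funext fun y => (hΨd y).deriv]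
  have hsupp : Function.support (fun t => W t - F t) ⊆ Set.Ioc (-R) R := fun t ht => by
    have : |t| < R := by
      by_contra hh
      exact ht (hWF0 t (not_lt.1 hh))
    exact ⟨(abs_lt.1 this).1, (abs_lt.1 this).2.le⟩
  have hWi : Integrable W := hW.continuous.integrable_of_hasCompactSupport
    (hasCompactSupport_of_abs hW0)
  have hFi : Integrable F := hFc.continuous.integrable_of_hasCompactSupport
    (hasCompactSupport_of_abs fun y hy => hG2 1 y hy)
  have hgi : Integrable g := hg.continuous.integrable_of_hasCompactSupport
    (HasCompactSupport.intro (isCompact_Icc.prod isCompact_Icc :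
      IsCompact (Set.Icc (-1 : ℝ) 1 ×ˢ Set.Icc (-1 : ℝ) 1)) fun p hp => by
        rw [Set.mem_prod, not_and_or] at hp
        rcases hp with hp | hp
        · exact h0 p.1 p.2 (by by_contra hlt; exact hp (abs_le.1 (not_le.1 hlt).le))
        · exact h0' p.1 p.2 (by by_contra hlt; exact hp (abs_le.1 (not_le.1 hlt).le)))
  have hFm : ∫ y, F y = ∫ p, g p := by
    rw [Measure.volume_eq_prod, integral_prod_symm _ (by rwa [← Measure.volume_eq_prod])]
    exact integral_congr_ae (Eventually.of_forall fun y => hG3 1 y le_rfl)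
  have hΨ0 : ∀ y, R ≤ |y| → Ψ y = 0 := fun y hy => by
    rcases le_abs.1 hy with h | h
    · have : Function.support (fun t => W t - F t) ⊆ Set.Ioc (-R) y :=
        hsupp.trans (Set.Ioc_subset_Ioc_right h)
      simp only [hΨ]
      rw [intervalIntegral.integral_eq_integral_of_support_subset this,
        integral_sub hWi hFi, hmass, hFm, sub_self]
    · refine (intervalIntegral.integral_congr (g := fun _ => (0 : ℝ)) fun t ht => ?_).trans (by simp)
      rw [Set.uIcc_of_ge (by linarith)] at ht
      exact hWF0 t (le_abs.2 (Or.inr (by linarith [ht.2])))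
  -- The field is `(G + H (W - F), -H' Ψ)`. The two extra contributions `H' (W - F)` to the
  -- divergence cancel, leaving `∂₁ G = g`; past the transition, `G = F` and `H = 1` leave `W`.
  have hr₁ : ContDiff ℝ 1 fun p : ℝ × ℝ => G p + H p.1 * (W p.2 - F p.2) :=
    hG.add (((hH.of_le (by norm_num)).comp contDiff_fst).mul
      ((hW.comp contDiff_snd).sub (hFc.comp contDiff_snd)))
  have hr₂ : ContDiff ℝ 1 fun p : ℝ × ℝ => -(deriv H p.1 * Ψ p.2) :=
    ((hH'.comp contDiff_fst).mul (hΨc.comp contDiff_snd)).neg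
  refine ⟨_, _, hr₁, hr₂, fun p => ?_, fun s y hsy => ?_⟩
  · rw [fderiv_apply_fst (hr₁.differentiable (by simp) p)
      ((hGd p.1 p.2).add ((hHd p.1).mul_const (W p.2 - F p.2))),
      fderiv_apply_snd (hr₂.differentiable (by simp) p) ((hΨd p.2).const_mul (deriv H p.1)).neg]
    ring
  · simp only
    rcases hsy with h | h
    · rw [hH0 s h]
      rcases lt_abs.1 h with h | h
      · have e1 : H s = 1 := Real.smoothTransition.one_of_one_le h.le
        rw [hG3 s y h.le, ← hG3 1 y le_rfl, e1]
        simp [hF]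
      · have e1 : H s = 0 := Real.smoothTransition.zero_of_nonpos (by linarith)
        rw [hG1 s y (by linarith), e1]
        simp
    · rw [hΨ0 y h, hG2 s y (hR.trans h), hW0 y h]
      simp [hF, hG2 1 y (hR.trans h)]

/-! ### Frame coordinates -/

theorem measurePreserving_frame {τ : Plane} (h : ‖τ‖ = 1) (a : Plane) :
    MeasurePreserving (fun x : Plane => (inner ℝ τ (x - a), inner ℝ (perp τ) (x - a)))
      volume volume := by
  have hon : Orthonormal ℝ ![τ, perp τ] := by
    rw [orthonormal_iff_ite]
    intro i j
    fin_cases i <;> fin_cases j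
    · simp [h]
    · simpa using (real_inner_comm τ (perp τ)).symm.trans (inner_perp_self τ)
    · simpa using inner_perp_self τ
    · simp [norm_perp, h]
  have hspan : ⊤ ≤ Submodule.span ℝ (Set.range ![τ, perp τ]) := fun x _ => by
    rw [frame_decomp h x]
    exact Submodule.add_mem _ (Submodule.smul_mem _ _ (Submodule.subset_span ⟨0, rfl⟩))
      (Submodule.smul_mem _ _ (Submodule.subset_span ⟨1, rfl⟩))
  have h1 := (OrthonormalBasis.mk hon hspan).measurePreserving_repr
  have h2 := (volume_preserving_finTwoArrow ℝ).comp
    ((EuclideanSpace.volume_preserving_symm_measurableEquiv_toLp (Fin 2)).comp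
      (h1.comp (measurePreserving_sub_right volume a)))
  refine (congrArg (fun f => MeasurePreserving f volume volume) (funext fun x => ?_)).mp h2
  simp [OrthonormalBasis.repr_apply_apply, MeasurableEquiv.finTwoArrow, inner_sub_right]

theorem measurableEmbedding_frame {τ : Plane} (h : ‖τ‖ = 1) (a : Plane) :
    MeasurableEmbedding (fun x : Plane => (inner ℝ τ (x - a), inner ℝ (perp τ) (x - a))) := by
  refine Continuous.measurableEmbedding (by fun_prop) fun x y hxy => ?_
  simp only [Prod.mk.injEq] at hxy
  have : x - a = y - a := by rw [frame_decomp h (x - a), frame_decomp h (y - a), hxy.1, hxy.2]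
  exact sub_left_injective this

theorem integral_frame {τ : Plane} (h : ‖τ‖ = 1) (a : Plane) (f : ℝ × ℝ → ℝ) :
    ∫ x : Plane, f (inner ℝ τ (x - a), inner ℝ (perp τ) (x - a)) = ∫ p, f p :=
  (measurePreserving_frame h a).integral_comp (measurableEmbedding_frame h a) f

theorem integrable_frame {τ : Plane} (h : ‖τ‖ = 1) (a : Plane) {f : ℝ × ℝ → ℝ}
    (hf : Integrable f) :
    Integrable fun x : Plane => f (inner ℝ τ (x - a), inner ℝ (perp τ) (x - a)) :=
  (measurePreserving_frame h a).integrable_comp_of_integrable hf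

theorem inner_self_of_unit {τ : Plane} (h : ‖τ‖ = 1) : inner ℝ τ τ = (1 : ℝ) := by simp [h]

theorem inner_perp_perp {τ : Plane} (h : ‖τ‖ = 1) : inner ℝ (perp τ) (perp τ) = (1 : ℝ) := by
  simp [norm_perp, h]

theorem inner_self_perp (τ : Plane) : inner ℝ τ (perp τ) = (0 : ℝ) := by
  rw [real_inner_comm, inner_perp_self]

/-! ### The divergence of a vector field on the plane -/

/-- The divergence of a differentiable vector field. -/
def divergence (u : Plane → Plane) (x : Plane) : ℝ :=
  ∑ i, fderiv ℝ u x (EuclideanSpace.single i 1) i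

theorem sum_clm_single (L : Plane →L[ℝ] ℝ) (v : Plane) :
    ∑ i, L (EuclideanSpace.single i 1) * v i = L v := by
  have : v = ∑ i, v i • EuclideanSpace.single i (1 : ℝ) := by
    ext j; fin_cases j <;> simp
  conv_rhs => rw [this]
  simp [mul_comm]

theorem fderiv_smul_add_smul {f g : Plane → ℝ} {x : Plane} (hf : DifferentiableAt ℝ f x)
    (hg : DifferentiableAt ℝ g x) (a b v : Plane) :
    fderiv ℝ (fun y => f y • a + g y • b) x v = fderiv ℝ f x v • a + fderiv ℝ g x v • b := by
  have h : HasFDerivAt (fun y => f y • a + g y • b) _ x :=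
    (hf.hasFDerivAt.smul_const a).add (hg.hasFDerivAt.smul_const b)
  rw [h.fderiv]
  simp

theorem divergence_smul_add_smul {f g : Plane → ℝ} {x : Plane} (hf : DifferentiableAt ℝ f x)
    (hg : DifferentiableAt ℝ g x) (a b : Plane) :
    divergence (fun y => f y • a + g y • b) x = fderiv ℝ f x a + fderiv ℝ g x b := by
  simp only [divergence, fderiv_smul_add_smul hf hg, PiLp.add_apply, PiLp.smul_apply, smul_eq_mul,
    Finset.sum_add_distrib, sum_clm_single]

/-! ### Jets -/

/-- A field with divergence `θ σ`, equal away from the origin to a jet of profile `W` in the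
direction `τ`. -/
structure IsJet (σ : Plane → ℝ) (τ : Plane) (θ : ℝ) (W : ℝ → ℝ) (R : ℝ) (r : Plane → Plane) :
    Prop where
  contDiff : ContDiff ℝ 1 r
  divergence_eq : ∀ x, divergence r x = θ * σ x
  eq_of_le : ∀ x, R ≤ ‖x‖ →
    r x = (Real.smoothTransition (inner ℝ τ x) * W (inner ℝ (perp τ) x)) • τ
  bounded : ∃ K, ∀ x, ‖r x‖ ≤ K ∧ ‖fderiv ℝ r x‖ ≤ K

theorem smoothTransition_abs_le (s : ℝ) : |Real.smoothTransition s| ≤ 1 :=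
  abs_le.2 ⟨by linarith [Real.smoothTransition.nonneg s], Real.smoothTransition.le_one s⟩

theorem smoothTransition_hasDerivAt_zero {s : ℝ} (hs : s < 0 ∨ 1 < s) :
    HasDerivAt Real.smoothTransition 0 s := by
  rcases hs with h | h
  · refine (hasDerivAt_const s (0 : ℝ)).congr_of_eventuallyEq ?_
    filter_upwards [gt_mem_nhds h] with t ht using Real.smoothTransition.zero_of_nonpos ht.le
  · refine (hasDerivAt_const s (1 : ℝ)).congr_of_eventuallyEq ?_
    filter_upwards [lt_mem_nhds h] with t ht using Real.smoothTransition.one_of_one_le ht.le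

theorem smoothTransition_hasDerivAt (s : ℝ) :
    HasDerivAt Real.smoothTransition (deriv Real.smoothTransition s) s :=
  ((Real.smoothTransition.contDiff (n := 1)).differentiable (by simp) s).hasDerivAt

theorem exists_deriv_smoothTransition_le : ∃ K, ∀ s, |deriv Real.smoothTransition s| ≤ K := by
  have hc : HasCompactSupport (deriv Real.smoothTransition) :=
    hasCompactSupport_of_abs (R := 2) fun s hs => (smoothTransition_hasDerivAt_zero (by
      rcases le_abs.1 hs with h | h
      · exact Or.inr (by linarith)
      · exact Or.inl (by linarith))).deriv
  exact hc.exists_bound_of_continuous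
    ((Real.smoothTransition.contDiff (n := 1)).continuous_deriv (by simp))

theorem fderiv_comp_inner {f : ℝ → ℝ} {d : ℝ} (τ a : Plane) {x : Plane}
    (hf : HasDerivAt f d (inner ℝ τ (x - a))) :
    HasFDerivAt (fun y : Plane => f (inner ℝ τ (y - a))) (d • innerSL ℝ τ) x := by
  have h1 : HasFDerivAt (fun y : Plane => inner ℝ τ (y - a)) (innerSL ℝ τ) x := by
    have := (innerSL ℝ τ).hasFDerivAt (x := x - a)
    exact this.comp x (hasFDerivAt_sub_const a)
  exact hf.comp_hasFDerivAt x h1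

/-- The planar construction in the frame `(τ, perp τ)`, applied to `θ σ` in these coordinates. Every
radius large enough works, so that all edges can later share one. -/
theorem exists_isJet {σ : Plane → ℝ} (hσ : ContDiff ℝ 1 σ) (hσ0 : ∀ x, 1 ≤ ‖x‖ → σ x = 0)
    (hσ1 : ∫ x, σ x = 1) {τ : Plane} (hτ : ‖τ‖ = 1) {β θ c R : ℝ} {W W' : ℝ → ℝ}
    (hW : IsEdgeProfile β θ c W W' R) :
    ∃ R₁, ∀ R₂ ≥ R₁, ∃ r, IsJet σ τ θ W R₂ r := by
  set g : ℝ × ℝ → ℝ := fun p => θ * σ (p.1 • τ + p.2 • perp τ) with hg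
  have hgc : ContDiff ℝ 1 g := by
    refine contDiff_const.mul (hσ.comp ?_)
    exact (contDiff_fst.smul contDiff_const).add (contDiff_snd.smul contDiff_const)
  have hnorm : ∀ s y : ℝ, ‖s • τ + y • perp τ‖ ^ 2 = s ^ 2 + y ^ 2 := fun s y => by
    rw [frame_norm_sq hτ]
    simp [inner_add_right, inner_smul_right, inner_perp_self, inner_self_perp, norm_perp, hτ]
  have hg0 : ∀ s y, 1 ≤ |s| → g (s, y) = 0 := fun s y hs => by
    have : 1 ≤ ‖s • τ + y • perp τ‖ := by
      have h1 : 1 ≤ s ^ 2 := (one_le_sq_iff_one_le_abs s).2 hs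
      rw [← one_le_sq_iff₀ (norm_nonneg _), hnorm]; nlinarith [sq_nonneg y]
    simp [hg, hσ0 _ this]
  have hg0' : ∀ s y, 1 ≤ |y| → g (s, y) = 0 := fun s y hy => by
    have : 1 ≤ ‖s • τ + y • perp τ‖ := by
      have h1 : 1 ≤ y ^ 2 := (one_le_sq_iff_one_le_abs y).2 hy
      rw [← one_le_sq_iff₀ (norm_nonneg _), hnorm]; nlinarith [sq_nonneg s]
    simp [hg, hσ0 _ this]
  have hmass : ∫ y, W y = ∫ p, g p := by
    rw [hW.mass, ← integral_frame hτ 0 g]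
    have : ∀ x : Plane, g (inner ℝ τ (x - 0), inner ℝ (perp τ) (x - 0)) = θ * σ x := fun x => by
      simp only [hg, sub_zero]
      rw [← frame_decomp hτ x]
    simp_rw [this, integral_const_mul, hσ1, mul_one]
  obtain ⟨r₁, r₂, hr₁, hr₂, hdiv, hfar⟩ := exists_planar_jet hgc hg0 hg0' (le_max_left 1 R)
    hW.contDiff (fun y hy => hW.eq_zero y ((le_max_right _ _).trans hy)) hmass
  set M := max 1 R with hM
  have hM1 : 1 ≤ M := le_max_left _ _
  refine ⟨M + 2, fun R₂ hR₂ => ?_⟩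
  set Φ : Plane →L[ℝ] ℝ × ℝ := (innerSL ℝ τ).prod (innerSL ℝ (perp τ)) with hΦ
  have hΦv : ∀ x, Φ x = (inner ℝ τ x, inner ℝ (perp τ) x) := fun x => rfl
  set r : Plane → Plane := fun x => r₁ (Φ x) • τ + r₂ (Φ x) • perp τ with hr
  have h1 : ContDiff ℝ 1 fun x => r₁ (Φ x) := hr₁.comp Φ.contDiff
  have h2 : ContDiff ℝ 1 fun x => r₂ (Φ x) := hr₂.comp Φ.contDiff
  have hrc : ContDiff ℝ 1 r := (h1.smul contDiff_const).add (h2.smul contDiff_const)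
  have hfar' : ∀ x : Plane, M + 2 ≤ ‖x‖ →
      r x = (Real.smoothTransition (inner ℝ τ x) * W (inner ℝ (perp τ) x)) • τ := fun x hx => by
    have : 1 < |inner ℝ τ x| ∨ M ≤ |inner ℝ (perp τ) x| := by
      by_contra! hlt
      have h3 := frame_norm_sq hτ x
      rw [← sq_abs (inner ℝ τ x), ← sq_abs (inner ℝ (perp τ) x)] at h3
      nlinarith [abs_nonneg (inner ℝ τ x : ℝ), abs_nonneg (inner ℝ (perp τ) x : ℝ)]
    have := hfar (inner ℝ τ x) (inner ℝ (perp τ) x) this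
    simp only [hr, hΦv]
    rw [this.1, this.2, zero_smul, add_zero]
  refine ⟨r, hrc, fun x => ?_, fun x hx => hfar' x (hR₂.trans hx), ?_⟩
  · have hd1 := hr₁.differentiable (by simp) (Φ x)
    have hd2 := hr₂.differentiable (by simp) (Φ x)
    have e1 : fderiv ℝ (fun x => r₁ (Φ x)) x = (fderiv ℝ r₁ (Φ x)).comp Φ :=
      (hd1.hasFDerivAt.comp x Φ.hasFDerivAt).fderiv
    have e2 : fderiv ℝ (fun x => r₂ (Φ x)) x = (fderiv ℝ r₂ (Φ x)).comp Φ :=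
      (hd2.hasFDerivAt.comp x Φ.hasFDerivAt).fderiv
    have e3 : Φ τ = (1, 0) := by rw [hΦv, inner_self_of_unit hτ, inner_perp_self]
    have e4 : Φ (perp τ) = (0, 1) := by rw [hΦv, inner_perp_perp hτ, inner_self_perp]
    rw [hr, divergence_smul_add_smul (h1.differentiable (by simp) x)
      (h2.differentiable (by simp) x), e1, e2, ContinuousLinearMap.comp_apply,
      ContinuousLinearMap.comp_apply, e3, e4, hdiv, hΦv]
    simp only [hg]
    rw [← frame_decomp hτ x]
  · set J : Plane → Plane :=
      fun x => (Real.smoothTransition (inner ℝ τ x) * W (inner ℝ (perp τ) x)) • τ with hJ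
    have hJd : ∀ x, HasFDerivAt J (((Real.smoothTransition (inner ℝ τ x) •
        (W' (inner ℝ (perp τ) x) • innerSL ℝ (perp τ)) + W (inner ℝ (perp τ) x) •
        (deriv Real.smoothTransition (inner ℝ τ x) • innerSL ℝ τ)).smulRight τ)) x := fun x => by
      have a1 := fderiv_comp_inner τ 0 (x := x) (smoothTransition_hasDerivAt _)
      have a2 := fderiv_comp_inner (perp τ) 0 (x := x) (hW.hasDerivAt _)
      simp only [sub_zero] at a1 a2
      exact (a1.mul a2).smul_const τ
    have hJc : ContDiff ℝ 1 J := by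
      have a1 : ContDiff ℝ 1 fun x : Plane => Real.smoothTransition (inner ℝ τ x) :=
        (Real.smoothTransition.contDiff (n := 1)).comp (innerSL ℝ τ).contDiff
      have a2 : ContDiff ℝ 1 fun x : Plane => W (inner ℝ (perp τ) x) :=
        hW.contDiff.comp (innerSL ℝ (perp τ)).contDiff
      exact (a1.mul a2).smul contDiff_const
    -- The field is not compactly supported, but it differs from the explicit jet `J` by a compactly
    -- supported `C¹` field, and `J` and its derivative are bounded directly.
    have hcs : HasCompactSupport (r - J) :=
      HasCompactSupport.intro (isCompact_closedBall (0 : Plane) (M + 2)) fun x hx => by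
        rw [Metric.mem_closedBall, dist_zero_right, not_le] at hx
        rw [Pi.sub_apply, hfar' x hx.le, sub_self]
    have hrJ : ContDiff ℝ 1 (r - J) := hrc.sub hJc
    obtain ⟨K₁, hK₁⟩ := hcs.exists_bound_of_continuous hrJ.continuous
    have hcs' : HasCompactSupport (fderiv ℝ (r - J)) := hcs.fderiv ℝ
    obtain ⟨K₂, hK₂⟩ := hcs'.exists_bound_of_continuous
      (hrJ.continuous_fderiv (by simp))
    obtain ⟨K₃, hK₃⟩ := (hasCompactSupport_of_abs hW.eq_zero).exists_bound_of_continuous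
      hW.continuous
    obtain ⟨K₄, hK₄⟩ := (hasCompactSupport_of_abs hW.deriv_eq_zero).exists_bound_of_continuous
      hW.continuous_deriv
    obtain ⟨K₅, hK₅⟩ := exists_deriv_smoothTransition_le
    have p3 : 0 ≤ K₃ := (norm_nonneg _).trans (hK₃ 0)
    have p4 : 0 ≤ K₄ := (norm_nonneg _).trans (hK₄ 0)
    have p5 : 0 ≤ K₅ := (abs_nonneg _).trans (hK₅ 0)
    have b1 : ∀ x, ‖r x‖ ≤ K₁ + K₃ := fun x => by
      have e : r x = (r - J) x + J x := by simp
      rw [e]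
      refine (norm_add_le _ _).trans (add_le_add (hK₁ x) ?_)
      rw [hJ, norm_smul, hτ, mul_one, norm_mul]
      calc _ ≤ 1 * K₃ := mul_le_mul (smoothTransition_abs_le _) (hK₃ _) (norm_nonneg _) zero_le_one
        _ = K₃ := one_mul _
    have b2 : ∀ x, ‖fderiv ℝ r x‖ ≤ K₂ + (K₄ + K₃ * K₅) := fun x => by
      have e : fderiv ℝ r x = fderiv ℝ (r - J) x + fderiv ℝ J x := by
        rw [fderiv_sub (hrc.differentiable (by simp) x) (hJc.differentiable (by simp) x)]
        simp
      rw [e]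
      refine (norm_add_le _ _).trans (add_le_add (hK₂ x) ?_)
      rw [(hJd x).fderiv, ContinuousLinearMap.norm_smulRight_apply, hτ, mul_one]
      refine (norm_add_le _ _).trans (add_le_add ?_ ?_)
      · rw [norm_smul, norm_smul, innerSL_apply_norm, norm_perp, hτ, mul_one]
        calc _ ≤ 1 * K₄ :=
              mul_le_mul (smoothTransition_abs_le _) (hK₄ _) (norm_nonneg _) zero_le_one
          _ = K₄ := one_mul _
      · rw [norm_smul, norm_smul, innerSL_apply_norm, hτ, mul_one]
        exact mul_le_mul (hK₃ _) (hK₅ _) (norm_nonneg _) p3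
    exact ⟨max (K₁ + K₃) (K₂ + (K₄ + K₃ * K₅)), fun x =>
      ⟨(b1 x).trans (le_max_left _ _), (b2 x).trans (le_max_right _ _)⟩⟩

theorem IsEdgeProfile.mono {β θ c R R₁ : ℝ} {W W' : ℝ → ℝ} (h : IsEdgeProfile β θ c W W' R)
    (hR : R ≤ R₁) : IsEdgeProfile β θ c W W' R₁ where
  pos := h.pos.trans_le hR
  continuous_deriv := h.continuous_deriv
  hasDerivAt := h.hasDerivAt
  nonneg := h.nonneg
  eq_zero y hy := h.eq_zero y (hR.trans hy)
  deriv_eq_zero y hy := h.deriv_eq_zero y (hR.trans hy)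
  mass := h.mass
  energy := h.energy

/-! ### Functions concentrated around an edge -/

/-- The function `f` of the transversal coordinate, concentrated at scale `δ` around the edge `e`. -/
def stripFn (e : Plane × Plane) (δ : ℝ) (f : ℝ → ℝ) (x : Plane) : ℝ :=
  (Set.Ioo 0 ‖e.2 - e.1‖).indicator 1 (inner ℝ (direction e) (x - e.1) : ℝ) *
    (δ⁻¹ * f (δ⁻¹ * inner ℝ (perp (direction e)) (x - e.1)))

theorem stripFn_eq_zero {e : Plane × Plane} {δ R : ℝ} (hδ : 0 < δ) {f : ℝ → ℝ}
    (hf : ∀ y, R ≤ |y| → f y = 0) {x : Plane}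
    (hx : R * δ ≤ |inner ℝ (perp (direction e)) (x - e.1)|) : stripFn e δ f x = 0 := by
  rw [stripFn, hf, mul_zero, mul_zero]
  rw [abs_mul, abs_inv, abs_of_pos hδ]
  rw [inv_mul_eq_div, le_div_iff₀ hδ]
  exact hx

theorem indicator_Ioo_abs_le (L s : ℝ) : |(Set.Ioo 0 L).indicator (1 : ℝ → ℝ) s| ≤ 1 := by
  by_cases h : s ∈ Set.Ioo 0 L <;> simp [h]

theorem abs_stripFn_le {e : Plane × Plane} {δ K : ℝ} (hδ : 0 < δ) {f : ℝ → ℝ}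
    (hf : ∀ y, |f y| ≤ K) (x : Plane) : |stripFn e δ f x| ≤ K / δ := by
  rw [stripFn, abs_mul, abs_mul, abs_inv, abs_of_pos hδ, div_eq_inv_mul]
  calc _ ≤ 1 * (δ⁻¹ * K) := mul_le_mul (indicator_Ioo_abs_le _ _)
        (mul_le_mul_of_nonneg_left (hf _) (inv_pos.2 hδ).le) (by positivity) zero_le_one
    _ = _ := one_mul _

theorem stripFn_nonneg {e : Plane × Plane} {δ : ℝ} (hδ : 0 < δ) {f : ℝ → ℝ}
    (hf : ∀ y, 0 ≤ f y) (x : Plane) : 0 ≤ stripFn e δ f x :=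
  mul_nonneg (Set.indicator_nonneg (fun _ _ => zero_le_one) _)
    (mul_nonneg (inv_pos.2 hδ).le (hf _))

theorem integral_inv_mul_comp {δ : ℝ} (hδ : 0 < δ) (f : ℝ → ℝ) :
    ∫ y, δ⁻¹ * f (δ⁻¹ * y) = ∫ y, f y := by
  rw [integral_const_mul, Measure.integral_comp_mul_left, inv_inv, abs_of_pos hδ, smul_eq_mul,
    ← mul_assoc, inv_mul_cancel₀ hδ.ne', one_mul]

theorem integrable_inv_mul_comp {δ : ℝ} (hδ : 0 < δ) {f : ℝ → ℝ} (hf : Integrable f) :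
    Integrable fun y => δ⁻¹ * f (δ⁻¹ * y) :=
  (hf.comp_mul_left' (inv_pos.2 hδ).ne').const_mul _

/-- Integral of a function concentrated around an edge against a function of the longitudinal
coordinate. -/
theorem integral_stripFn_mul {e : Plane × Plane} (he : e.1 ≠ e.2) {δ : ℝ} (hδ : 0 < δ) (f h : ℝ → ℝ) :
    ∫ x, stripFn e δ f x * h (inner ℝ (direction e) (x - e.1)) =
      (∫ s in Set.Icc 0 ‖e.2 - e.1‖, h s) * ∫ y, f y := by
  have h1 := integral_frame (norm_direction he) e.1 fun p =>
    ((Set.Ioo 0 ‖e.2 - e.1‖).indicator h p.1) * (δ⁻¹ * f (δ⁻¹ * p.2))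
  rw [Measure.volume_eq_prod, integral_prod_mul ((Set.Ioo 0 ‖e.2 - e.1‖).indicator h)
    (fun y => δ⁻¹ * f (δ⁻¹ * y)), integral_inv_mul_comp hδ, integral_indicator measurableSet_Ioo,
    ← integral_Icc_eq_integral_Ioo] at h1
  rw [← h1]
  congr 1
  ext x
  by_cases hx : (inner ℝ (direction e) (x - e.1) : ℝ) ∈ Set.Ioo 0 ‖e.2 - e.1‖ <;>
    simp [stripFn, hx, mul_comm]

theorem integral_stripFn {e : Plane × Plane} (he : e.1 ≠ e.2) {δ : ℝ} (hδ : 0 < δ) (f : ℝ → ℝ) :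
    ∫ x, stripFn e δ f x = ‖e.2 - e.1‖ * ∫ y, f y := by
  have := integral_stripFn_mul he hδ f fun _ => 1
  simpa using this

theorem integrable_stripFn {e : Plane × Plane} (he : e.1 ≠ e.2) {δ : ℝ} (hδ : 0 < δ) {f : ℝ → ℝ}
    (hf : Integrable f) : Integrable (stripFn e δ f) := by
  have h1 : Integrable ((Set.Ioo 0 ‖e.2 - e.1‖).indicator (1 : ℝ → ℝ)) :=
    (integrable_indicator_iff measurableSet_Ioo).2 (integrableOn_const (by simp))
  have h2 := h1.mul_prod (integrable_inv_mul_comp hδ hf)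
  rw [← Measure.volume_eq_prod] at h2
  exact integrable_frame (norm_direction he) e.1 h2

/-! ### Two opposite jets at the ends of an edge -/

section Edge

variable {σ : Plane → ℝ} {e : Plane × Plane} {β θ c R δ : ℝ} {W W' : ℝ → ℝ} {r : Plane → Plane}

/-- The difference of the rescaled jets at the two ends of an edge. -/
def edgeField (r : Plane → Plane) (e : Plane × Plane) (δ : ℝ) (x : Plane) : Plane :=
  δ⁻¹ • (r (δ⁻¹ • (x - e.1)) - r (δ⁻¹ • (x - e.2)))

theorem IsJet.edgeField_contDiff (hr : IsJet σ (direction e) θ W R r) :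
    ContDiff ℝ 1 (edgeField r e δ) := by
  have := hr.contDiff
  unfold edgeField
  fun_prop

theorem IsJet.hasFDerivAt_edgeField (hr : IsJet σ (direction e) θ W R r) (x : Plane) :
    HasFDerivAt (edgeField r e δ) ((δ⁻¹ * δ⁻¹) • (fderiv ℝ r (δ⁻¹ • (x - e.1)) -
      fderiv ℝ r (δ⁻¹ • (x - e.2)))) x := by
  have h1 : ∀ a : Plane, HasFDerivAt (fun y => r (δ⁻¹ • (y - a)))
      (δ⁻¹ • fderiv ℝ r (δ⁻¹ • (x - a))) x := fun a => by
    have h2 : HasFDerivAt (fun y : Plane => δ⁻¹ • (y - a))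
        (δ⁻¹ • ContinuousLinearMap.id ℝ Plane) x :=
      (hasFDerivAt_sub_const a).const_smul δ⁻¹
    have h3 := (hr.contDiff.differentiable (by simp) (δ⁻¹ • (x - a))).hasFDerivAt.comp x h2
    rw [ContinuousLinearMap.comp_smul, ContinuousLinearMap.comp_id] at h3
    exact h3
  have h4 := ((h1 e.1).sub (h1 e.2)).const_smul δ⁻¹
  rw [mul_smul, smul_sub δ⁻¹ (fderiv ℝ r _)]
  exact h4

theorem IsJet.norm_edgeField_le (hr : IsJet σ (direction e) θ W R r) :
    ∃ K, ∀ δ > 0, ∀ x, ‖edgeField r e δ x‖ ≤ K / δ ∧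
      ‖fderiv ℝ (edgeField r e δ) x‖ ≤ K / δ ^ 2 := by
  obtain ⟨K, hK⟩ := hr.bounded
  refine ⟨K + K, fun δ hδ x => ⟨?_, ?_⟩⟩
  · rw [edgeField, norm_smul, norm_inv, Real.norm_of_nonneg hδ.le, div_eq_inv_mul]
    exact mul_le_mul_of_nonneg_left ((norm_sub_le _ _).trans (add_le_add (hK _).1 (hK _).1))
      (inv_pos.2 hδ).le
  · rw [(hr.hasFDerivAt_edgeField x).fderiv, norm_smul, norm_mul, norm_inv,
      Real.norm_of_nonneg hδ.le, div_eq_inv_mul, sq, mul_inv]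
    exact mul_le_mul_of_nonneg_left ((norm_sub_le _ _).trans (add_le_add (hK _).2 (hK _).2))
      (by positivity)

theorem IsJet.divergence_edgeField (hr : IsJet σ (direction e) θ W R r) (x : Plane) :
    divergence (edgeField r e δ) x =
      θ * (δ⁻¹ * δ⁻¹ * (σ (δ⁻¹ • (x - e.1)) - σ (δ⁻¹ • (x - e.2)))) := by
  have h1 := hr.divergence_eq (δ⁻¹ • (x - e.1))
  have h2 := hr.divergence_eq (δ⁻¹ • (x - e.2))
  rw [divergence, (hr.hasFDerivAt_edgeField x).fderiv]
  simp only [_root_.sub_apply, _root_.smul_apply, PiLp.smul_apply, PiLp.sub_apply, smul_eq_mul,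
    ← Finset.mul_sum, Finset.sum_sub_distrib]
  unfold divergence at h1 h2
  rw [h1, h2]
  ring

/-- Away from the ends of the edge, the field is exactly the jet along the edge. -/
theorem IsJet.edgeField_eventuallyEq (he : e.1 ≠ e.2) (hr : IsJet σ (direction e) θ W R r)
    (hδ : 0 < δ) {x : Plane} (h1 : R * δ < ‖x - e.1‖) (h2 : R * δ < ‖x - e.2‖) :
    edgeField r e δ =ᶠ[𝓝 x] fun z => ((Real.smoothTransition
      (δ⁻¹ * inner ℝ (direction e) (z - e.1)) - Real.smoothTransition
      (δ⁻¹ * (inner ℝ (direction e) (z - e.1) - ‖e.2 - e.1‖))) *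
      (δ⁻¹ * W (δ⁻¹ * inner ℝ (perp (direction e)) (z - e.1)))) • direction e := by
  have o1 : ∀ a : Plane, R * δ < ‖x - a‖ → ∀ᶠ z in 𝓝 x, R * δ < ‖z - a‖ := fun a ha =>
    (by fun_prop : Continuous fun z : Plane => ‖z - a‖).continuousAt.eventually (lt_mem_nhds ha)
  filter_upwards [o1 _ h1, o1 _ h2] with z z1 z2
  have far : ∀ a : Plane, R * δ < ‖z - a‖ → R ≤ ‖δ⁻¹ • (z - a)‖ := fun a ha => by
    rw [norm_smul, norm_inv, Real.norm_of_nonneg hδ.le, inv_mul_eq_div, le_div_iff₀ hδ]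
    exact ha.le
  have hτ := norm_direction he
  have hz : z - e.2 = (z - e.1) - ‖e.2 - e.1‖ • direction e := by
    rw [sub_sub, add_norm_smul_direction he]
  rw [edgeField, hr.eq_of_le _ (far _ z1), hr.eq_of_le _ (far _ z2), hz]
  simp only [inner_smul_right, inner_sub_right, inner_perp_self, inner_self_of_unit hτ, mul_zero,
    mul_one, sub_zero]
  rw [← sub_smul, smul_smul]
  congr 1
  ring

/-- Pythagoras: `((R+1)δ)² > δ² + (Rδ)²`. Thus inside the strip and outside the balls of radius
`(R+1)δ`, both rescaled transition functions are in their constant range. -/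
theorem abs_inner_gt (he : e.1 ≠ e.2) (hδ : 0 < δ) (hR : 0 < R) {x : Plane}
    (h1 : (R + 1) * δ < ‖x - e.1‖) (h2 : (R + 1) * δ < ‖x - e.2‖)
    (hy : |inner ℝ (perp (direction e)) (x - e.1)| < R * δ) :
    δ < |(inner ℝ (direction e) (x - e.1) : ℝ)| ∧
      δ < |inner ℝ (direction e) (x - e.1) - ‖e.2 - e.1‖| := by
  have hτ := norm_direction he
  have key : ∀ s y n : ℝ, 0 ≤ n → n ^ 2 = s ^ 2 + y ^ 2 → (R + 1) * δ < n → |y| < R * δ →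
      δ < |s| := fun s y n hn hsq hn' hy' => by
    rw [← sq_abs s, ← sq_abs y] at hsq
    by_contra! hs
    have a1 : |s| ^ 2 ≤ δ ^ 2 := pow_le_pow_left₀ (abs_nonneg _) hs 2
    have a2 : |y| ^ 2 ≤ (R * δ) ^ 2 := pow_le_pow_left₀ (abs_nonneg _) hy'.le 2
    have a3 : ((R + 1) * δ) ^ 2 < n ^ 2 := pow_lt_pow_left₀ hn' (by positivity) two_ne_zero
    nlinarith [mul_pos hR (mul_pos hδ hδ)]
  refine ⟨key _ _ _ (norm_nonneg _) (frame_norm_sq hτ _) h1 hy, ?_⟩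
  have hz : x - e.2 = (x - e.1) - ‖e.2 - e.1‖ • direction e := by
    rw [sub_sub, add_norm_smul_direction he]
  refine key _ _ _ (norm_nonneg _) ?_ h2 hy
  rw [frame_norm_sq hτ, hz]
  simp only [inner_smul_right, inner_sub_right, inner_perp_self, inner_self_of_unit hτ, mul_zero,
    mul_one, sub_zero]

theorem transition_diff (hδ : 0 < δ) {s L : ℝ} (hL : 0 < L) (h1 : δ < |s|) (h2 : δ < |s - L|) :
    Real.smoothTransition (δ⁻¹ * s) - Real.smoothTransition (δ⁻¹ * (s - L)) =
      (Set.Ioo 0 L).indicator (1 : ℝ → ℝ) s := by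
  have pos : ∀ t, δ < t → Real.smoothTransition (δ⁻¹ * t) = 1 := fun t ht =>
    Real.smoothTransition.one_of_one_le (by
      rw [inv_mul_eq_div, le_div_iff₀ hδ, one_mul]; exact ht.le)
  have neg : ∀ t, t ≤ 0 → Real.smoothTransition (δ⁻¹ * t) = 0 := fun t ht =>
    Real.smoothTransition.zero_of_nonpos (mul_nonpos_of_nonneg_of_nonpos (inv_pos.2 hδ).le ht)
  rcases lt_abs.1 h1 with h | h
  · rcases lt_abs.1 h2 with h' | h'
    · rw [pos _ h, pos _ h', Set.indicator_of_notMem (fun hm => by linarith [hm.2]), sub_self]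
    · rw [pos _ h, neg _ (by linarith), Set.indicator_of_mem (show s ∈ Set.Ioo 0 L from ⟨by linarith, by linarith⟩)]
      simp
  · rw [neg _ (by linarith), neg _ (by linarith),
      Set.indicator_of_notMem (fun hm => by linarith [hm.1]), sub_self]

/-- Either the transversal coordinate is outside the support of the profile and everything vanishes,
or the point is longitudinally far from both ends, where the difference of the transitions is
locally constant and equal to the indicator of the edge. -/
theorem IsJet.edgeField_eq (he : e.1 ≠ e.2) (hW : IsEdgeProfile β θ c W W' R)
    (hr : IsJet σ (direction e) θ W R r) (hδ : 0 < δ) {x : Plane}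
    (h1 : (R + 1) * δ < ‖x - e.1‖) (h2 : (R + 1) * δ < ‖x - e.2‖) :
    edgeField r e δ x = stripFn e δ W x • direction e ∧
      fderiv ℝ (edgeField r e δ) x =
        (δ⁻¹ * stripFn e δ W' x) • (innerSL ℝ (perp (direction e))).smulRight (direction e) := by
  have hL : 0 < ‖e.2 - e.1‖ := norm_pos_iff.2 (sub_ne_zero.2 he.symm)
  have hev := hr.edgeField_eventuallyEq he hδ (x := x) (by nlinarith) (by nlinarith)
  set s : ℝ := inner ℝ (direction e) (x - e.1) with hs
  set y : ℝ := inner ℝ (perp (direction e)) (x - e.1) with hy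
  set L := ‖e.2 - e.1‖
  set τ := direction e
  set H := Real.smoothTransition
  have dH : ∀ t₀ : ℝ, HasFDerivAt (fun z : Plane => H (δ⁻¹ * (inner ℝ τ (z - e.1) - t₀)))
      ((deriv H (δ⁻¹ * (s - t₀)) * δ⁻¹) • innerSL ℝ τ) x := fun t₀ => by
    have : HasDerivAt (fun t => H (δ⁻¹ * (t - t₀))) (deriv H (δ⁻¹ * (s - t₀)) * δ⁻¹) s := by
      have h3 : HasDerivAt (fun t : ℝ => δ⁻¹ * (t - t₀)) δ⁻¹ s := by
        simpa using ((hasDerivAt_id s).sub_const t₀).const_mul δ⁻¹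
      exact (smoothTransition_hasDerivAt _).comp s h3
    exact fderiv_comp_inner τ e.1 this
  have dW : HasFDerivAt (fun z : Plane => δ⁻¹ * W (δ⁻¹ * inner ℝ (perp τ) (z - e.1)))
      ((δ⁻¹ * (W' (δ⁻¹ * y) * δ⁻¹)) • innerSL ℝ (perp τ)) x := by
    have : HasDerivAt (fun t => δ⁻¹ * W (δ⁻¹ * t)) (δ⁻¹ * (W' (δ⁻¹ * y) * δ⁻¹)) y := by
      have h3 : HasDerivAt (fun t : ℝ => δ⁻¹ * t) δ⁻¹ y := by
        simpa using (hasDerivAt_id y).const_mul δ⁻¹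
      exact ((hW.hasDerivAt _).comp y h3).const_mul δ⁻¹
    exact fderiv_comp_inner (perp τ) e.1 this
  have d0 := dH 0
  simp only [sub_zero] at d0
  have dE := (((d0.sub (dH L)).mul dW).smul_const τ).congr_of_eventuallyEq hev
  rw [dE.fderiv, hev.eq_of_nhds]
  by_cases hyR : R * δ ≤ |y|
  · have far : R ≤ |δ⁻¹ * y| := by
      rw [abs_mul, abs_inv, abs_of_pos hδ, inv_mul_eq_div, le_div_iff₀ hδ]
      exact hyR
    rw [stripFn_eq_zero hδ hW.eq_zero hyR, stripFn_eq_zero hδ hW.deriv_eq_zero hyR]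
    constructor
    · change (_ * (δ⁻¹ * W (δ⁻¹ * y))) • τ = _
      rw [hW.eq_zero _ far]; simp
    · change ContinuousLinearMap.smulRight ((H (δ⁻¹ * s) - H (δ⁻¹ * (s - L))) • _ +
        (δ⁻¹ * W (δ⁻¹ * y)) • _) τ = _
      rw [hW.eq_zero _ far, hW.deriv_eq_zero _ far]
      ext; simp
  · obtain ⟨s1, s2⟩ := abs_inner_gt he hδ hW.pos h1 h2 (not_le.1 hyR)
    have hdiff := transition_diff hδ hL s1 s2
    have z1 : deriv H (δ⁻¹ * s) = 0 := by
      refine (smoothTransition_hasDerivAt_zero ?_).deriv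
      rw [inv_mul_eq_div]
      rcases lt_abs.1 s1 with h | h
      · exact Or.inr ((one_lt_div hδ).2 h)
      · exact Or.inl (div_neg_of_neg_of_pos (by linarith) hδ)
    have z2 : deriv H (δ⁻¹ * (s - L)) = 0 := by
      refine (smoothTransition_hasDerivAt_zero ?_).deriv
      rw [inv_mul_eq_div]
      rcases lt_abs.1 s2 with h | h
      · exact Or.inr ((one_lt_div hδ).2 h)
      · exact Or.inl (div_neg_of_neg_of_pos (by linarith) hδ)
    constructor
    · change ((H (δ⁻¹ * s) - H (δ⁻¹ * (s - L))) * (δ⁻¹ * W (δ⁻¹ * y))) • τ = _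
      rw [hdiff]; rfl
    · change ContinuousLinearMap.smulRight ((H (δ⁻¹ * s) - H (δ⁻¹ * (s - L))) • _ +
        (δ⁻¹ * W (δ⁻¹ * y)) • _) τ = _
      rw [hdiff, z1, z2]
      have : stripFn e δ W' x = (Set.Ioo 0 L).indicator 1 s * (δ⁻¹ * W' (δ⁻¹ * y)) := rfl
      rw [this]
      ext v i
      simp
      ring

end Edge

/-! ### Overlap of thin strips -/

/-- The open strip of half-width `w` around the edge `e`. -/
def strip (e : Plane × Plane) (w : ℝ) : Set Plane :=
  {x | (inner ℝ (direction e) (x - e.1) : ℝ) ∈ Set.Ioo 0 ‖e.2 - e.1‖ ∧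
    |inner ℝ (perp (direction e)) (x - e.1)| < w}

theorem stripFn_eq_zero_of_notMem {e : Plane × Plane} {δ R : ℝ} (hδ : 0 < δ) {f : ℝ → ℝ}
    (hf : ∀ y, R ≤ |y| → f y = 0) {x : Plane} (hx : x ∉ strip e (R * δ)) :
    stripFn e δ f x = 0 := by
  by_cases hs : (inner ℝ (direction e) (x - e.1) : ℝ) ∈ Set.Ioo 0 ‖e.2 - e.1‖
  · exact stripFn_eq_zero hδ hf (not_lt.1 fun h => hx ⟨hs, h⟩)
  · rw [stripFn, Set.indicator_of_notMem hs, zero_mul]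

theorem line_mem_segment {e : Plane × Plane} (he : e.1 ≠ e.2) {t : ℝ}
    (ht : t ∈ Set.Icc 0 ‖e.2 - e.1‖) : e.1 + t • direction e ∈ segment ℝ e.1 e.2 :=
  (mem_segment_iff_line he).2 ⟨t, ht, rfl⟩

/-- Transversal strips meet in a set of diameter `O(δ)`. Parallel strips are disjoint: on distinct
lines as soon as `δ` is small, and on the same line because a common point would give the two
segments an interval in common. -/
theorem volume_strip_inter_strip {e f : Plane × Plane} (he : e.1 ≠ e.2) (hf : f.1 ≠ f.2)
    (h : (segment ℝ e.1 e.2 ∩ segment ℝ f.1 f.2).Subsingleton) {R : ℝ} (hR : 0 < R) :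
    ∃ c, 0 ≤ c ∧ ∀ᶠ δ in 𝓝[>] (0 : ℝ),
      volume (strip e (R * δ) ∩ strip f (R * δ)) ≤ ENNReal.ofReal (c * δ ^ 2) := by
  have hτ := norm_direction he
  have hτ' := norm_direction hf
  set τ := direction e with hτdef
  set τ' := direction f with hτdef'
  rcases eq_or_ne (inner ℝ (perp τ) τ' : ℝ) 0 with h0 | h0
  · refine ⟨0, le_rfl, ?_⟩
    set κ : ℝ := inner ℝ τ τ' with hκ
    have e1 : τ' = κ • τ := by
      have := frame_decomp hτ τ'
      rwa [h0, zero_smul, add_zero] at this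
    have hκ2 : κ * κ = 1 := by
      have := frame_norm_sq hτ τ'
      rw [hτ', h0] at this
      nlinarith
    have e2 : perp τ' = κ • perp τ := by
      rw [e1]; ext i; fin_cases i <;> simp
    have e3 : τ = κ • τ' := by rw [e1, smul_smul, hκ2, one_smul]
    set d : ℝ := inner ℝ (perp τ) (f.1 - e.1) with hd
    have hy : ∀ x : Plane, κ * inner ℝ (perp τ') (x - f.1) = inner ℝ (perp τ) (x - e.1) - d :=
      fun x => by
        rw [e2, inner_smul_left, hd]
        simp only [conj_trivial, inner_sub_right]
        linear_combination (inner ℝ (perp τ) x - inner ℝ (perp τ) f.1 : ℝ) * hκ2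
    rcases eq_or_ne d 0 with hd0 | hd0
    · refine Eventually.of_forall fun δ => ?_
      rw [zero_mul, ENNReal.ofReal_zero, nonpos_iff_eq_zero]
      suffices strip e (R * δ) ∩ strip f (R * δ) = ∅ by rw [this, measure_empty]
      refine Set.eq_empty_of_forall_notMem fun x ⟨⟨hs, _⟩, ⟨hs', _⟩⟩ => ?_
      rw [← hτdef] at hs
      rw [← hτdef'] at hs'
      set s : ℝ := inner ℝ τ (x - e.1) with hsdef
      set s' : ℝ := inner ℝ τ' (x - f.1) with hsdef'
      have hyx := hy x
      rw [hd0, sub_zero] at hyx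
      have p1 : e.1 + s • τ = f.1 + s' • τ' := by
        have q1 := frame_decomp hτ (x - e.1)
        have q2 := frame_decomp hτ' (x - f.1)
        rw [← hsdef, sub_eq_iff_eq_add'] at q1
        rw [← hsdef', sub_eq_iff_eq_add'] at q2
        have q3 : (inner ℝ (perp τ') (x - f.1) : ℝ) • perp τ' =
            (inner ℝ (perp τ) (x - e.1) : ℝ) • perp τ := by
          conv_lhs => rw [e2, smul_smul, ← e2, mul_comm, hyx]
        rw [q3] at q2
        have := q1.symm.trans q2
        rw [← add_assoc, ← add_assoc] at this
        exact add_right_cancel this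
      -- Both projections are interior to their segments, so a small shift along the common line
      -- stays in both and produces a second common point.
      obtain ⟨η, hη, hη1, hη2⟩ : ∃ η : ℝ, 0 < η ∧ s + η ∈ Set.Icc 0 ‖e.2 - e.1‖ ∧
          s' + κ * η ∈ Set.Icc 0 ‖f.2 - f.1‖ := by
        have c1 : ∀ᶠ η in 𝓝[>] (0 : ℝ), s + η ∈ Set.Ioo 0 ‖e.2 - e.1‖ :=
          ((by fun_prop : Continuous fun η : ℝ => s + η).continuousAt.eventually
            (isOpen_Ioo.mem_nhds (by simpa using hs))).filter_mono nhdsWithin_le_nhds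
        have c2 : ∀ᶠ η in 𝓝[>] (0 : ℝ), s' + κ * η ∈ Set.Ioo 0 ‖f.2 - f.1‖ :=
          ((by fun_prop : Continuous fun η : ℝ => s' + κ * η).continuousAt.eventually
            (isOpen_Ioo.mem_nhds (by simpa using hs'))).filter_mono nhdsWithin_le_nhds
        obtain ⟨η, h1, h2, h3⟩ := (c1.and (c2.and self_mem_nhdsWithin)).exists
        exact ⟨η, h3, Set.Ioo_subset_Icc_self h1, Set.Ioo_subset_Icc_self h2⟩
      have m1 : e.1 + s • τ ∈ segment ℝ e.1 e.2 ∩ segment ℝ f.1 f.2 :=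
        ⟨line_mem_segment he (Set.Ioo_subset_Icc_self hs),
          p1 ▸ line_mem_segment hf (Set.Ioo_subset_Icc_self hs')⟩
      have p2 : e.1 + (s + η) • τ = f.1 + (s' + κ * η) • τ' := by
        rw [add_smul, add_smul, ← add_assoc, ← add_assoc, p1, mul_comm, mul_smul, ← e3]
      have m2 : e.1 + (s + η) • τ ∈ segment ℝ e.1 e.2 ∩ segment ℝ f.1 f.2 :=
        ⟨line_mem_segment he hη1, p2 ▸ line_mem_segment hf hη2⟩
      have := h m1 m2
      rw [add_smul, ← add_assoc, left_eq_add, smul_eq_zero] at this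
      rcases this with h1 | h1
      · exact hη.ne' h1
      · rw [h1, norm_zero] at hτ; exact zero_ne_one hτ
    · filter_upwards [Ioo_mem_nhdsGT (show 0 < |d| / (2 * R) by positivity)] with δ hδ
      rw [zero_mul, ENNReal.ofReal_zero, nonpos_iff_eq_zero]
      suffices strip e (R * δ) ∩ strip f (R * δ) = ∅ by rw [this, measure_empty]
      refine Set.eq_empty_of_forall_notMem fun x ⟨⟨_, h1⟩, ⟨_, h2⟩⟩ => ?_
      rw [← hτdef] at h1
      rw [← hτdef'] at h2
      have hκa : |κ| = 1 := by
        have := abs_mul κ κ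
        rw [hκ2, abs_one] at this
        nlinarith [abs_nonneg κ]
      have h3 : d = inner ℝ (perp τ) (x - e.1) - κ * inner ℝ (perp τ') (x - f.1) := by
        rw [hy x]; ring
      have h4 : |d| ≤ |inner ℝ (perp τ) (x - e.1)| + |κ * inner ℝ (perp τ') (x - f.1)| := by
        rw [h3]; exact abs_sub _ _
      rw [abs_mul, hκa, one_mul] at h4
      have h5 := hδ.2
      rw [lt_div_iff₀ (by positivity)] at h5
      linarith
  · set D := |(inner ℝ (perp τ) τ' : ℝ)| with hD
    have hD0 : 0 < D := abs_pos.2 h0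
    set c := 4 * R / D + 2 * R with hc
    have hc0 : 0 < c := by positivity
    refine ⟨c ^ 2 * Real.pi, by positivity, ?_⟩
    filter_upwards [self_mem_nhdsWithin] with δ hδ
    have hδ0 : (0 : ℝ) < δ := hδ
    rcases (strip e (R * δ) ∩ strip f (R * δ)).eq_empty_or_nonempty with h | ⟨x₀, h₀⟩
    · rw [h, measure_empty]; exact zero_le
    have hsub : strip e (R * δ) ∩ strip f (R * δ) ⊆ Metric.closedBall x₀ (c * δ) := by
      intro x hx
      rw [Metric.mem_closedBall, dist_eq_norm]
      have b1 : |inner ℝ (perp τ) (x - x₀)| ≤ 2 * (R * δ) := by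
        have : (inner ℝ (perp τ) (x - x₀) : ℝ) =
          inner ℝ (perp τ) (x - e.1) - inner ℝ (perp τ) (x₀ - e.1) := by
            rw [← inner_sub_right, sub_sub_sub_cancel_right]
        rw [this]
        exact (abs_sub _ _).trans (by linarith [hx.1.2, h₀.1.2])
      have b2 : |inner ℝ (perp τ') (x - x₀)| ≤ 2 * (R * δ) := by
        have : (inner ℝ (perp τ') (x - x₀) : ℝ) =
          inner ℝ (perp τ') (x - f.1) - inner ℝ (perp τ') (x₀ - f.1) := by
            rw [← inner_sub_right, sub_sub_sub_cancel_right]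
        rw [this]
        exact (abs_sub _ _).trans (by linarith [hx.2.2, h₀.2.2])
      set z := x - x₀
      have hz := frame_decomp hτ' z
      -- Decomposing in the frame of `f` and pairing with the normal of `e` solves for the remaining
      -- coordinate; `D`, the sine of the angle between the edges, is the determinant.
      have b3 : |(inner ℝ τ' z : ℝ)| * D ≤ 4 * (R * δ) := by
        have q : (inner ℝ τ' z : ℝ) * inner ℝ (perp τ) τ' = inner ℝ (perp τ) z -
            inner ℝ (perp τ') z * inner ℝ (perp τ) (perp τ') := by
          conv_rhs => rw [hz]
          simp only [inner_add_right, inner_smul_right, inner_perp_self, inner_perp_perp hτ']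
          ring
        rw [hD, ← abs_mul, q]
        refine (abs_sub _ _).trans ?_
        have q2 : |(inner ℝ (perp τ) (perp τ') : ℝ)| ≤ 1 := by
          refine (abs_real_inner_le_norm _ _).trans ?_
          rw [norm_perp, norm_perp, hτ, hτ', one_mul]
        rw [abs_mul]
        nlinarith [mul_le_mul b2 q2 (abs_nonneg _) (by positivity)]
      have b4 : |(inner ℝ τ' z : ℝ)| ≤ 4 * R / D * δ := by
        rw [div_mul_eq_mul_div, le_div_iff₀ hD0]; linarith
      rw [hz]
      refine (norm_add_le _ _).trans ?_
      rw [norm_smul, norm_smul, norm_perp, hτ', mul_one, mul_one, Real.norm_eq_abs,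
        Real.norm_eq_abs, hc]
      linarith
    refine (measure_mono hsub).trans ?_
    rw [EuclideanSpace.volume_closedBall_fin_two, ← ENNReal.ofReal_pow (by positivity),
      ← ENNReal.ofReal_mul (by positivity)]
    exact ENNReal.ofReal_le_ofReal (le_of_eq (by ring))

/-! ### The exceptional set -/

namespace WeightedDigraph

variable {Ω : Set Plane} (G : WeightedDigraph Ω)

open Classical in
/-- The points near a vertex or near two different edges. -/
def exceptional (R δ : ℝ) : Set Plane :=
  (⋃ v ∈ G.V, Metric.closedBall v ((R + 1) * δ)) ∪
    ⋃ p ∈ (G.E ×ˢ G.E).filter (fun p => p.1 ≠ p.2), strip p.1 (R * δ) ∩ strip p.2 (R * δ)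

variable {G} in
theorem IsSimple.volume_exceptional (hG : G.IsSimple) {R : ℝ} (hR : 0 < R) :
    ∃ c, 0 ≤ c ∧ ∀ᶠ δ in 𝓝[>] (0 : ℝ),
      volume (G.exceptional R δ) ≤ ENNReal.ofReal (c * δ ^ 2) := by
  classical
  set S := (G.E ×ˢ G.E).filter (fun p => p.1 ≠ p.2)
  have h1 : ∀ p ∈ S, ∃ c, 0 ≤ c ∧ ∀ᶠ δ in 𝓝[>] (0 : ℝ),
      volume (strip p.1 (R * δ) ∩ strip p.2 (R * δ)) ≤ ENNReal.ofReal (c * δ ^ 2) := fun p hp => by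
    rw [Finset.mem_filter, Finset.mem_product] at hp
    exact volume_strip_inter_strip (G.ne _ hp.1.1) (G.ne _ hp.1.2)
      (hG _ hp.1.1 _ hp.1.2 hp.2) hR
  choose! c hc0 hc using h1
  refine ⟨(∑ _v ∈ G.V, (R + 1) ^ 2 * Real.pi) + ∑ p ∈ S, c p, add_nonneg
    (Finset.sum_nonneg fun _ _ => by positivity) (Finset.sum_nonneg hc0), ?_⟩
  filter_upwards [(Finset.eventually_all S).2 hc, self_mem_nhdsWithin] with δ hδ hδ0
  have hδ0 : (0 : ℝ) < δ := hδ0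
  rw [add_mul, ENNReal.ofReal_add (mul_nonneg (Finset.sum_nonneg fun _ _ => by positivity)
    (sq_nonneg _)) (mul_nonneg (Finset.sum_nonneg hc0) (sq_nonneg _)), Finset.sum_mul,
    Finset.sum_mul, ENNReal.ofReal_sum_of_nonneg fun _ _ => by positivity,
    ENNReal.ofReal_sum_of_nonneg fun p hp => mul_nonneg (hc0 p hp) (sq_nonneg _)]
  refine (measure_union_le _ _).trans (add_le_add ?_ ?_)
  · refine (measure_biUnion_finset_le _ _).trans (Finset.sum_le_sum fun v _ => ?_)
    rw [EuclideanSpace.volume_closedBall_fin_two, ← ENNReal.ofReal_pow (by positivity),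
      ← ENNReal.ofReal_mul (by positivity)]
    exact ENNReal.ofReal_le_ofReal (le_of_eq (by ring))
  · exact (measure_biUnion_finset_le _ _).trans (Finset.sum_le_sum fun p hp => hδ p hp)

end WeightedDigraph

/-! ### Energy density, and comparison of integrals off a small set -/

/-- The sum of the squares of the entries of the gradient. -/
def gradSq (u : Plane → Plane) (x : Plane) : ℝ :=
  ∑ i, ∑ j, (fderiv ℝ u x (EuclideanSpace.single j 1) i) ^ 2

/-- The density of the approximate energy at scale `δ`. -/
def energyDensity (β δ : ℝ) (u : Plane → Plane) (x : Plane) : ℝ :=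
  δ ^ (β - 1) * ‖u x‖ ^ β + δ ^ 3 * gradSq u x

theorem abs_coord_le (x : Plane) (i : Fin 2) : |x i| ≤ ‖x‖ := by
  simpa using PiLp.norm_apply_le x i

theorem abs_fderiv_coord_le (L : Plane →L[ℝ] Plane) (i j : Fin 2) :
    |L (EuclideanSpace.single j 1) i| ≤ ‖L‖ := by
  refine (abs_coord_le _ i).trans ((L.le_opNorm _).trans ?_)
  simp

theorem gradSq_nonneg (u : Plane → Plane) (x : Plane) : 0 ≤ gradSq u x :=
  Finset.sum_nonneg fun _ _ => Finset.sum_nonneg fun _ _ => sq_nonneg _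

theorem gradSq_le {u : Plane → Plane} {x : Plane} {K : ℝ} (h : ‖fderiv ℝ u x‖ ≤ K) :
    gradSq u x ≤ 4 * K ^ 2 := by
  have h1 : ∀ i j, (fderiv ℝ u x (EuclideanSpace.single j 1) i) ^ 2 ≤ K ^ 2 := fun i j => by
    rw [← sq_abs]
    exact pow_le_pow_left₀ (abs_nonneg _) ((abs_fderiv_coord_le _ i j).trans h) 2
  simp only [gradSq, Fin.sum_univ_two]
  linarith [h1 0 0, h1 0 1, h1 1 0, h1 1 1]

/-- The common form of all error estimates: densities of size `O(1/δ)` that agree off a set of area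
`O(δ²)` have integrals differing by `O(δ)`. -/
theorem abs_integral_sub_le {X : Type*} [MeasurableSpace X] {μ : Measure X} {F S : X → ℝ}
    {N : Set X} (hF : Integrable F μ) (hS : Integrable S μ)
    (heq : ∀ x ∉ N, F x = S x) {B v : ℝ} (hB : ∀ x ∈ N, |F x - S x| ≤ B) (hB0 : 0 ≤ B)
    (hv : 0 ≤ v) (hμ : μ N ≤ ENNReal.ofReal v) : |∫ x, F x ∂μ - ∫ x, S x ∂μ| ≤ B * v := by
  rw [← integral_sub hF hS, ← setIntegral_eq_integral_of_forall_compl_eq_zero (s := N)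
    fun x hx => by rw [heq x hx, sub_self]]
  have hlt : μ N < ⊤ := hμ.trans_lt ENNReal.ofReal_lt_top
  refine (norm_setIntegral_le_of_norm_le_const (f := fun x => F x - S x) hlt hB).trans ?_
  exact mul_le_mul_of_nonneg_left (ENNReal.toReal_le_of_le_ofReal hv hμ) hB0

/-! ### Jets for all the edges and the approximating field -/

namespace WeightedDigraph

variable {Ω : Set Plane} (G : WeightedDigraph Ω)

/-- Profiles and jets for all the edges of the graph. -/
structure IsJetSystem (σ : Plane → ℝ) (β : ℝ) (c : ℝ → ℝ) (W W' : Plane × Plane → ℝ → ℝ)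
    (r : Plane × Plane → Plane → Plane) (R : ℝ) : Prop where
  pos : 0 < R
  profile : ∀ e ∈ G.E, IsEdgeProfile β (G.θ e) (c (G.θ e)) (W e) (W' e) R
  jet : ∀ e ∈ G.E, IsJet σ (direction e) (G.θ e) (W e) R (r e)

theorem exists_isJetSystem {σ : Plane → ℝ} (hσ : ContDiff ℝ 1 σ) (hσ0 : ∀ x, 1 ≤ ‖x‖ → σ x = 0)
    (hσ1 : ∫ x, σ x = 1) {β : ℝ} {c : ℝ → ℝ}
    (hc : ∀ θ > 0, ∃ W W' R, IsEdgeProfile β θ (c θ) W W' R) :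
    ∃ W W' r R, G.IsJetSystem σ β c W W' r R := by
  have h1 : ∀ e ∈ G.E, ∃ W W' R, IsEdgeProfile β (G.θ e) (c (G.θ e)) W W' R := fun e he =>
    hc _ (G.θ_pos e he)
  choose! W W' R₁ hW using h1
  have h2 : ∀ e ∈ G.E, ∃ R₂, ∀ R ≥ R₂, ∃ r, IsJet σ (direction e) (G.θ e) (W e) R r :=
    fun e he => exists_isJet hσ hσ0 hσ1 (norm_direction (G.ne e he)) (hW e he)
  choose! R₂ hR₂ using h2
  -- One radius for all profiles and jets; the absolute values make each term of the sum bounded by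
  -- `R`, and the `1` keeps it positive when there are no edges.
  set R : ℝ := 1 + ∑ e ∈ G.E, (|R₁ e| + |R₂ e|) with hR
  have hle : ∀ e ∈ G.E, |R₁ e| + |R₂ e| ≤ R := fun e he => by
    have := Finset.single_le_sum (f := fun e => |R₁ e| + |R₂ e|) (fun _ _ => by positivity) he
    linarith
  have h3 : ∀ e ∈ G.E, ∃ r, IsJet σ (direction e) (G.θ e) (W e) R r := fun e he =>
    hR₂ e he R (by
      have := hle e he
      linarith [le_abs_self (R₂ e), abs_nonneg (R₁ e)])
  choose! r hr using h3
  refine ⟨W, W', r, R, ⟨?_, fun e he => (hW e he).mono ?_, hr⟩⟩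
  · have : 0 ≤ ∑ e ∈ G.E, (|R₁ e| + |R₂ e|) := Finset.sum_nonneg fun _ _ => by positivity
    linarith
  · linarith [hle e he, le_abs_self (R₁ e), abs_nonneg (R₂ e)]

/-- The approximating field at scale `δ`. -/
def field (r : Plane × Plane → Plane → Plane) (δ : ℝ) (x : Plane) : Plane :=
  ∑ e ∈ G.E, edgeField (r e) e δ x

/-- The union of the vertices and of the edges. -/
def carrier : Set Plane := (G.V : Set Plane) ∪ ⋃ e ∈ G.E, segment ℝ e.1 e.2

theorem isCompact_carrier : IsCompact G.carrier :=
  G.V.finite_toSet.isCompact.union (G.E.isCompact_biUnion fun e _ => isCompact_segment e.1 e.2)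

theorem carrier_subset : G.carrier ⊆ Ω :=
  Set.union_subset (fun x hx => G.V_subset x hx) (Set.iUnion₂_subset G.segment_subset)

theorem segment_subset_carrier {e : Plane × Plane} (he : e ∈ G.E) :
    segment ℝ e.1 e.2 ⊆ G.carrier :=
  (Set.subset_biUnion_of_mem (u := fun e : Plane × Plane => segment ℝ e.1 e.2) he).trans
    Set.subset_union_right

theorem strip_subset_cthickening {e : Plane × Plane} (he : e ∈ G.E) {w : ℝ} :
    strip e w ⊆ Metric.cthickening w G.carrier := by
  intro x hx
  refine Metric.mem_cthickening_of_dist_le x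
    (e.1 + (inner ℝ (direction e) (x - e.1) : ℝ) • direction e) w _ (G.segment_subset_carrier he
    (line_mem_segment (G.ne e he) (Set.Ioo_subset_Icc_self hx.1))) ?_
  have h1 := frame_decomp (norm_direction (G.ne e he)) (x - e.1)
  rw [dist_eq_norm, ← sub_sub]
  have h2 : x - e.1 - (inner ℝ (direction e) (x - e.1) : ℝ) • direction e =
      (inner ℝ (perp (direction e)) (x - e.1) : ℝ) • perp (direction e) :=
    sub_eq_iff_eq_add'.2 h1
  rw [h2, norm_smul, norm_perp, norm_direction (G.ne e he), mul_one]
  exact hx.2.le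

variable {G}

namespace IsJetSystem

variable {σ : Plane → ℝ} {β : ℝ} {c : ℝ → ℝ} {W W' : Plane × Plane → ℝ → ℝ}
  {r : Plane × Plane → Plane → Plane} {R δ : ℝ}

theorem contDiff_field (h : G.IsJetSystem σ β c W W' r R) : ContDiff ℝ 1 (G.field r δ) :=
  ContDiff.sum fun e he => (h.jet e he).edgeField_contDiff

theorem fderiv_field (h : G.IsJetSystem σ β c W W' r R) (x : Plane) :
    fderiv ℝ (G.field r δ) x = ∑ e ∈ G.E, fderiv ℝ (edgeField (r e) e δ) x :=
  fderiv_fun_sum fun e he => (h.jet e he).edgeField_contDiff.differentiable (by simp) x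

theorem norm_field_le (h : G.IsJetSystem σ β c W W' r R) :
    ∃ K, 0 ≤ K ∧ ∀ δ > 0, ∀ x, ‖G.field r δ x‖ ≤ K / δ ∧ ‖fderiv ℝ (G.field r δ) x‖ ≤ K / δ ^ 2 := by
  have h1 := fun e he => (h.jet e he).norm_edgeField_le
  choose! K hK using h1
  have h2 : ∀ δ > 0, ∀ x, ‖G.field r δ x‖ ≤ (∑ e ∈ G.E, K e) / δ ∧
      ‖fderiv ℝ (G.field r δ) x‖ ≤ (∑ e ∈ G.E, K e) / δ ^ 2 := fun δ hδ x => by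
    rw [h.fderiv_field, field, Finset.sum_div, Finset.sum_div]
    exact ⟨norm_sum_le_of_le _ fun e he => (hK e he δ hδ x).1,
      norm_sum_le_of_le _ fun e he => (hK e he δ hδ x).2⟩
  refine ⟨∑ e ∈ G.E, K e, ?_, h2⟩
  have := (norm_nonneg _).trans (h2 1 one_pos 0).1
  simpa using this

/-- Each edge contributes its weight times the difference of the kernels at its two ends, so the
vertex sums are exactly the fluxes. No error term appears. -/
theorem divergence_field (h : G.IsJetSystem σ β c W W' r R) (x : Plane) :
    divergence (G.field r δ) x = ∑ v ∈ G.V, G.flux v * (δ⁻¹ * δ⁻¹ * σ (δ⁻¹ • (x - v))) := by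
  have h1 := G.sum_flux_smul fun v => δ⁻¹ * δ⁻¹ * σ (δ⁻¹ • (x - v))
  simp only [smul_eq_mul] at h1
  rw [h1]
  have h2 : divergence (G.field r δ) x = ∑ e ∈ G.E, divergence (edgeField (r e) e δ) x := by
    simp only [divergence, h.fderiv_field, FunLike.coe_sum, Finset.sum_apply, WithLp.ofLp_sum]
    rw [Finset.sum_comm]
  rw [h2]
  refine Finset.sum_congr rfl fun e he => ?_
  rw [(h.jet e he).divergence_edgeField]
  ring

theorem field_eq (h : G.IsJetSystem σ β c W W' r R) (hδ : 0 < δ) {x : Plane}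
    (hx : ∀ v ∈ G.V, (R + 1) * δ < ‖x - v‖) :
    G.field r δ x = ∑ e ∈ G.E, stripFn e δ (W e) x • direction e ∧
      fderiv ℝ (G.field r δ) x = ∑ e ∈ G.E, (δ⁻¹ * stripFn e δ (W' e) x) •
        (innerSL ℝ (perp (direction e))).smulRight (direction e) := by
  have h1 := fun e he => (h.jet e he).edgeField_eq (G.ne e he) (h.profile e he) hδ
    (hx _ (G.source_mem e he)) (hx _ (G.target_mem e he))
  rw [h.fderiv_field]
  exact ⟨Finset.sum_congr rfl fun e he => (h1 e he).1,
    Finset.sum_congr rfl fun e he => (h1 e he).2⟩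

theorem far_of_notMem_exceptional {x : Plane} (hx : x ∉ G.exceptional R δ) :
    ∀ v ∈ G.V, (R + 1) * δ < ‖x - v‖ := fun v hv => by
  by_contra! hle
  refine hx (Or.inl (Set.mem_biUnion hv ?_))
  rwa [Metric.mem_closedBall, dist_eq_norm]

/-- Far from all vertices the field is a sum of strip functions, and each strip lies within `R δ` of
its edge. For small `δ` the support is therefore inside `Ω`. -/
theorem field_eq_zero (h : G.IsJetSystem σ β c W W' r R) (hδ : 0 < δ) {x : Plane}
    (hx : x ∉ Metric.cthickening ((R + 1) * δ) G.carrier) : G.field r δ x = 0 := by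
  have h1 : ∀ v ∈ G.V, (R + 1) * δ < ‖x - v‖ := fun v hv => by
    by_contra! hle
    exact hx (Metric.mem_cthickening_of_dist_le x v _ _ (Or.inl hv) (by rwa [dist_eq_norm]))
  rw [(h.field_eq hδ h1).1]
  refine Finset.sum_eq_zero fun e he => ?_
  rw [stripFn_eq_zero_of_notMem hδ (h.profile e he).eq_zero fun hm => hx
    (Metric.cthickening_mono (by linarith) _ (G.strip_subset_cthickening he hm)), zero_smul]

theorem tsupport_field_subset (h : G.IsJetSystem σ β c W W' r R) (hδ : 0 < δ) :
    tsupport (G.field r δ) ⊆ Metric.cthickening ((R + 1) * δ) G.carrier :=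
  closure_minimal (fun x hx => by
    by_contra hn
    exact hx (h.field_eq_zero hδ hn)) Metric.isClosed_cthickening

theorem hasCompactSupport_field (h : G.IsJetSystem σ β c W W' r R) (hδ : 0 < δ) :
    HasCompactSupport (G.field r δ) :=
  G.isCompact_carrier.cthickening.of_isClosed_subset (isClosed_tsupport _)
    (h.tsupport_field_subset hδ)

theorem integrable_stripFn_profile (h : G.IsJetSystem σ β c W W' r R) (hδ : 0 < δ)
    {e : Plane × Plane} (he : e ∈ G.E) : Integrable (stripFn e δ (W e)) :=
  integrable_stripFn (G.ne e he) hδ (h.profile e he).integrable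

end IsJetSystem

end WeightedDigraph

/-! ### Energy and mass of the approximating field -/

theorem gradSq_eq_of_fderiv {u : Plane → Plane} {x τ : Plane} (hτ : ‖τ‖ = 1) {k : ℝ}
    (h : fderiv ℝ u x = k • (innerSL ℝ (perp τ)).smulRight τ) : gradSq u x = k ^ 2 := by
  have h1 := sq_add_sq_of_unit hτ
  simp [gradSq, h, Fin.sum_univ_two, inner_eq]
  linear_combination k ^ 2 * (τ 0 ^ 2 + τ 1 ^ 2 + 1) * h1

theorem stripFn_of_mem {e : Plane × Plane} {δ w : ℝ} {f : ℝ → ℝ} {x : Plane}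
    (hx : x ∈ strip e w) :
    stripFn e δ f x = δ⁻¹ * f (δ⁻¹ * inner ℝ (perp (direction e)) (x - e.1)) := by
  rw [stripFn, Set.indicator_of_mem hx.1, Pi.one_apply, one_mul]

/-- The energy density of a rescaled profile along an edge. -/
theorem energyDensity_strip {e : Plane × Plane} (he : e.1 ≠ e.2) {β δ w : ℝ} (hδ : 0 < δ)
    {W W' : ℝ → ℝ} (hW : ∀ y, 0 ≤ W y) {u : Plane → Plane} {x : Plane} (hx : x ∈ strip e w)
    (hu : u x = stripFn e δ W x • direction e)
    (hD : fderiv ℝ u x =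
      (δ⁻¹ * stripFn e δ W' x) • (innerSL ℝ (perp (direction e))).smulRight (direction e)) :
    energyDensity β δ u x = stripFn e δ (fun y => W y ^ β + W' y ^ 2) x := by
  rw [energyDensity, gradSq_eq_of_fderiv (norm_direction he) hD, hu, norm_smul, norm_direction he,
    mul_one, Real.norm_of_nonneg (stripFn_nonneg hδ hW x), stripFn_of_mem hx, stripFn_of_mem hx,
    stripFn_of_mem hx, Real.mul_rpow (inv_pos.2 hδ).le (hW _), Real.inv_rpow hδ.le,
    ← Real.rpow_neg hδ.le, ← mul_assoc, ← Real.rpow_add hδ,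
    show β - 1 + -β = -1 by ring, Real.rpow_neg_one]
  field_simp

namespace WeightedDigraph.IsJetSystem

variable {Ω : Set Plane} {G : WeightedDigraph Ω} {σ : Plane → ℝ} {β : ℝ} {c : ℝ → ℝ}
  {W W' : Plane × Plane → ℝ → ℝ} {r : Plane × Plane → Plane → Plane} {R δ : ℝ}

theorem exists_at_most_one {x : Plane} (hx : x ∉ G.exceptional R δ) :
    (∀ e ∈ G.E, x ∉ strip e (R * δ)) ∨
      ∃ e ∈ G.E, x ∈ strip e (R * δ) ∧ ∀ f ∈ G.E, f ≠ e → x ∉ strip f (R * δ) := by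
  classical
  by_cases h : ∀ e ∈ G.E, x ∉ strip e (R * δ)
  · exact Or.inl h
  push Not at h
  obtain ⟨e, he, hxe⟩ := h
  refine Or.inr ⟨e, he, hxe, fun f hf hfe hxf => hx (Or.inr ?_)⟩
  exact Set.mem_biUnion (x := (f, e)) (by simp [hf, he, hfe]) ⟨hxf, hxe⟩

/-- The density is not additive in the field, but off the exceptional set at most one strip contains
the point, so at most one term of each sum is nonzero. -/
theorem energyDensity_eq (h : G.IsJetSystem σ β c W W' r R) (hβ : 0 < β) (hδ : 0 < δ) {x : Plane}
    (hx : x ∉ G.exceptional R δ) :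
    energyDensity β δ (G.field r δ) x =
      ∑ e ∈ G.E, stripFn e δ (fun y => W e y ^ β + W' e y ^ 2) x := by
  obtain ⟨h1, h2⟩ := h.field_eq hδ (far_of_notMem_exceptional hx)
  have zW : ∀ e ∈ G.E, x ∉ strip e (R * δ) → stripFn e δ (W e) x = 0 := fun e he hn =>
    stripFn_eq_zero_of_notMem hδ (h.profile e he).eq_zero hn
  have zW' : ∀ e ∈ G.E, x ∉ strip e (R * δ) → stripFn e δ (W' e) x = 0 := fun e he hn =>
    stripFn_eq_zero_of_notMem hδ (h.profile e he).deriv_eq_zero hn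
  have zk : ∀ e ∈ G.E, x ∉ strip e (R * δ) →
      stripFn e δ (fun y => W e y ^ β + W' e y ^ 2) x = 0 := fun e he hn =>
    stripFn_eq_zero_of_notMem hδ (fun y hy => by
      rw [(h.profile e he).eq_zero y hy, (h.profile e he).deriv_eq_zero y hy,
        Real.zero_rpow hβ.ne']; simp) hn
  rcases exists_at_most_one hx with hn | ⟨e, he, hxe, hn⟩
  · rw [Finset.sum_eq_zero fun e he => by rw [zW e he (hn e he), zero_smul]] at h1
    rw [Finset.sum_eq_zero fun e he => by rw [zW' e he (hn e he), mul_zero, zero_smul]] at h2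
    rw [Finset.sum_eq_zero fun e he => zk e he (hn e he), energyDensity, gradSq, h1, h2]
    simp [Real.zero_rpow hβ.ne']
  · rw [Finset.sum_eq_single_of_mem e he fun f hf hne => by
      rw [zW f hf (hn f hf hne), zero_smul]] at h1
    rw [Finset.sum_eq_single_of_mem e he fun f hf hne => by
      rw [zW' f hf (hn f hf hne), mul_zero, zero_smul]] at h2
    rw [Finset.sum_eq_single_of_mem e he fun f hf hne => zk f hf (hn f hf hne)]
    exact energyDensity_strip (G.ne e he) hδ (h.profile e he).nonneg hxe h1 h2

theorem continuous_energyDensity (hβ : 0 < β) {u : Plane → Plane} (hu : ContDiff ℝ 1 u) :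
    Continuous (energyDensity β δ u) := by
  have h1 := hu.continuous_fderiv (by simp)
  have h2 : Continuous fun x => ‖u x‖ ^ β :=
    hu.continuous.norm.rpow_const fun _ => Or.inr hβ.le
  unfold energyDensity gradSq
  fun_prop

theorem hasCompactSupport_energyDensity (hβ : 0 < β) {u : Plane → Plane}
    (hu : HasCompactSupport u) : HasCompactSupport (energyDensity β δ u) := by
  refine hu.mono' fun x hx => ?_
  by_contra hn
  have h1 : u x = 0 := image_eq_zero_of_notMem_tsupport hn
  have h2 : fderiv ℝ u x = 0 := image_eq_zero_of_notMem_tsupport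
    fun hh => hn (tsupport_fderiv_subset ℝ hh)
  exact hx (by simp [energyDensity, gradSq, h1, h2, Real.zero_rpow hβ.ne'])

theorem integrable_energyDensity (hβ : 0 < β) {u : Plane → Plane} (hu : ContDiff ℝ 1 u)
    (hu' : HasCompactSupport u) : Integrable (energyDensity β δ u) :=
  (continuous_energyDensity hβ hu).integrable_of_hasCompactSupport
    (hasCompactSupport_energyDensity hβ hu')

theorem energyDensity_nonneg (hδ : 0 < δ) (u : Plane → Plane) (x : Plane) :
    0 ≤ energyDensity β δ u x :=
  add_nonneg (by positivity) (mul_nonneg (by positivity) (gradSq_nonneg u x))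

theorem energyDensity_le (hβ : 0 < β) (hδ : 0 < δ) {u : Plane → Plane} {x : Plane} {K : ℝ}
    (hK : 0 ≤ K) (h1 : ‖u x‖ ≤ K / δ) (h2 : ‖fderiv ℝ u x‖ ≤ K / δ ^ 2) :
    energyDensity β δ u x ≤ (K ^ β + 4 * K ^ 2) / δ := by
  have e1 : δ ^ (β - 1) * ‖u x‖ ^ β ≤ K ^ β / δ := by
    calc _ ≤ δ ^ (β - 1) * (K / δ) ^ β := by
          gcongr
      _ = K ^ β / δ := by
          rw [Real.div_rpow hK hδ.le, Real.rpow_sub_one hδ.ne']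
          field_simp
  have e2 : δ ^ 3 * gradSq u x ≤ 4 * K ^ 2 / δ := by
    calc _ ≤ δ ^ 3 * (4 * (K / δ ^ 2) ^ 2) :=
          mul_le_mul_of_nonneg_left (gradSq_le h2) (by positivity)
      _ = 4 * K ^ 2 / δ := by field_simp
  rw [add_div]
  exact add_le_add e1 e2

theorem exists_abs_sum_stripFn_le (G : WeightedDigraph Ω) {f : Plane × Plane → ℝ → ℝ}
    (hf : ∀ e ∈ G.E, ∃ K, ∀ y, |f e y| ≤ K) :
    ∃ K, 0 ≤ K ∧ ∀ δ > 0, ∀ x, |∑ e ∈ G.E, stripFn e δ (f e) x| ≤ K / δ := by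
  choose! K hK using hf
  refine ⟨∑ e ∈ G.E, K e, Finset.sum_nonneg fun e he => (abs_nonneg _).trans (hK e he 0),
    fun δ hδ x => ?_⟩
  rw [Finset.sum_div]
  exact (Finset.abs_sum_le_sum_abs _ _).trans
    (Finset.sum_le_sum fun e he => abs_stripFn_le hδ (hK e he) x)

/-- The energy of the approximating field. -/
theorem abs_energy_sub_le (h : G.IsJetSystem σ β c W W' r R) (hG : G.IsSimple) (hβ : 0 < β) :
    ∃ C, ∀ᶠ δ in 𝓝[>] (0 : ℝ), |(∫ x, energyDensity β δ (G.field r δ) x) -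
      ∑ e ∈ G.E, c (G.θ e) * ‖e.2 - e.1‖| ≤ C * δ := by
  obtain ⟨K, hK0, hK⟩ := h.norm_field_le
  have hki : ∀ e ∈ G.E, Integrable fun y => W e y ^ β + W' e y ^ 2 := fun e he =>
    ((h.profile e he).integrable_rpow hβ).add (h.profile e he).integrable_deriv_sq
  obtain ⟨K₂, hK₂0, hK₂⟩ := exists_abs_sum_stripFn_le G
    (f := fun e y => W e y ^ β + W' e y ^ 2) fun e he => by
      have hp := h.profile e he
      have hc : Continuous fun y => W e y ^ β + W' e y ^ 2 :=
        (hp.continuous.rpow_const fun _ => Or.inr hβ.le).add (hp.continuous_deriv.pow 2)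
      exact (hasCompactSupport_of_abs (R := R) fun y hy => by
        rw [hp.eq_zero y hy, hp.deriv_eq_zero y hy,
          Real.zero_rpow hβ.ne']; simp).exists_bound_of_continuous hc
  obtain ⟨v, hv0, hv⟩ := hG.volume_exceptional h.pos
  -- The density of the field is at most `(K^β + 4K²)/δ` and the sum of strip functions at most
  -- `K₂/δ`, on a set of area `v δ²`.
  refine ⟨(K ^ β + 4 * K ^ 2 + K₂) * v, ?_⟩
  filter_upwards [hv, self_mem_nhdsWithin] with δ hvδ hδ
  have hδ : (0 : ℝ) < δ := hδ
  have hS : Integrable fun x => ∑ e ∈ G.E, stripFn e δ (fun y => W e y ^ β + W' e y ^ 2) x :=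
    integrable_finsetSum _ fun e he => integrable_stripFn (G.ne e he) hδ (hki e he)
  have hSi : ∫ x, ∑ e ∈ G.E, stripFn e δ (fun y => W e y ^ β + W' e y ^ 2) x =
      ∑ e ∈ G.E, c (G.θ e) * ‖e.2 - e.1‖ := by
    rw [integral_finsetSum _ fun e he => integrable_stripFn (G.ne e he) hδ (hki e he)]
    refine Finset.sum_congr rfl fun e he => ?_
    rw [integral_stripFn (G.ne e he) hδ, integral_add ((h.profile e he).integrable_rpow hβ)
      (h.profile e he).integrable_deriv_sq, (h.profile e he).energy, mul_comm]
  have hF := integrable_energyDensity (δ := δ) hβ h.contDiff_field (h.hasCompactSupport_field hδ)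
  rw [← hSi]
  refine (abs_integral_sub_le hF hS
    (fun x hx => h.energyDensity_eq hβ hδ hx) (B := (K ^ β + 4 * K ^ 2 + K₂) / δ)
    (fun x _ => ?_) (by positivity) (by positivity) hvδ).trans (le_of_eq ?_)
  · refine (abs_sub _ _).trans ?_
    rw [abs_of_nonneg (energyDensity_nonneg hδ _ _), add_div]
    exact add_le_add (energyDensity_le hβ hδ hK0 (hK δ hδ x).1 (hK δ hδ x).2) (hK₂ δ hδ x)
  · field_simp

/-- The mass of the approximating field. -/
theorem integral_norm_le (h : G.IsJetSystem σ β c W W' r R) (hG : G.IsSimple) :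
    ∃ C, ∀ᶠ δ in 𝓝[>] (0 : ℝ),
      ∫ x, ‖G.field r δ x‖ ≤ (∑ e ∈ G.E, G.θ e * ‖e.2 - e.1‖) + C * δ := by
  obtain ⟨K, hK0, hK⟩ := h.norm_field_le
  obtain ⟨K₂, hK₂0, hK₂⟩ := exists_abs_sum_stripFn_le G (f := W) fun e he =>
    (hasCompactSupport_of_abs (h.profile e he).eq_zero).exists_bound_of_continuous
      (h.profile e he).continuous
  obtain ⟨v, hv0, hv⟩ := hG.volume_exceptional h.pos
  refine ⟨(K + K₂) * v, ?_⟩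
  filter_upwards [hv, self_mem_nhdsWithin] with δ hvδ hδ
  have hδ : (0 : ℝ) < δ := hδ
  have hS : Integrable fun x => ∑ e ∈ G.E, stripFn e δ (W e) x :=
    integrable_finsetSum _ fun e he => h.integrable_stripFn_profile hδ he
  have hSi : ∫ x, ∑ e ∈ G.E, stripFn e δ (W e) x = ∑ e ∈ G.E, G.θ e * ‖e.2 - e.1‖ := by
    rw [integral_finsetSum _ fun e he => h.integrable_stripFn_profile hδ he]
    refine Finset.sum_congr rfl fun e he => ?_
    rw [integral_stripFn (G.ne e he) hδ, (h.profile e he).mass, mul_comm]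
  have hF : Integrable fun x => ‖G.field r δ x‖ :=
    (h.contDiff_field.continuous.integrable_of_hasCompactSupport
      (h.hasCompactSupport_field hδ)).norm
  have key : |(∫ x, ‖G.field r δ x‖) - ∫ x, ∑ e ∈ G.E, stripFn e δ (W e) x| ≤
      (K + K₂) / δ * (v * δ ^ 2) := by
    refine abs_integral_sub_le hF hS (fun x hx => ?_)
      (fun x _ => ?_) (by positivity) (by positivity) hvδ
    · rw [(h.field_eq hδ (far_of_notMem_exceptional hx)).1]
      have z : ∀ e ∈ G.E, x ∉ strip e (R * δ) → stripFn e δ (W e) x = 0 := fun e he hn =>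
        stripFn_eq_zero_of_notMem hδ (h.profile e he).eq_zero hn
      rcases exists_at_most_one hx with hn | ⟨e, he, _, hn⟩
      · rw [Finset.sum_eq_zero fun e he => by rw [z e he (hn e he), zero_smul],
          Finset.sum_eq_zero fun e he => z e he (hn e he), norm_zero]
      · rw [Finset.sum_eq_single_of_mem e he fun f hf hne => by
          rw [z f hf (hn f hf hne), zero_smul],
          Finset.sum_eq_single_of_mem e he fun f hf hne => z f hf (hn f hf hne), norm_smul,
          norm_direction (G.ne e he), mul_one,
          Real.norm_of_nonneg (stripFn_nonneg hδ (h.profile e he).nonneg x)]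
    · refine (abs_sub _ _).trans ?_
      rw [abs_of_nonneg (norm_nonneg _), add_div]
      exact add_le_add (hK δ hδ x).1 (hK₂ δ hδ x)
  rw [hSi] at key
  have e1 : (K + K₂) / δ * (v * δ ^ 2) = (K + K₂) * v * δ := by field_simp
  rw [e1] at key
  linarith [le_abs_self ((∫ x, ‖G.field r δ x‖) - ∑ e ∈ G.E, G.θ e * ‖e.2 - e.1‖)]

end WeightedDigraph.IsJetSystem

/-! ### Concentration on edges and at vertices -/

/-- If `h` is replaced by its value at the projection onto the line of the edge, the integral is
exact by Fubini. The replacement costs little since `h` is uniformly continuous and the strip has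
half-width `R δ`. -/
theorem tendsto_integral_stripFn_mul {e : Plane × Plane} (he : e.1 ≠ e.2) {β θ c R : ℝ}
    {W W' : ℝ → ℝ} (hW : IsEdgeProfile β θ c W W' R) {h : Plane → ℝ} (hc : Continuous h)
    (hs : HasCompactSupport h) :
    Tendsto (fun δ => ∫ x, stripFn e δ W x * h x) (𝓝[>] 0)
      (𝓝 ((∫ s in Set.Icc 0 ‖e.2 - e.1‖, h (e.1 + s • direction e)) * θ)) := by
  have huc := hc.uniformContinuous_of_tendsto_cocompact hs.is_zero_at_infty
  obtain ⟨M, hM⟩ := hs.exists_bound_of_continuous hc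
  have hL : 0 < ‖e.2 - e.1‖ := norm_pos_iff.2 (sub_ne_zero.2 he.symm)
  have hθ : 0 ≤ θ := hW.mass ▸ integral_nonneg hW.nonneg
  rw [Metric.tendsto_nhds]
  intro ε hε
  obtain ⟨ρ, hρ, hρε⟩ := Metric.uniformContinuous_iff.1 huc (ε / (‖e.2 - e.1‖ * θ + 1))
    (by positivity)
  filter_upwards [Ioo_mem_nhdsGT (div_pos hρ hW.pos)] with δ hδ
  have hδ0 := hδ.1
  have hRδ : R * δ < ρ := by
    have := hδ.2
    rw [lt_div_iff₀ hW.pos] at this; linarith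
  have hi := integrable_stripFn he hδ0 hW.integrable
  set p : Plane → Plane := fun x => e.1 + (inner ℝ (direction e) (x - e.1) : ℝ) • direction e
  have hp : Continuous p := by fun_prop
  have i1 : Integrable fun x => stripFn e δ W x * h x :=
    hi.mul_bdd hc.aestronglyMeasurable (Eventually.of_forall hM)
  have i2 : Integrable fun x => stripFn e δ W x * h (p x) :=
    hi.mul_bdd (hc.comp hp).aestronglyMeasurable (Eventually.of_forall fun x => hM _)
  rw [← hW.mass, ← integral_stripFn_mul he hδ0 W fun s => h (e.1 + s • direction e),
    Real.dist_eq, ← integral_sub i1 i2]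
  calc |∫ x, (stripFn e δ W x * h x - stripFn e δ W x * h (p x))|
      ≤ ∫ x, stripFn e δ W x * (ε / (‖e.2 - e.1‖ * θ + 1)) := by
        rw [← Real.norm_eq_abs]
        refine norm_integral_le_of_norm_le (hi.mul_const _) (Eventually.of_forall fun x => ?_)
        rw [← mul_sub, norm_mul, Real.norm_of_nonneg (stripFn_nonneg hδ0 hW.nonneg x)]
        by_cases hx : x ∈ strip e (R * δ)
        · refine mul_le_mul_of_nonneg_left ?_ (stripFn_nonneg hδ0 hW.nonneg x)
          rw [← dist_eq_norm]
          refine (hρε ?_).le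
          have h1 := frame_decomp (norm_direction he) (x - e.1)
          have h2 : x - p x =
              (inner ℝ (perp (direction e)) (x - e.1) : ℝ) • perp (direction e) := by
            rw [← sub_sub]; exact sub_eq_iff_eq_add'.2 h1
          rw [dist_eq_norm, h2, norm_smul, norm_perp, norm_direction he, mul_one]
          exact hx.2.trans hRδ
        · rw [stripFn_eq_zero_of_notMem hδ0 hW.eq_zero hx, zero_mul, zero_mul]
    _ = ‖e.2 - e.1‖ * θ * (ε / (‖e.2 - e.1‖ * θ + 1)) := by
        rw [integral_mul_const, integral_stripFn he hδ0, hW.mass]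
    _ < ε := by
        rw [mul_div_assoc', div_lt_iff₀ (by positivity)]
        nlinarith

/-- The rescaled kernel `σ` centred at `v`. -/
def kernelAt (σ : Plane → ℝ) (v : Plane) (δ : ℝ) (x : Plane) : ℝ :=
  δ⁻¹ * δ⁻¹ * σ (δ⁻¹ • (x - v))

/-- A smooth probability density carried by the unit ball. -/
structure IsKernel (σ : Plane → ℝ) : Prop where
  contDiff : ContDiff ℝ 1 σ
  nonneg : ∀ x, 0 ≤ σ x
  eq_zero : ∀ x, 1 ≤ ‖x‖ → σ x = 0
  integral_eq : ∫ x, σ x = 1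

theorem exists_isKernel : ∃ σ : Plane → ℝ, IsKernel σ := by
  let b : ContDiffBump (0 : Plane) := ⟨1 / 2, 1, by norm_num, by norm_num⟩
  refine ⟨b.normed volume, b.contDiff_normed, b.nonneg_normed, fun x hx => ?_, b.integral_normed⟩
  have h1 := b.support_normed_eq (μ := (volume : Measure Plane))
  by_contra hn
  have : x ∈ Function.support (b.normed volume) := hn
  rw [h1, mem_ball_zero_iff] at this
  exact absurd this (not_lt.2 hx)

namespace IsKernel

variable {σ : Plane → ℝ} {v : Plane} {δ : ℝ}

theorem hasCompactSupport (h : IsKernel σ) : HasCompactSupport σ :=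
  HasCompactSupport.intro (isCompact_closedBall (0 : Plane) 1) fun x hx => h.eq_zero x (by
    rw [mem_closedBall_zero_iff, not_le] at hx; exact hx.le)

theorem kernelAt_nonneg (h : IsKernel σ) (hδ : 0 < δ) (x : Plane) : 0 ≤ kernelAt σ v δ x :=
  mul_nonneg (by positivity) (h.nonneg _)

theorem kernelAt_eq_zero (h : IsKernel σ) (hδ : 0 < δ) {x : Plane} (hx : δ ≤ ‖x - v‖) :
    kernelAt σ v δ x = 0 := by
  rw [kernelAt, h.eq_zero, mul_zero]
  rwa [norm_smul, norm_inv, Real.norm_of_nonneg hδ.le, inv_mul_eq_div, le_div_iff₀ hδ, one_mul]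

theorem continuous_kernelAt (h : IsKernel σ) : Continuous (kernelAt σ v δ) := by
  have := h.contDiff.continuous
  unfold kernelAt
  fun_prop

theorem hasCompactSupport_kernelAt (h : IsKernel σ) (hδ : 0 < δ) :
    HasCompactSupport (kernelAt σ v δ) :=
  HasCompactSupport.intro (isCompact_closedBall v δ) fun x hx => h.kernelAt_eq_zero hδ (by
    rw [Metric.mem_closedBall, dist_eq_norm, not_le] at hx; exact hx.le)

theorem integrable_kernelAt (h : IsKernel σ) (hδ : 0 < δ) : Integrable (kernelAt σ v δ) :=
  h.continuous_kernelAt.integrable_of_hasCompactSupport (h.hasCompactSupport_kernelAt hδ)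

theorem integral_kernelAt (h : IsKernel σ) (hδ : 0 < δ) : ∫ x, kernelAt σ v δ x = 1 := by
  simp only [kernelAt]
  rw [integral_const_mul, integral_sub_right_eq_self (fun x => σ (δ⁻¹ • x)) v,
    Measure.integral_comp_smul, h.integral_eq]
  have : Module.finrank ℝ Plane = 2 := by simp
  rw [this, abs_of_pos (by positivity), smul_eq_mul]
  field_simp

theorem tendsto_integral_kernelAt_mul (h : IsKernel σ) {φ : Plane → ℝ} (hφ : Continuous φ)
    (hs : HasCompactSupport φ) (v : Plane) :
    Tendsto (fun δ => ∫ x, kernelAt σ v δ x * φ x) (𝓝[>] 0) (𝓝 (φ v)) := by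
  obtain ⟨M, hM⟩ := hs.exists_bound_of_continuous hφ
  rw [Metric.tendsto_nhds]
  intro ε hε
  obtain ⟨ρ, hρ, hρε⟩ := Metric.continuous_iff.1 hφ v (ε / 2) (by positivity)
  filter_upwards [Ioo_mem_nhdsGT hρ] with δ hδ
  have hi := h.integrable_kernelAt (v := v) hδ.1
  have i1 : Integrable fun x => kernelAt σ v δ x * φ x :=
    hi.mul_bdd hφ.aestronglyMeasurable (Eventually.of_forall hM)
  have e1 : φ v = ∫ x, kernelAt σ v δ x * φ v := by
    rw [integral_mul_const, h.integral_kernelAt hδ.1, one_mul]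
  rw [e1, Real.dist_eq, ← integral_sub i1 (hi.mul_const _)]
  calc |∫ x, (kernelAt σ v δ x * φ x - kernelAt σ v δ x * φ v)|
      ≤ ∫ x, kernelAt σ v δ x * (ε / 2) := by
        rw [← Real.norm_eq_abs]
        refine norm_integral_le_of_norm_le (hi.mul_const _) (Eventually.of_forall fun x => ?_)
        rw [← mul_sub, norm_mul, Real.norm_of_nonneg (h.kernelAt_nonneg hδ.1 x)]
        rcases lt_or_ge ‖x - v‖ δ with hx | hx
        · refine mul_le_mul_of_nonneg_left ?_ (h.kernelAt_nonneg hδ.1 x)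
          rw [← dist_eq_norm]
          exact (hρε x (by rw [dist_eq_norm]; exact hx.trans hδ.2)).le
        · rw [h.kernelAt_eq_zero hδ.1 hx, zero_mul, zero_mul]
    _ = ε / 2 := by rw [integral_mul_const, h.integral_kernelAt hδ.1, one_mul]
    _ < ε := by linarith

end IsKernel

/-- A continuous cutoff. -/
theorem exists_cutoff {K : Set Plane} (hK : IsCompact K) :
    ∃ χ : Plane → ℝ, Continuous χ ∧ HasCompactSupport χ ∧ ∀ x ∈ K, χ x = 1 := by
  obtain ⟨f, h1, _, h2, _⟩ := exists_continuous_one_zero_of_isCompact (t := ∅) hK isClosed_empty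
    (Set.disjoint_empty K)
  exact ⟨f, f.continuous, h2, fun x hx => h1 hx⟩

namespace WeightedDigraph.IsJetSystem

variable {Ω : Set Plane} {G : WeightedDigraph Ω} {σ : Plane → ℝ} {β : ℝ} {c : ℝ → ℝ}
  {W W' : Plane × Plane → ℝ → ℝ} {r : Plane × Plane → Plane → Plane} {R δ : ℝ}

theorem divergence_eq_sum_kernelAt (h : G.IsJetSystem σ β c W W' r R) (x : Plane) :
    divergence (G.field r δ) x = ∑ v ∈ G.V, G.flux v * kernelAt σ v δ x :=
  h.divergence_field x

/-- Off the exceptional set the field is the sum of the strips, which converge edge by edge; on that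
set the field and the strips are `O(1/δ)` and the area is `O(δ²)`. -/
theorem tendsto_integral_inner (h : G.IsJetSystem σ β c W W' r R) (hG : G.IsSimple)
    {ψ : Plane → Plane} (hψ : Continuous ψ) (hs : HasCompactSupport ψ) :
    Tendsto (fun δ => ∫ x, inner ℝ (ψ x) (G.field r δ x)) (𝓝[>] 0)
      (𝓝 (∑ e ∈ G.E, ∫ s in Set.Icc 0 ‖e.2 - e.1‖,
        inner ℝ (ψ (e.1 + s • direction e)) (G.θ e • direction e))) := by
  obtain ⟨K, hK0, hK⟩ := h.norm_field_le
  obtain ⟨K₂, hK₂0, hK₂⟩ := exists_abs_sum_stripFn_le G (f := W) fun e he =>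
    (hasCompactSupport_of_abs (h.profile e he).eq_zero).exists_bound_of_continuous
      (h.profile e he).continuous
  obtain ⟨v, hv0, hv⟩ := hG.volume_exceptional h.pos
  obtain ⟨M, hM⟩ := hs.exists_bound_of_continuous hψ
  have hM0 : 0 ≤ M := (norm_nonneg _).trans (hM 0)
  have hc : ∀ e : Plane × Plane, Continuous fun x => (inner ℝ (ψ x) (direction e) : ℝ) :=
    fun e => by fun_prop
  have hcs : ∀ e : Plane × Plane,
      HasCompactSupport fun x => (inner ℝ (ψ x) (direction e) : ℝ) := fun e =>
    hs.comp_left (g := fun z => (inner ℝ z (direction e) : ℝ)) (by simp)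
  have hlim : Tendsto (fun δ => ∑ e ∈ G.E,
      ∫ x, stripFn e δ (W e) x * inner ℝ (ψ x) (direction e)) (𝓝[>] 0)
      (𝓝 (∑ e ∈ G.E, ∫ s in Set.Icc 0 ‖e.2 - e.1‖,
        inner ℝ (ψ (e.1 + s • direction e)) (G.θ e • direction e))) := by
    refine tendsto_finsetSum _ fun e he => ?_
    have := tendsto_integral_stripFn_mul (G.ne e he) (h.profile e he) (hc e) (hcs e)
    rw [← integral_mul_const] at this
    simpa only [inner_smul_right, mul_comm] using this
  have hdiff : Tendsto (fun δ => (∫ x, inner ℝ (ψ x) (G.field r δ x)) - ∑ e ∈ G.E,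
      ∫ x, stripFn e δ (W e) x * inner ℝ (ψ x) (direction e)) (𝓝[>] 0) (𝓝 0) := by
    have hb : Tendsto (fun δ : ℝ => (M * K + M * K₂) * v * δ) (𝓝[>] 0) (𝓝 0) := by
      have : Continuous fun δ : ℝ => (M * K + M * K₂) * v * δ := by fun_prop
      simpa using (this.tendsto 0).mono_left nhdsWithin_le_nhds
    refine squeeze_zero_norm' ?_ hb
    filter_upwards [hv, self_mem_nhdsWithin] with δ hvδ hδ
    have hδ : (0 : ℝ) < δ := hδ
    have hi : ∀ e ∈ G.E, Integrable fun x => stripFn e δ (W e) x * inner ℝ (ψ x) (direction e) :=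
      fun e he => by
        obtain ⟨M', hM'⟩ := (hcs e).exists_bound_of_continuous (hc e)
        exact (h.integrable_stripFn_profile hδ he).mul_bdd (hc e).aestronglyMeasurable
          (Eventually.of_forall hM')
    have hF : Integrable fun x => (inner ℝ (ψ x) (G.field r δ x) : ℝ) := by
      have c1 : Continuous (G.field r δ) := h.contDiff_field.continuous
      have c2 : Continuous fun x => (inner ℝ (ψ x) (G.field r δ x) : ℝ) := by fun_prop
      refine c2.integrable_of_hasCompactSupport (hs.mono fun x hx => ?_)
      simp only [Function.mem_support] at hx ⊢
      rintro h0
      exact hx (by rw [h0, inner_zero_left])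
    rw [← integral_finsetSum _ hi]
    refine (abs_integral_sub_le hF (integrable_finsetSum _ hi) (N := G.exceptional R δ)
      (fun x hx => ?_) (B := (M * K + M * K₂) / δ) (fun x _ => ?_) (by positivity) (by positivity)
      hvδ).trans (le_of_eq (by field_simp))
    · rw [(h.field_eq hδ (far_of_notMem_exceptional hx)).1, inner_sum]
      simp only [inner_smul_right]
    · refine (abs_sub _ _).trans ?_
      rw [add_div]
      refine add_le_add ?_ ?_
      · refine (abs_real_inner_le_norm _ _).trans ?_
        rw [mul_div_assoc]
        exact mul_le_mul (hM x) (hK δ hδ x).1 (norm_nonneg _) hM0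
      · have n0 : ∀ e ∈ G.E, 0 ≤ stripFn e δ (W e) x := fun e he =>
          stripFn_nonneg hδ (h.profile e he).nonneg x
        calc |∑ e ∈ G.E, stripFn e δ (W e) x * inner ℝ (ψ x) (direction e)|
            ≤ ∑ e ∈ G.E, M * stripFn e δ (W e) x := by
              refine (Finset.abs_sum_le_sum_abs _ _).trans (Finset.sum_le_sum fun e he => ?_)
              rw [abs_mul, abs_of_nonneg (n0 e he), mul_comm]
              refine mul_le_mul_of_nonneg_right ((abs_real_inner_le_norm _ _).trans ?_) (n0 e he)
              rw [norm_direction (G.ne e he), mul_one]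
              exact hM x
          _ = M * |∑ e ∈ G.E, stripFn e δ (W e) x| := by
              rw [← Finset.mul_sum, abs_of_nonneg (Finset.sum_nonneg n0)]
          _ ≤ M * K₂ / δ := by
              rw [mul_div_assoc]
              exact mul_le_mul_of_nonneg_left (hK₂ δ hδ x) hM0
  simpa using hdiff.add hlim

/-- Convergence of the approximating fields, tested against continuous fields. -/
theorem tendsto_integral_inner' (h : G.IsJetSystem σ β c W W' r R) (hG : G.IsSimple)
    {ψ : Plane → Plane} (hψ : Continuous ψ) :
    Tendsto (fun δ => ∫ x, inner ℝ (ψ x) (G.field r δ x)) (𝓝[>] 0)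
      (𝓝 (∑ e ∈ G.E, ∫ s in Set.Icc 0 ‖e.2 - e.1‖,
        inner ℝ (ψ (e.1 + s • direction e)) (G.θ e • direction e))) := by
  -- Test fields on the plane need not have compact support. A cutoff equal to `1` on a
  -- neighbourhood of the carrier changes neither side once the fields are supported there.
  obtain ⟨χ, c1, c2, c3⟩ := exists_cutoff (G.isCompact_carrier.cthickening (r := 1))
  have key := h.tendsto_integral_inner hG (c1.smul hψ) (HasCompactSupport.smul_right c2)
  have e1 : (∑ e ∈ G.E, ∫ s in Set.Icc 0 ‖e.2 - e.1‖,
      inner ℝ ((fun x => χ x • ψ x) (e.1 + s • direction e)) (G.θ e • direction e)) =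
      ∑ e ∈ G.E, ∫ s in Set.Icc 0 ‖e.2 - e.1‖,
        inner ℝ (ψ (e.1 + s • direction e)) (G.θ e • direction e) := by
    refine Finset.sum_congr rfl fun e he => setIntegral_congr_fun measurableSet_Icc fun s hs => ?_
    simp only
    rw [c3 _ (Metric.self_subset_cthickening _ (G.segment_subset_carrier he
      (line_mem_segment (G.ne e he) hs))), one_smul]
  rw [← e1]
  refine Tendsto.congr' ?_ key
  filter_upwards [Ioo_mem_nhdsGT (show 0 < 1 / (R + 1) by have := h.pos; positivity)] with δ hδ
  refine integral_congr_ae (Eventually.of_forall fun x => ?_)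
  change inner ℝ (χ x • ψ x) (G.field r δ x) = _
  by_cases hx : x ∈ Metric.cthickening 1 G.carrier
  · rw [c3 x hx, one_smul]
  · have z := h.field_eq_zero hδ.1 fun hm => hx (Metric.cthickening_mono (by
      have h2 := hδ.2
      have := h.pos
      rw [lt_div_iff₀ (by positivity)] at h2
      linarith) _ hm)
    simp only [z, inner_zero_right]

theorem integrable_divergence (h : G.IsJetSystem σ β c W W' r R) (hσ : IsKernel σ) (hδ : 0 < δ) :
    Integrable (divergence (G.field r δ)) := by
  rw [show divergence (G.field r δ) = _ from funext h.divergence_eq_sum_kernelAt]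
  exact integrable_finsetSum _ fun v _ => (hσ.integrable_kernelAt hδ).const_mul _

theorem integral_abs_divergence_le (h : G.IsJetSystem σ β c W W' r R) (hσ : IsKernel σ)
    (hδ : 0 < δ) : ∫ x, |divergence (G.field r δ) x| ≤ ∑ v ∈ G.V, |G.flux v| := by
  have hi : ∀ v ∈ G.V, Integrable fun x => |G.flux v| * kernelAt σ v δ x := fun v _ =>
    (hσ.integrable_kernelAt hδ).const_mul _
  calc ∫ x, |divergence (G.field r δ) x| ≤ ∫ x, ∑ v ∈ G.V, |G.flux v| * kernelAt σ v δ x := by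
        refine integral_mono (h.integrable_divergence hσ hδ).abs (integrable_finsetSum _ hi)
          fun x => ?_
        simp only
        rw [h.divergence_eq_sum_kernelAt]
        refine (Finset.abs_sum_le_sum_abs _ _).trans (Finset.sum_le_sum fun v _ => ?_)
        rw [abs_mul, abs_of_nonneg (hσ.kernelAt_nonneg hδ x)]
    _ = ∑ v ∈ G.V, |G.flux v| := by
        rw [integral_finsetSum _ hi]
        simp [integral_const_mul, hσ.integral_kernelAt hδ]

/-- Interpolation between the uniform bound `O(1/δ²)` on the rescaled kernels and the `L¹` bound
independent of `δ`. -/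
theorem exists_integral_divergence_sq_le (h : G.IsJetSystem σ β c W W' r R) (hσ : IsKernel σ) :
    ∃ C, 0 ≤ C ∧ ∀ δ > 0, ∫ x, divergence (G.field r δ) x ^ 2 ≤ C / δ ^ 2 := by
  obtain ⟨M, hM⟩ := hσ.hasCompactSupport.exists_bound_of_continuous hσ.contDiff.continuous
  have hM0 : 0 ≤ M := (norm_nonneg _).trans (hM 0)
  set A := ∑ v ∈ G.V, |G.flux v| with hA
  have hA0 : 0 ≤ A := Finset.sum_nonneg fun _ _ => abs_nonneg _
  refine ⟨A * M * A, by positivity, fun δ hδ => ?_⟩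
  have hb : ∀ x, |divergence (G.field r δ) x| ≤ A * M / δ ^ 2 := fun x => by
    rw [h.divergence_eq_sum_kernelAt]
    refine (Finset.abs_sum_le_sum_abs _ _).trans ?_
    rw [hA, Finset.sum_mul, Finset.sum_div]
    refine Finset.sum_le_sum fun v _ => ?_
    rw [abs_mul, mul_div_assoc]
    refine mul_le_mul_of_nonneg_left ?_ (abs_nonneg _)
    rw [kernelAt, abs_mul, abs_of_nonneg (by positivity : 0 ≤ δ⁻¹ * δ⁻¹)]
    calc δ⁻¹ * δ⁻¹ * |σ (δ⁻¹ • (x - v))| ≤ δ⁻¹ * δ⁻¹ * M :=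
          mul_le_mul_of_nonneg_left (hM _) (by positivity)
      _ = M / δ ^ 2 := by field_simp
  have hi := (h.integrable_divergence hσ hδ).abs
  calc ∫ x, divergence (G.field r δ) x ^ 2
      ≤ ∫ x, A * M / δ ^ 2 * |divergence (G.field r δ) x| := by
        refine integral_mono_of_nonneg (Eventually.of_forall fun x => sq_nonneg _)
          (hi.const_mul _) (Eventually.of_forall fun x => ?_)
        simp only
        rw [← sq_abs, sq]
        exact mul_le_mul_of_nonneg_right (hb x) (abs_nonneg _)
    _ ≤ A * M / δ ^ 2 * A := by
        rw [integral_const_mul]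
        exact mul_le_mul_of_nonneg_left (h.integral_abs_divergence_le hσ hδ) (by positivity)
    _ = A * M * A / δ ^ 2 := by ring

/-- Convergence of the divergences, tested against continuous functions. -/
theorem tendsto_integral_divergence (h : G.IsJetSystem σ β c W W' r R) (hσ : IsKernel σ)
    {φ : Plane → ℝ} (hφ : Continuous φ) :
    Tendsto (fun δ => ∫ x, φ x * divergence (G.field r δ) x) (𝓝[>] 0)
      (𝓝 (∑ v ∈ G.V, G.flux v * φ v)) := by
  obtain ⟨χ, c1, c2, c3⟩ := exists_cutoff (G.isCompact_carrier.cthickening (r := 1))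
  have hs : HasCompactSupport fun x => χ x * φ x := c2.mul_right
  obtain ⟨M, hM⟩ := hs.exists_bound_of_continuous (c1.mul hφ)
  have mem : ∀ v ∈ G.V, v ∈ Metric.cthickening 1 G.carrier := fun v hv =>
    Metric.self_subset_cthickening _ (Or.inl hv)
  have key : Tendsto (fun δ => ∑ v ∈ G.V, G.flux v * ∫ x, kernelAt σ v δ x * (χ x * φ x)) (𝓝[>] 0)
      (𝓝 (∑ v ∈ G.V, G.flux v * φ v)) := by
    refine tendsto_finsetSum _ fun v hv => Tendsto.const_mul _ ?_
    have := hσ.tendsto_integral_kernelAt_mul (c1.mul hφ) hs v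
    simpa [c3 v (mem v hv)] using this
  refine key.congr' ?_
  filter_upwards [Ioo_mem_nhdsGT one_pos] with δ hδ
  have hi : ∀ v ∈ G.V, Integrable fun x => G.flux v * (kernelAt σ v δ x * (χ x * φ x)) :=
    fun v _ => ((hσ.integrable_kernelAt hδ.1).mul_bdd (c1.mul hφ).aestronglyMeasurable
      (Eventually.of_forall hM)).const_mul _
  simp_rw [← integral_const_mul]
  rw [← integral_finsetSum _ hi]
  refine integral_congr_ae (Eventually.of_forall fun x => ?_)
  simp only
  rw [h.divergence_eq_sum_kernelAt, Finset.mul_sum]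
  refine Finset.sum_congr rfl fun v hv => ?_
  rcases lt_or_ge ‖x - v‖ δ with hx | hx
  · rw [c3 x (Metric.mem_cthickening_of_dist_le x v _ _ (Or.inl hv)
      (by rw [dist_eq_norm]; linarith [hδ.2]))]
    ring
  · rw [hσ.kernelAt_eq_zero hδ.1 hx]; simp

end WeightedDigraph.IsJetSystem

/-! ### Compactly supported fields of class `C¹` -/

/-- The gradient matrix of a field. -/
def gradMatrix (u : Plane → Plane) (x : Plane) : Matrix (Fin 2) (Fin 2) ℝ :=
  Matrix.of fun i j => fderiv ℝ u x (EuclideanSpace.single j 1) i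

section Sobolev

variable {Ω : Set Plane} {u : Plane → Plane}

theorem continuous_gradMatrix (hu : ContDiff ℝ 1 u) (i j : Fin 2) :
    Continuous fun x => gradMatrix u x i j := by
  have := hu.continuous_fderiv (by simp)
  unfold gradMatrix
  simp only [Matrix.of_apply]
  fun_prop

theorem gradMatrix_eq_zero {x : Plane} (hx : x ∉ tsupport u) (i j : Fin 2) :
    gradMatrix u x i j = 0 := by
  have : fderiv ℝ u x = 0 := image_eq_zero_of_notMem_tsupport
    fun hh => hx (tsupport_fderiv_subset ℝ hh)
  simp [gradMatrix, this]

theorem hasCompactSupport_gradMatrix (hs : HasCompactSupport u) (i j : Fin 2) :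
    HasCompactSupport fun x => gradMatrix u x i j :=
  hs.mono' fun x hx => by
    by_contra hn
    exact hx (gradMatrix_eq_zero hn i j)

theorem hasFDerivAt_coord (hu : ContDiff ℝ 1 u) (i : Fin 2) (x : Plane) :
    HasFDerivAt (fun y => u y i) ((EuclideanSpace.proj i).comp (fderiv ℝ u x)) x :=
  (EuclideanSpace.proj (𝕜 := ℝ) i).hasFDerivAt.comp x
    (hu.differentiable (by simp) x).hasFDerivAt

theorem integral_coord_mul_fderiv (hu : ContDiff ℝ 1 u) (hs : HasCompactSupport u) (i j : Fin 2)
    {φ : Plane → ℝ} (hφ : ContDiff ℝ 1 φ) :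
    ∫ x, u x i * fderiv ℝ φ x (EuclideanSpace.single j 1) = -∫ x, gradMatrix u x i j * φ x := by
  have hc : Continuous fun x => u x i := by
    have := hu.continuous
    fun_prop
  have hcs : HasCompactSupport fun x => u x i :=
    hs.comp_left (g := fun z : Plane => z i) (by simp)
  have hd : ∀ x, fderiv ℝ (fun y => u y i) x (EuclideanSpace.single j 1) = gradMatrix u x i j :=
    fun x => by rw [(hasFDerivAt_coord hu i x).fderiv]; rfl
  have hφc : Continuous fun x => fderiv ℝ φ x (EuclideanSpace.single j 1) :=
    (hφ.continuous_fderiv (by simp)).clm_apply continuous_const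
  rw [integral_mul_fderiv_eq_neg_fderiv_mul_of_integrable]
  · simp_rw [hd]
  · simp_rw [hd]
    exact ((continuous_gradMatrix hu i j).mul hφ.continuous).integrable_of_hasCompactSupport
      (hasCompactSupport_gradMatrix hs i j).mul_right
  · exact (hc.mul hφc).integrable_of_hasCompactSupport hcs.mul_right
  · exact (hc.mul hφ.continuous).integrable_of_hasCompactSupport hcs.mul_right
  · exact fun x _ => (hasFDerivAt_coord hu i x).differentiableAt
  · exact fun x _ => hφ.differentiable (by simp) x

theorem memH1_of_contDiff (hu : ContDiff ℝ 1 u) (hs : HasCompactSupport u) (hΩ : tsupport u ⊆ Ω) :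
    MemH1 Ω u (gradMatrix u) where
  memLp := (hu.continuous.memLp_of_hasCompactSupport hs).restrict Ω
  memLp_grad i j := ((continuous_gradMatrix hu i j).memLp_of_hasCompactSupport
    (hasCompactSupport_gradMatrix hs i j)).restrict Ω
  weak_grad i j φ hφ _ _ := by
    rw [setIntegral_eq_integral_of_forall_compl_eq_zero fun x hx => by
        rw [image_eq_zero_of_notMem_tsupport fun h => hx (hΩ h)]; simp,
      setIntegral_eq_integral_of_forall_compl_eq_zero fun x hx => by
        rw [gradMatrix_eq_zero fun h => hx (hΩ h), zero_mul]]
    exact integral_coord_mul_fderiv hu hs i j (hφ.of_le (by simp))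

/-- Mollification. -/
theorem exists_smooth_approx (hu : ContDiff ℝ 1 u) (hs : HasCompactSupport u) {ε : ℝ}
    (hε : 0 < ε) : ∃ ψ : Plane → Plane, ContDiff ℝ ∞ ψ ∧
      tsupport ψ ⊆ Metric.cthickening ε (tsupport u) ∧ (∀ x, ‖ψ x - u x‖ ≤ ε) ∧
      ∀ x, ‖fderiv ℝ ψ x - fderiv ℝ u x‖ ≤ ε := by
  have c1 := hu.continuous
  have c2 := hu.continuous_fderiv (by simp)
  obtain ⟨ρ₁, hρ₁, h₁⟩ := Metric.uniformContinuous_iff.1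
    (c1.uniformContinuous_of_tendsto_cocompact hs.is_zero_at_infty) ε hε
  obtain ⟨ρ₂, hρ₂, h₂⟩ := Metric.uniformContinuous_iff.1
    (c2.uniformContinuous_of_tendsto_cocompact (hs.fderiv ℝ).is_zero_at_infty) ε hε
  -- Radius of the mollifier: small enough for the moduli of continuity of `u` and of its
  -- derivative, and for the enlargement of the support.
  set ρ := min ε (min ρ₁ ρ₂) with hρdef
  have hρ : 0 < ρ := by positivity
  let b : ContDiffBump (0 : Plane) := ⟨ρ / 2, ρ, by positivity, by linarith⟩
  have hloc : LocallyIntegrable (b.normed (volume : Measure Plane)) volume :=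
    b.continuous_normed.locallyIntegrable
  set ψ := convolution (b.normed volume) u (ContinuousLinearMap.lsmul ℝ ℝ) volume with hψ
  refine ⟨ψ, ?_, ?_, fun x => ?_, fun x => ?_⟩
  · exact b.hasCompactSupport_normed.contDiff_convolution_left _ b.contDiff_normed
      c1.locallyIntegrable
  · refine closure_minimal (fun x hx => ?_) Metric.isClosed_cthickening
    have := support_convolution_subset (ContinuousLinearMap.lsmul ℝ ℝ) hx
    obtain ⟨y, hy, z, hz, rfl⟩ := Set.mem_add.1 this
    rw [b.support_normed_eq, mem_ball_zero_iff] at hy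
    refine Metric.mem_cthickening_of_dist_le _ z _ _ (subset_tsupport _ hz) ?_
    rw [dist_eq_norm, add_sub_cancel_right]
    exact hy.le.trans (min_le_left _ _)
  · rw [← dist_eq_norm]
    refine b.dist_normed_convolution_le c1.aestronglyMeasurable fun y hy => (h₁ ?_).le
    exact (Metric.mem_ball.1 hy).trans_le ((min_le_right _ _).trans (min_le_left _ _))
  · rw [(hs.hasFDerivAt_convolution_right _ hloc hu x).fderiv, ← dist_eq_norm]
    have e : (ContinuousLinearMap.lsmul ℝ ℝ : ℝ →L[ℝ] Plane →L[ℝ] Plane).precompR Plane =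
        ContinuousLinearMap.lsmul ℝ ℝ := by
      ext c L x
      simp
    rw [e]
    refine b.dist_normed_convolution_le c2.aestronglyMeasurable fun y hy => (h₂ ?_).le
    exact (Metric.mem_ball.1 hy).trans_le ((min_le_right _ _).trans (min_le_right _ _))

theorem tendsto_eLpNorm_of_le {F : Type*} [NormedAddCommGroup F] (hΩ : volume Ω ≠ ⊤)
    {f : ℕ → Plane → F} {a : ℕ → ℝ} (ha : Tendsto a atTop (𝓝 0)) (hf : ∀ n x, ‖f n x‖ ≤ a n) :
    Tendsto (fun n => eLpNorm (f n) 2 (volume.restrict Ω)) atTop (𝓝 0) := by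
  have h1 : Tendsto (fun n => (volume.restrict Ω) Set.univ ^ (2 : ℝ≥0∞).toReal⁻¹ *
      ENNReal.ofReal (a n)) atTop (𝓝 0) := by
    have h2 := ENNReal.tendsto_ofReal ha
    rw [ENNReal.ofReal_zero] at h2
    have h3 := ENNReal.Tendsto.const_mul (a := (volume.restrict Ω) Set.univ ^ (2 : ℝ≥0∞).toReal⁻¹)
      h2 (Or.inr (ENNReal.rpow_ne_top_of_nonneg (by positivity) (by simpa using hΩ)))
    rwa [mul_zero] at h3
  exact tendsto_of_tendsto_of_tendsto_of_le_of_le tendsto_const_nhds h1 (fun _ => zero_le)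
    fun n => eLpNorm_le_of_ae_bound (Eventually.of_forall (hf n))

/-- Mollifications converge uniformly together with their derivatives, hence in `H¹` on the bounded
set `Ω`; the radii are capped so that all supports stay in `Ω`. -/
theorem memH10_of_contDiff (hΩ : IsOpen Ω) (hΩ' : Bornology.IsBounded Ω) (hu : ContDiff ℝ 1 u)
    (hs : HasCompactSupport u) (hsub : tsupport u ⊆ Ω) : MemH10 Ω u (gradMatrix u) := by
  refine ⟨memH1_of_contDiff hu hs hsub, ?_⟩
  obtain ⟨ρ, hρ, hρΩ⟩ := hs.isCompact.exists_cthickening_subset_open hΩ hsub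
  have hpos : ∀ n : ℕ, 0 < min ρ (1 / ((n : ℝ) + 1)) := fun n => by positivity
  choose ψ h1 h2 h3 h4 using fun n : ℕ => exists_smooth_approx hu hs (hpos n)
  have hlim : Tendsto (fun n : ℕ => min ρ (1 / ((n : ℝ) + 1))) atTop (𝓝 0) :=
    tendsto_of_tendsto_of_tendsto_of_le_of_le tendsto_const_nhds
      tendsto_one_div_add_atTop_nhds_zero_nat (fun n => (hpos n).le) fun n => min_le_right _ _
  have hsub' : ∀ n, tsupport (ψ n) ⊆ Metric.cthickening ρ (tsupport u) := fun n =>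
    (h2 n).trans (Metric.cthickening_mono (min_le_left _ _) _)
  refine ⟨ψ, fun n => ⟨h1 n, ?_, (hsub' n).trans hρΩ⟩,
    tendsto_eLpNorm_of_le hΩ'.measure_lt_top.ne hlim h3, fun i j =>
    tendsto_eLpNorm_of_le hΩ'.measure_lt_top.ne hlim fun n x => ?_⟩
  · exact hs.isCompact.cthickening.of_isClosed_subset (isClosed_tsupport _) (hsub' n)
  · refine le_trans ?_ (h4 n x)
    exact abs_fderiv_coord_le (fderiv ℝ (ψ n) x - fderiv ℝ u x) i j

theorem sum_gradMatrix_diag (u : Plane → Plane) (x : Plane) :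
    ∑ i, gradMatrix u x i i = divergence u x := rfl

theorem sum_gradMatrix_sq (u : Plane → Plane) (x : Plane) :
    ∑ i, ∑ j, gradMatrix u x i j ^ 2 = gradSq u x := rfl

theorem divergence_eq_zero {x : Plane} (hx : x ∉ tsupport u) : divergence u x = 0 := by
  simp only [← sum_gradMatrix_diag, gradMatrix_eq_zero hx, Finset.sum_const_zero]

theorem integrable_divergence (hu : ContDiff ℝ 1 u) (hs : HasCompactSupport u) :
    Integrable (divergence u) := by
  rw [show divergence u = fun x => ∑ i, gradMatrix u x i i from rfl]
  exact integrable_finsetSum _ fun i _ => (continuous_gradMatrix hu i i).integrable_of_hasCompactSupport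
    (hasCompactSupport_gradMatrix hs i i)

/-! ### The measures associated to compactly supported fields -/

theorem variation_withDensity_compl {F : Type*} [NormedAddCommGroup F] [NormedSpace ℝ F]
    [CompleteSpace F] {f : Plane → F} (hf : Integrable f) :
    ((volume.restrict Ω).withDensityᵥ f).variation (closure Ω)ᶜ = 0 := by
  rw [Measure.variation_withDensityᵥ hf.restrict]
  refine withDensity_absolutelyContinuous _ _ ?_
  rw [Measure.restrict_apply isClosed_closure.measurableSet.compl]
  exact measure_mono_null (fun x hx => absurd (subset_closure hx.2) hx.1) measure_empty

theorem integral_withDensity_restrict {F E H : Type*} [NormedAddCommGroup F] [NormedSpace ℝ F]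
    [CompleteSpace F] [NormedAddCommGroup E] [NormedSpace ℝ E] [NormedAddCommGroup H]
    [NormedSpace ℝ H] [CompleteSpace H] (hΩ' : Bornology.IsBounded Ω) {f : Plane → F}
    (hf : Integrable f) (hsub : ∀ x ∉ Ω, f x = 0) (B : E →L[ℝ] F →L[ℝ] H) {g : Plane → E}
    (hg : Continuous g) :
    ((volume.restrict Ω).withDensityᵥ f).integral g B = ∫ x, B (g x) (f x) := by
  have hfin : ((volume.restrict Ω).withDensityᵥ f).variation Set.univ ≠ ⊤ := by
    rw [Measure.variation_withDensityᵥ hf.restrict, withDensity_apply _ MeasurableSet.univ]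
    simpa using! (hf.restrict (s := Ω)).2.ne
  rw [integral_withDensityᵥ hf.restrict B (integrable_of_variation_compl hfin
    hΩ'.isCompact_closure (variation_withDensity_compl hf) hg)]
  exact setIntegral_eq_integral_of_forall_compl_eq_zero fun x hx => by rw [hsub x hx, map_zero]

theorem integral_fieldMeasure (hΩ' : Bornology.IsBounded Ω) (hu : ContDiff ℝ 1 u)
    (hs : HasCompactSupport u) (hsub : tsupport u ⊆ Ω) {E H : Type*} [NormedAddCommGroup E]
    [NormedSpace ℝ E] [NormedAddCommGroup H] [NormedSpace ℝ H] [CompleteSpace H]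
    (B : E →L[ℝ] Plane →L[ℝ] H) {g : Plane → E} (hg : Continuous g) :
    (fieldMeasure Ω u).integral g B = ∫ x, B (g x) (u x) :=
  integral_withDensity_restrict hΩ' (hu.continuous.integrable_of_hasCompactSupport hs)
    (fun _ hx => image_eq_zero_of_notMem_tsupport fun h => hx (hsub h)) B hg

theorem integral_divergence_measure (hΩ' : Bornology.IsBounded Ω) (hu : ContDiff ℝ 1 u)
    (hs : HasCompactSupport u) (hsub : tsupport u ⊆ Ω) {φ : Plane → ℝ} (hφ : Continuous φ) :
    ((volume.restrict Ω).withDensityᵥ (divergence u)).integral φ (ContinuousLinearMap.lsmul ℝ ℝ) =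
      ∫ x, φ x * divergence u x :=
  integral_withDensity_restrict hΩ' (integrable_divergence hu hs)
    (fun _ hx => divergence_eq_zero fun h => hx (hsub h)) _ hφ

/-- Because the field has compact support in `Ω`, integration by parts leaves no boundary term,
although test functions are free on the boundary of `Ω`. -/
theorem hasWeakDiv_fieldMeasure (hΩ' : Bornology.IsBounded Ω) (hu : ContDiff ℝ 1 u)
    (hs : HasCompactSupport u) (hsub : tsupport u ⊆ Ω) :
    HasWeakDiv Ω (fieldMeasure Ω u) ((volume.restrict Ω).withDensityᵥ (divergence u)) := by
  refine ⟨variation_withDensity_compl (integrable_divergence hu hs), fun φ hφ => ?_⟩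
  rw [integral_divergence_measure hΩ' hu hs hsub hφ.continuous,
    integral_fieldMeasure hΩ' hu hs hsub _ (hφ.continuous_fderiv (by simp))]
  have h1 : ∀ x, (ContinuousLinearMap.id ℝ (Plane →L[ℝ] ℝ)) (fderiv ℝ φ x) (u x) =
      ∑ i, u x i * fderiv ℝ φ x (EuclideanSpace.single i 1) := fun x => by
    rw [ContinuousLinearMap.id_apply, ← sum_clm_single]
    exact Finset.sum_congr rfl fun i _ => mul_comm _ _
  have h2 : ∀ x, φ x * divergence u x = ∑ i, gradMatrix u x i i * φ x := fun x => by
    rw [← Finset.sum_mul, sum_gradMatrix_diag, mul_comm]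
  simp_rw [h1, h2]
  rw [integral_finsetSum _ fun i _ => ?_, integral_finsetSum _ fun i _ => ?_,
    ← Finset.sum_neg_distrib]
  · exact Finset.sum_congr rfl fun i _ => by
      rw [integral_coord_mul_fderiv hu hs i i hφ, neg_neg]
  · have hc : Continuous fun x => u x i := by
      have := hu.continuous
      fun_prop
    have hcs : HasCompactSupport fun x => u x i :=
      hs.comp_left (g := fun z : Plane => z i) (by simp)
    exact (hc.mul ((hφ.continuous_fderiv (by simp)).clm_apply
      continuous_const)).integrable_of_hasCompactSupport hcs.mul_right
  · exact ((continuous_gradMatrix hu i i).mul hφ.continuous).integrable_of_hasCompactSupport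
      (hasCompactSupport_gradMatrix hs i i).mul_right

theorem memMdiv_fieldMeasure (hΩ' : Bornology.IsBounded Ω) (hu : ContDiff ℝ 1 u)
    (hs : HasCompactSupport u) (hsub : tsupport u ⊆ Ω) : MemMdiv Ω (fieldMeasure Ω u) :=
  ⟨variation_withDensity_compl (hu.continuous.integrable_of_hasCompactSupport hs),
    _, hasWeakDiv_fieldMeasure hΩ' hu hs hsub⟩

/-! ### The approximate energy of a compactly supported field -/

/-- The fundamental lemma of the calculus of variations. It ensures that the infimum in
`approxEnergy` is over a single value. -/
theorem MemH1.ae_eq_grad (hΩ : IsOpen Ω) {D D' : Plane → Matrix (Fin 2) (Fin 2) ℝ}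
    (h : MemH1 Ω u D) (h' : MemH1 Ω u D') (i j : Fin 2) :
    ∀ᵐ x ∂volume.restrict Ω, D x i j = D' x i j := by
  have l1 := (h.memLp_grad i j).locallyIntegrable (by norm_num)
  have l2 := (h'.memLp_grad i j).locallyIntegrable (by norm_num)
  have key : ∀ᵐ x ∂volume.restrict Ω, x ∈ Ω → D x i j - D' x i j = 0 := by
    refine hΩ.ae_eq_zero_of_integral_contDiff_smul_eq_zero
      ((l1.sub l2).locallyIntegrableOn Ω) fun φ hφ hs hsub => ?_
    have e1 := h.weak_grad i j φ hφ hs hsub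
    have e2 := h'.weak_grad i j φ hφ hs hsub
    have e3 : ∫ x in Ω, D x i j * φ x = ∫ x in Ω, D' x i j * φ x :=
      neg_injective (e1.symm.trans e2)
    have i1 : ∀ {D : Plane → Matrix (Fin 2) (Fin 2) ℝ}, MemH1 Ω u D →
        Integrable (fun x => D x i j * φ x) (volume.restrict Ω) := fun hD =>
      (hD.memLp_grad i j).integrable_mul (q := 2)
        ((hφ.continuous.memLp_of_hasCompactSupport hs).restrict Ω)
    rw [← sub_eq_zero, ← integral_sub (i1 h) (i1 h')] at e3
    rw [← e3]
    exact integral_congr_ae (Eventually.of_forall fun x => by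
      simp only [smul_eq_mul]; ring)
  filter_upwards [key, ae_restrict_mem hΩ.measurableSet] with x hx hm
  exact sub_eq_zero.1 (hx hm)

theorem approxEnergy_eq (hΩ : IsOpen Ω) {D : Plane → Matrix (Fin 2) (Fin 2) ℝ} (h : MemH1 Ω u D)
    (α ε : ℝ) : approxEnergy α ε Ω u =
      ENNReal.ofReal (ε ^ (-gammaOne α)) * (∫⁻ x in Ω, ENNReal.ofReal (‖u x‖ ^ betaExp α)) +
      ENNReal.ofReal (ε ^ gammaTwo α) *
        ∫⁻ x in Ω, ENNReal.ofReal (∑ i, ∑ j, D x i j ^ 2) := by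
  refine le_antisymm (iInf₂_le D h) (le_iInf₂ fun D' h' => le_of_eq ?_)
  congr 2
  refine lintegral_congr_ae ?_
  filter_upwards [ae_all_iff.2 fun i => ae_all_iff.2 fun j => h.ae_eq_grad hΩ h' i j] with x hx
  simp only [hx]

theorem approxEnergy_eq_ofReal (hΩ : IsOpen Ω) (hu : ContDiff ℝ 1 u) (hs : HasCompactSupport u)
    (hsub : tsupport u ⊆ Ω) {α ε δ : ℝ} (hβ : 0 < betaExp α) (hδ : 0 < δ)
    (e1 : ε ^ (-gammaOne α) = δ ^ (betaExp α - 1)) (e2 : ε ^ gammaTwo α = δ ^ 3) :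
    approxEnergy α ε Ω u = ENNReal.ofReal (∫ x, energyDensity (betaExp α) δ u x) := by
  have n1 : ∀ x, 0 ≤ δ ^ (betaExp α - 1) * ‖u x‖ ^ betaExp α := fun x => by positivity
  have n2 : ∀ x, 0 ≤ δ ^ 3 * gradSq u x := fun x => mul_nonneg (by positivity) (gradSq_nonneg u x)
  have hi := WeightedDigraph.IsJetSystem.integrable_energyDensity (δ := δ) hβ hu hs
  have hc : Continuous fun x => ‖u x‖ ^ betaExp α :=
    hu.continuous.norm.rpow_const fun _ => Or.inr hβ.le
  rw [approxEnergy_eq hΩ (memH1_of_contDiff hu hs hsub), e1, e2,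
    ← lintegral_const_mul' _ _ ENNReal.ofReal_ne_top,
    ← lintegral_const_mul' _ _ ENNReal.ofReal_ne_top, ← lintegral_add_left
      ((hc.measurable.ennreal_ofReal).const_mul _),
    ← setIntegral_eq_integral_of_forall_compl_eq_zero (s := Ω) fun x hx => ?_,
    ofReal_integral_eq_lintegral_ofReal hi.restrict (Eventually.of_forall fun x =>
      WeightedDigraph.IsJetSystem.energyDensity_nonneg hδ u x)]
  · refine lintegral_congr fun x => ?_
    rw [sum_gradMatrix_sq, energyDensity, ENNReal.ofReal_add (n1 x) (n2 x),
      ENNReal.ofReal_mul (by positivity), ENNReal.ofReal_mul (by positivity)]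
  · have h1 : x ∉ tsupport u := fun h => hx (hsub h)
    rw [energyDensity, ← sum_gradMatrix_sq]
    simp [gradMatrix_eq_zero h1, image_eq_zero_of_notMem_tsupport h1, Real.zero_rpow hβ.ne']

end Sobolev

/-! ### The scale `δ = ε^γ` and the conclusion -/

theorem rpow_gammaExp_energy {α ε : ℝ} (hα : 1 / 2 < α) (hε : 0 < ε) :
    ε ^ (-gammaOne α) = (ε ^ gammaExp α) ^ (betaExp α - 1) ∧
      ε ^ gammaTwo α = (ε ^ gammaExp α) ^ 3 := by
  have h : α + 1 ≠ 0 := by linarith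
  constructor
  · rw [← Real.rpow_mul hε.le]
    congr 1
    rw [gammaOne, gammaExp, betaExp]
    field_simp
    ring
  · rw [← Real.rpow_natCast, ← Real.rpow_mul hε.le]
    congr 1
    rw [gammaTwo, gammaExp]
    push_cast
    ring

theorem tendsto_rpow_gammaExp {α : ℝ} (hα : 1 / 2 < α) :
    Tendsto (fun ε : ℝ => ε ^ gammaExp α) (𝓝[>] 0) (𝓝[>] 0) := by
  have hγ : 0 < gammaExp α := by rw [gammaExp]; linarith
  refine tendsto_nhdsWithin_iff.2 ⟨?_, ?_⟩
  · have := (Real.continuous_rpow_const hγ.le).tendsto (0 : ℝ)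
    rw [Real.zero_rpow hγ.ne'] at this
    exact this.mono_left nhdsWithin_le_nhds
  · filter_upwards [self_mem_nhdsWithin] with ε hε using Real.rpow_pos_of_pos hε _

theorem setLIntegral_enorm_le {F : Type*} [NormedAddCommGroup F] {f : Plane → F} {Ω : Set Plane}
    (hf : Integrable f) : ∫⁻ x in Ω, ‖f x‖ₑ ≤ ENNReal.ofReal (∫ x, ‖f x‖) := by
  rw [ofReal_integral_norm_eq_lintegral_enorm hf]
  exact setLIntegral_le_lintegral _ _

theorem eLpNorm_two_restrict_le {f : Plane → ℝ} {Ω : Set Plane} (hf : MemLp f 2) {A : ℝ}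
    (h : ∫ x, f x ^ 2 ≤ A ^ 2) (hA : 0 ≤ A) :
    eLpNorm f 2 (volume.restrict Ω) ≤ ENNReal.ofReal A := by
  refine (eLpNorm_mono_measure f Measure.restrict_le_self).trans ?_
  rw [hf.eLpNorm_eq_integral_rpow_norm (by norm_num) (by norm_num)]
  refine ENNReal.ofReal_le_ofReal ?_
  simp only [ENNReal.toReal_ofNat, Real.rpow_ofNat, Real.norm_eq_abs, sq_abs]
  rw [Real.rpow_inv_le_iff_of_pos (integral_nonneg fun _ => sq_nonneg _) hA two_pos]
  simpa using h

/-- The approximation theorem for a simple graph. -/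
theorem WeightedDigraph.IsSimple.exists_approximation {α : ℝ} (hα : 1 / 2 < α) (hα' : α < 1)
    {Ω : Set Plane} (hΩ : IsOpen Ω) (hΩ' : Bornology.IsBounded Ω) {G : WeightedDigraph Ω}
    (hG : G.IsSimple) :
    ∃ (u : ℝ → Plane → Plane) (C : ℝ),
      (∀ ε > 0, IntegrableOn (u ε) Ω ∧ MemMdiv Ω (fieldMeasure Ω (u ε))) ∧
      TendstoMdiv Ω (𝓝[>] (0 : ℝ)) (fun ε => fieldMeasure Ω (u ε)) G.measure ∧
      ∀ᶠ ε in 𝓝[>] (0 : ℝ),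
        ∃ D : Plane → Matrix (Fin 2) (Fin 2) ℝ,
          MemH10 Ω (u ε) D ∧
          (∫⁻ x in Ω, ‖u ε x‖ₑ) ≤
            G.measure.variation Ω + ENNReal.ofReal (C * ε ^ gammaExp α) ∧
          (∫⁻ x in Ω, ‖∑ i, D x i i‖ₑ) ≤ (weakDiv Ω G.measure).variation Ω ∧
          ENNReal.ofReal (ε ^ gammaExp α) *
              eLpNorm (fun x => ∑ i, D x i i) 2 (volume.restrict Ω) ≤ ENNReal.ofReal C ∧
          approxEnergy α ε Ω (u ε) ≠ ⊤ ∧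
          |(approxEnergy α ε Ω (u ε)).toReal - (cZero α).toReal * (energy α G.measure).toReal| ≤
            C * ε ^ gammaExp α := by
  classical
  have hβ := betaExp_pos hα
  obtain ⟨σ, hσ⟩ := exists_isKernel
  obtain ⟨W, W', r, R, h⟩ := G.exists_isJetSystem hσ.contDiff hσ.eq_zero hσ.integral_eq
    (cZero_and_edgeProfiles hα hα').2
  obtain ⟨ρ, hρ, hρΩ⟩ := G.isCompact_carrier.exists_cthickening_subset_open hΩ G.carrier_subset
  obtain ⟨C₁, hC₁⟩ := h.integral_norm_le hG
  obtain ⟨C₂, hC₂0, hC₂⟩ := h.exists_integral_divergence_sq_le hσ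
  obtain ⟨C₃, hC₃⟩ := h.abs_energy_sub_le hG hβ
  have hR := h.pos
  set γ := gammaExp α
  -- The family must lie in `M_div(Ω)` for every `ε > 0`, so it is set to zero while the strips are
  -- too wide to be certain to fit in `Ω`.
  set u : ℝ → Plane → Plane := fun ε =>
    if 0 < ε ^ γ ∧ (R + 1) * ε ^ γ ≤ ρ then G.field r (ε ^ γ) else 0 with hu
  have hprop : ∀ ε, ContDiff ℝ 1 (u ε) ∧ HasCompactSupport (u ε) ∧ tsupport (u ε) ⊆ Ω := by
    intro ε
    by_cases hc : 0 < ε ^ γ ∧ (R + 1) * ε ^ γ ≤ ρ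
    · simp only [hu, if_pos hc]
      exact ⟨h.contDiff_field, h.hasCompactSupport_field hc.1, (h.tsupport_field_subset hc.1).trans
        ((Metric.cthickening_mono hc.2 _).trans hρΩ)⟩
    · simp only [hu, if_neg hc]
      exact ⟨contDiff_const, HasCompactSupport.zero, by simp [tsupport]⟩
  have hlim := tendsto_rpow_gammaExp hα
  have hev : ∀ᶠ ε in 𝓝[>] (0 : ℝ), u ε = G.field r (ε ^ γ) := by
    have : ∀ᶠ δ in 𝓝[>] (0 : ℝ), 0 < δ ∧ (R + 1) * δ ≤ ρ := by
      filter_upwards [Ioo_mem_nhdsGT (show 0 < ρ / (R + 1) by positivity)] with δ hδ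
      have h2 := hδ.2
      rw [lt_div_iff₀ (by positivity)] at h2
      exact ⟨hδ.1, by linarith⟩
    filter_upwards [hlim.eventually this] with ε hε
    exact if_pos hε
  have hdiv : weakDiv Ω G.measure = G.divMeasure := G.hasWeakDiv.weakDiv_eq hΩ'
  -- One constant for the mass, divergence and energy estimates; the absolute values make it
  -- dominate each of the three.
  refine ⟨u, |C₁| + Real.sqrt C₂ + |C₃|, fun ε _ => ?_, ⟨fun ψ hψ => ?_, fun φ hφ => ?_⟩, ?_⟩
  · obtain ⟨h1, h2, h3⟩ := hprop ε
    exact ⟨(h1.continuous.integrable_of_hasCompactSupport h2).integrableOn,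
      memMdiv_fieldMeasure hΩ' h1 h2 h3⟩
  · rw [G.integral_measure hψ]
    refine ((h.tendsto_integral_inner' hG hψ).comp hlim).congr' ?_
    filter_upwards [hev] with ε hε
    obtain ⟨h1, h2, h3⟩ := hprop ε
    rw [integral_fieldMeasure hΩ' h1 h2 h3 _ hψ, hε]
    rfl
  · rw [hdiv, G.integral_divMeasure hφ]
    refine ((h.tendsto_integral_divergence hσ hφ).comp hlim).congr' ?_
    filter_upwards [hev] with ε hε
    obtain ⟨h1, h2, h3⟩ := hprop ε
    rw [(hasWeakDiv_fieldMeasure hΩ' h1 h2 h3).weakDiv_eq hΩ',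
      integral_divergence_measure hΩ' h1 h2 h3 hφ, hε]
    rfl
  · filter_upwards [hev, hlim.eventually hC₁, hlim.eventually hC₃, self_mem_nhdsWithin]
      with ε hε b1 b3 hε0
    have hε0 : (0 : ℝ) < ε := hε0
    obtain ⟨h1, h2, h3⟩ := hprop ε
    rw [hε] at h1 h2 h3 ⊢
    set δ := ε ^ γ
    have hδ : 0 < δ := Real.rpow_pos_of_pos hε0 _
    obtain ⟨e1, e2⟩ := rpow_gammaExp_energy hα hε0
    have hA := approxEnergy_eq_ofReal hΩ h1 h2 h3 hβ hδ e1 e2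
    have hsq := Real.sqrt_nonneg C₂
    refine ⟨gradMatrix (G.field r δ), memH10_of_contDiff hΩ hΩ' h1 h2 h3, ?_, ?_, ?_, ?_, ?_⟩
    · refine (setLIntegral_enorm_le (h1.continuous.integrable_of_hasCompactSupport h2)).trans ?_
      refine (ENNReal.ofReal_le_ofReal b1).trans (ENNReal.ofReal_add_le.trans ?_)
      refine add_le_add hG.mass_le_variation (ENNReal.ofReal_le_ofReal ?_)
      exact mul_le_mul_of_nonneg_right
        (by linarith [le_abs_self C₁, abs_nonneg C₃]) hδ.le
    · rw [hdiv]
      refine le_trans ?_ G.sum_abs_flux_le_variation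
      simp_rw [sum_gradMatrix_diag]
      refine (setLIntegral_enorm_le (h.integrable_divergence hσ hδ)).trans ?_
      refine (ENNReal.ofReal_le_ofReal (h.integral_abs_divergence_le hσ hδ)).trans (le_of_eq ?_)
      rw [ENNReal.ofReal_sum_of_nonneg fun _ _ => abs_nonneg _]
      exact Finset.sum_congr rfl fun v _ => (Real.enorm_eq_ofReal_abs _).symm
    · simp_rw [sum_gradMatrix_diag]
      have hcont : Continuous (divergence (G.field r δ)) := by
        rw [show divergence (G.field r δ) = fun x => ∑ i, gradMatrix (G.field r δ) x i i from rfl]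
        exact continuous_finsetSum _ fun i _ => continuous_gradMatrix h1 i i
      have hcs : HasCompactSupport (divergence (G.field r δ)) := h2.mono' fun x hx => by
        by_contra hn
        exact hx (divergence_eq_zero hn)
      have hle : ∫ x, divergence (G.field r δ) x ^ 2 ≤ (Real.sqrt C₂ / δ) ^ 2 := by
        rw [div_pow, Real.sq_sqrt hC₂0]
        exact hC₂ δ hδ
      calc ENNReal.ofReal δ * eLpNorm (fun x => divergence (G.field r δ) x) 2 (volume.restrict Ω)
          ≤ ENNReal.ofReal δ * ENNReal.ofReal (Real.sqrt C₂ / δ) :=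
            mul_le_mul_right (eLpNorm_two_restrict_le
              (hcont.memLp_of_hasCompactSupport hcs) hle (by positivity)) _
        _ = ENNReal.ofReal (Real.sqrt C₂) := by
            rw [← ENNReal.ofReal_mul hδ.le, mul_div_cancel₀ _ hδ.ne']
        _ ≤ _ := ENNReal.ofReal_le_ofReal (by linarith [abs_nonneg C₁, abs_nonneg C₃])
    · rw [hA]; exact ENNReal.ofReal_ne_top
    · rw [hA, hG.energy_eq, ENNReal.toReal_ofReal (integral_nonneg fun x =>
        WeightedDigraph.IsJetSystem.energyDensity_nonneg hδ _ x),
        ENNReal.toReal_ofReal (Finset.sum_nonneg fun e he => mul_nonneg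
          (Real.rpow_nonneg (G.θ_pos e he).le _) (norm_nonneg _)), Finset.mul_sum]
      simp_rw [← mul_assoc]
      refine b3.trans (mul_le_mul_of_nonneg_right ?_ hδ.le)
      linarith [le_abs_self C₃, abs_nonneg C₁]

end BranchedTransport

end

theorem mainTheorem6 (α : ℝ) (hα : 1 / 2 < α) (hα' : α < 1)
    (Ω : Set BranchedTransport.Plane) (hΩ : IsOpen Ω) (hΩ' : Bornology.IsBounded Ω)
    (G : BranchedTransport.WeightedDigraph Ω) :
    BranchedTransport.MemMdiv Ω G.measure ∧
    BranchedTransport.cZero α ≠ ⊤ ∧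
    BranchedTransport.energy α G.measure ≠ ⊤ ∧
    ∃ (u : ℝ → BranchedTransport.Plane → BranchedTransport.Plane) (C : ℝ),
      (∀ ε > 0, IntegrableOn (u ε) Ω ∧
        BranchedTransport.MemMdiv Ω (BranchedTransport.fieldMeasure Ω (u ε))) ∧
      BranchedTransport.TendstoMdiv Ω (𝓝[>] (0 : ℝ))
        (fun ε => BranchedTransport.fieldMeasure Ω (u ε)) G.measure ∧
      ∀ᶠ ε in 𝓝[>] (0 : ℝ),
        ∃ D : BranchedTransport.Plane → Matrix (Fin 2) (Fin 2) ℝ,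
          BranchedTransport.MemH10 Ω (u ε) D ∧
          (∫⁻ x in Ω, ‖u ε x‖ₑ) ≤
            G.measure.variation Ω +
              ENNReal.ofReal (C * ε ^ BranchedTransport.gammaExp α) ∧
          (∫⁻ x in Ω, ‖∑ i, D x i i‖ₑ) ≤
            (BranchedTransport.weakDiv Ω G.measure).variation Ω ∧
          ENNReal.ofReal (ε ^ BranchedTransport.gammaExp α) *
              eLpNorm (fun x => ∑ i, D x i i) 2 (volume.restrict Ω) ≤ ENNReal.ofReal C ∧
          BranchedTransport.approxEnergy α ε Ω (u ε) ≠ ⊤ ∧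
          |(BranchedTransport.approxEnergy α ε Ω (u ε)).toReal -
              (BranchedTransport.cZero α).toReal *
                (BranchedTransport.energy α G.measure).toReal| ≤
            C * ε ^ BranchedTransport.gammaExp α := by
  -- All the quantities in the conclusion depend on the graph only through its measure, so it may be
  -- replaced by one without overlapping edges.
  obtain ⟨G', hm, hG'⟩ := G.exists_isSimple
  refine ⟨G.memMdiv, (BranchedTransport.cZero_and_edgeProfiles hα hα').1, ?_, ?_⟩
  · rw [← hm, hG'.energy_eq]
    exact ENNReal.ofReal_ne_top
  · rw [← hm]
    exact hG'.exists_approximation hα hα' hΩ hΩ'
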